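/- Let $n,N\ge 0$ be integers, $\Omega\subset\mathbb R^n$ open, $0<T<\infty$, $Q_T=(0,T)\times\Omega$. Let $D$ denote either the gradient, $Du=\nabla u$, or (if $N=n$) the symmetric gradient, $Du=\varepsilon u=\frac12(\nabla u+(\nabla u)^T)$. Let $\mu\ge 0$, let $F:\Omega\times\mathbb R^{N\times n}\to\mathbb R$ be measurable with $F(x,0)=0$ and $F(x,\cdot)\in C^{0,1}_{\rm loc}(\mathbb R^{N\times n})\cap C^2(\mathbb R^{N\times n}\setminus\{0\})$, and put $A(x,Q)=D_QF(x,Q)$. We write $g\sim h$ if $cg\le h\le Cg$ with constants $c,C>0$. Assume one of the following, for all $x\in\Omega$ and all $P,Q$ (in the conditions on $D_QA$: $Q\ne0$). ($p$-growth) $1<p<\infty$, $\varphi(t)=t^p$, $V(Q)=(\mu^2+|Q|^2)^{\frac{p-2}4}Q$, and $\lambda(|Q|^2+\mu^2)^{\frac{p-2}2}|Q|^2\le A(x,Q)\cdot Q$, $\;|A(x,Q)|\le\Lambda(|Q|^2+\mu^2)^{\frac{p-2}2}|Q|$, $\;(A(x,Q)-A(x,P))\cdot(Q-P)\sim|V(Q)-V(P)|^2$,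 $\;|D_xA(x,Q)|\le c(|Q|^2+\mu^2)^{\frac{p-2}2}|Q|$, $\;D_QA(x,Q)P\cdot P\sim|P|^2(\mu^2+|Q|^2)^{\frac{p-2}2}$. (Orlicz growth) $\varphi\in C^2((0,\infty),(0,\infty))\cap C^1([0,\infty),[0,\infty))$ is convex, $\varphi'(0)=0$, $\varphi'(t)>0$ and $\varphi''(t)t^2\sim\varphi(t)$ for $t>0$; $V(Q)=\sqrt{\varphi'(|Q|+\mu)/(|Q|+\mu)}\,Q$, and $\lambda\frac{\varphi'(|Q|+\mu)}{|Q|+\mu}|Q|^2\le A(x,Q)\cdot Q$, $\;|A(x,Q)|\le\Lambda\varphi''(|Q|+\mu)|Q|$, $\;(A(x,Q)-A(x,P))\cdot(Q-P)\sim|V(Q)-V(P)|^2$, $\;|D_xA(x,Q)|\le c\,\varphi'(|Q|+\mu)$, $\;D_QA(x,Q)P\cdot P\sim|P|^2\varphi''(|Q|+\mu)$. If $D=\varepsilon$, assume also that $A(x,Q)$ is symmetric for symmetric $Q$. The constants in these assumptions (including $p$ and $\mu$) are called the characteristics of $F$. Let $\varphi^*(t)=\sup_{a>0}(at-\varphi(a))$,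 let $V^{1,\varphi}_0(\Omega)$ be the closure of $C_c^\infty(\Omega)$ with respect to $\|\nabla\cdot\|_{L^\varphi(\Omega)}$ and $V^{1,\varphi}_{0,\operatorname{div}}(\Omega)$ that of the divergence-free functions in $C^\infty_c(\Omega)$. Let $u_0\in L^2(\Omega)$ and $f\in L^{\varphi^*}((0,T),(V^{1,\varphi}_0(\Omega))^*)\cap W^{1,2}((0,T),L^2(\Omega))$. Let $u$ be a weak solution of the system $$u_t-\operatorname{div}A(x,Du)=f\ \text{in }Q_T,\qquad u=0\ \text{on }(0,T)\times\partial\Omega,\qquad u(0)=u_0,$$ or, with $N=n$ and $D=\varepsilon$, of the Stokes system $$u_t-\operatorname{div}A(x,\varepsilon u)+\nabla\pi=f,\quad\operatorname{div}u=0\ \text{in }Q_T,\qquad u=0\ \text{on }(0,T)\times\partial\Omega,\qquad u(0)=u_0.$$ That is: $u\in L^\varphi((0,T),V^{1,\varphi}_0(\Omega))\cap L^\infty((0,T),L^2(\Omega))$ (with $V^{1,\varphi}_{0,\operatorname{div}}$ for the Stokes system), and $$-\int_{Q_T}u\cdot\partial_t\xi+\int_{Q_T}A(x,Du)\cdot D\xi-\int_\Omega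 u_0\cdot\xi(0)=\int_{Q_T}f\cdot\xi$$ for all $\xi\in C_c^\infty((-\infty,T)\times\Omega)$ (with $\operatorname{div}\xi=0$ for the Stokes system). Membership of $u$ in the solution space is understood as follows: there are $\psi_j\in C_c^\infty(\mathbb R\times\Omega)$ (divergence-free for the Stokes system) with $\psi_j\to u$ in $L^2(Q_T)$, $\nabla\psi_j\to\nabla u$ in $L^\varphi(Q_T)$, and $\int_{Q_T}\varphi_\mu(|D\psi_j-Du|)\to0$, where $\varphi_\mu(s)=\frac{\varphi'(s+\mu)}{s+\mu}s^2$; the last condition follows from the previous one if $\mu=0$ or $|\Omega|<\infty$. Then $u$ has a weak time derivative $u_t$ in $Q_T$, and for every $a>0$ it belongs to $\mathcal N^{\frac12,2}((a,T-a),L^2(\Omega))$ with $$\|u_t\|_{\mathcal N^{\frac12,2}((a,T-a),L^2(\Omega))}\le\frac K{a^2},$$ where $$\|g\|^2_{\mathcal N^{\frac12,2}((a,b),L^2(\Omega))}=\sup_{h>0}\int_a^{b-h}\Big\|\frac{g(t+h)-g(t)}{h^{1/2}}\Big\|_{L^2(\Omega)}^2dt+\int_a^b\|g(t)\|^2_{L^2(\Omega)}dt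 .$$ The constant $K$ depends only on $n$, $N$, which of the systems is considered, the characteristics of $F$, $T$, and upper bounds for $\|f\|_{L^2(Q_T)}$, $\|f_t\|_{L^2(Q_T)}$ and $\|u_0\|_{L^2(\Omega)}$; in particular not on $\Omega$, $a$, $u$, nor otherwise on $F$, $f$, $u_0$. -/

import Mathlib

open MeasureTheory Set Filter Topology
open scoped ENNReal NNReal ContDiff

noncomputable section

namespace DegParabolic

/-- Points of `ℝⁿ` and values in `ℝᴺ`, with the Euclidean norm. -/
abbrev Vec (n : ℕ) : Type := EuclideanSpace ℝ (Fin n)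

/-- Gradients of maps `ℝⁿ → ℝᴺ`, with the Frobenius inner product; the entry `(i, j)` is `∂ⱼ uᵢ`. -/
abbrev Mat (n N : ℕ) : Type := EuclideanSpace ℝ (Fin N × Fin n)

/-- The transposed matrix. -/
def transpose {n : ℕ} (Q : Mat n n) : Mat n n := WithLp.toLp 2 fun ij => Q (ij.2, ij.1)

/-- The symmetric part `(Q + Qᵀ) / 2`. -/
def symPart {n : ℕ} (Q : Mat n n) : Mat n n := (2⁻¹ : ℝ) • (Q + transpose Q)

/-- The three problems: the parabolic system with `D = ∇`, the parabolic system with the symmetric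
gradient `D = ε`, and the generalized Stokes system (`D = ε`, solenoidal fields). -/
inductive SystemKind : ℕ → ℕ → Type
  | fullGradient (n N : ℕ) : SystemKind n N
  | symGradient (n : ℕ) : SystemKind n n
  | stokes (n : ℕ) : SystemKind n n

/-- The pointwise operation turning `∇u` into `Du`. -/
def SystemKind.D : {n N : ℕ} → SystemKind n N → Mat n N → Mat n N
  | _, _, .fullGradient _ _ => fun Q => Q
  | _, _, .symGradient _ => symPart
  | _, _, .stokes _ => symPart

/-- Spatial gradient of a smooth function of `(t, x)`. -/
def spaceGrad {n N : ℕ} (ξ : ℝ × Vec n → Vec N) (z : ℝ × Vec n) : Mat n N :=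
  WithLp.toLp 2 fun ij => (fderiv ℝ (fun y => ξ (z.1, y)) z.2 (EuclideanSpace.single ij.2 1)) ij.1

/-- Time derivative of a smooth function of `(t, x)`. -/
def timeDeriv {n N : ℕ} (ξ : ℝ × Vec n → Vec N) (z : ℝ × Vec n) : Vec N :=
  deriv (fun s => ξ (s, z.2)) z.1

/-- The constraint on test functions: `div ξ = 0` for the Stokes system, none otherwise. -/
def SystemKind.Constraint :
    {n N : ℕ} → SystemKind n N → (ℝ × Vec n → Vec N) → Prop
  | _, _, .fullGradient _ _ => fun _ => True
  | _, _, .symGradient _ => fun _ => True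
  | _, _, .stokes _ => fun ξ => ∀ z, ∑ i, spaceGrad ξ z (i, i) = 0

/-- Smooth functions of `(t, x)` with compact support contained in `I × Ω`. -/
structure IsTest {n N : ℕ} (I : Set ℝ) (Ω : Set (Vec n)) (ξ : ℝ × Vec n → Vec N) : Prop where
  smooth : ContDiff ℝ ∞ ξ
  compact : HasCompactSupport ξ
  support : tsupport ξ ⊆ I ×ˢ Ω

/-- The space-time cylinder `(0,T) × Ω`. -/
def cylinder {n : ℕ} (T : ℝ) (Ω : Set (Vec n)) : Set (ℝ × Vec n) := Ioo 0 T ×ˢ Ω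

/-! ### Orlicz functions -/

/-- `φ'` on `[0, ∞)`. -/
def dφ (φ : ℝ → ℝ) (t : ℝ) : ℝ := derivWithin φ (Ici 0) t

/-- `φ''` on `(0, ∞)`. -/
def ddφ (φ : ℝ → ℝ) (t : ℝ) : ℝ := deriv (deriv φ) t

/-- The assumptions on the Orlicz function, with `φ''(t) t² ∼ φ(t)` with constants `d₁`, `d₂`. -/
structure OrliczFunction (d₁ d₂ : ℝ) (φ : ℝ → ℝ) : Prop where
  contDiffOn_two : ContDiffOn ℝ 2 φ (Ioi 0)
  contDiffOn_one : ContDiffOn ℝ 1 φ (Ici 0)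
  nonneg : ∀ t, 0 ≤ t → 0 ≤ φ t
  pos : ∀ t, 0 < t → 0 < φ t
  convexOn : ConvexOn ℝ (Ici 0) φ
  deriv_zero : dφ φ 0 = 0
  deriv_pos : ∀ t, 0 < t → 0 < dφ φ t
  d₁_pos : 0 < d₁
  lower : ∀ t, 0 < t → d₁ * φ t ≤ ddφ φ t * t ^ 2
  upper : ∀ t, 0 < t → ddφ φ t * t ^ 2 ≤ d₂ * φ t

/-- The conjugate function `φ*(t) = sup_{a > 0} (a t - φ(a))`. -/
def conj (φ : ℝ → ℝ) (t : ℝ) : ℝ≥0∞ := ⨆ (a : ℝ) (_ : 0 < a), ENNReal.ofReal (a * t - φ a)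

/-- The Luxemburg norm of `v` in `L^φ(Ω)`. -/
def luxemburgNorm {n : ℕ} {X : Type*} [NormedAddCommGroup X] (φ : ℝ → ℝ) (Ω : Set (Vec n))
    (v : Vec n → X) : ℝ≥0∞ :=
  ⨅ (r : ℝ) (_ : 0 < r) (_ : ∫⁻ x in Ω, ENNReal.ofReal (φ (‖v x‖ / r)) ≤ 1), ENNReal.ofReal r

/-! ### Growth assumptions on `F` -/

/-- The stress `A(x, Q) = D_Q F(x, Q)`. -/
def stress {n N : ℕ} (F : Vec n → Mat n N → ℝ) (x : Vec n) (Q : Mat n N) : Mat n N :=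
  gradient (F x) Q

/-- The constants in the growth assumptions. -/
structure Characteristics where
  /-- the shift -/
  μ : ℝ
  /-- coercivity constant -/
  lam : ℝ
  /-- growth constant -/
  Lam : ℝ
  /-- lower constant in the monotonicity assumption -/
  cV : ℝ
  /-- upper constant in the monotonicity assumption -/
  CV : ℝ
  /-- constant in the bound of `D_x A` -/
  cx : ℝ
  /-- lower constant in the ellipticity assumption -/
  cQ : ℝ
  /-- upper constant in the ellipticity assumption -/
  CQ : ℝ

/-- Admissible signs of the constants. -/
structure Characteristics.Valid (χ : Characteristics) : Prop where
  μ_nonneg : 0 ≤ χ.μ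
  lam_pos : 0 < χ.lam
  cV_pos : 0 < χ.cV
  cQ_pos : 0 < χ.cQ

/-- The part of the assumptions common to `p`-growth and Orlicz growth. -/
structure BasicAssumption {n N : ℕ} (Ω : Set (Vec n)) (F : Vec n → Mat n N → ℝ) : Prop where
  measurable : Measurable fun z : Vec n × Mat n N => F z.1 z.2
  lipschitz : ∀ x ∈ Ω, LocallyLipschitz (F x)
  contDiffOn : ∀ x ∈ Ω, ContDiffOn ℝ 2 (F x) {0}ᶜ
  zero : ∀ x ∈ Ω, F x 0 = 0

/-- `V(Q) = (μ² + |Q|²)^{(p-2)/4} Q`. -/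
def Vp {n N : ℕ} (p μ : ℝ) (Q : Mat n N) : Mat n N := ((μ ^ 2 + ‖Q‖ ^ 2) ^ ((p - 2) / 4)) • Q

/-- `p`-growth. The bound on `D_x A` is stated as a local Lipschitz bound on segments in `Ω`, which
covers classical as well as weak derivatives. -/
structure PGrowth {n N : ℕ} (p : ℝ) (χ : Characteristics) (Ω : Set (Vec n))
    (F : Vec n → Mat n N → ℝ) : Prop where
  one_lt : 1 < p
  valid : χ.Valid
  basic : BasicAssumption Ω F
  coercive : ∀ x ∈ Ω, ∀ Q : Mat n N,
    χ.lam * (‖Q‖ ^ 2 + χ.μ ^ 2) ^ ((p - 2) / 2) * ‖Q‖ ^ 2 ≤ inner ℝ (stress F x Q) Q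
  growth : ∀ x ∈ Ω, ∀ Q : Mat n N,
    ‖stress F x Q‖ ≤ χ.Lam * (‖Q‖ ^ 2 + χ.μ ^ 2) ^ ((p - 2) / 2) * ‖Q‖
  monotone_lower : ∀ x ∈ Ω, ∀ Q P : Mat n N,
    χ.cV * ‖Vp p χ.μ Q - Vp p χ.μ P‖ ^ 2 ≤ inner ℝ (stress F x Q - stress F x P) (Q - P)
  monotone_upper : ∀ x ∈ Ω, ∀ Q P : Mat n N,
    inner ℝ (stress F x Q - stress F x P) (Q - P) ≤ χ.CV * ‖Vp p χ.μ Q - Vp p χ.μ P‖ ^ 2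
  space_deriv : ∀ x ∈ Ω, ∀ y ∈ Ω, segment ℝ x y ⊆ Ω → ∀ Q : Mat n N,
    ‖stress F x Q - stress F y Q‖ ≤
      χ.cx * (‖Q‖ ^ 2 + χ.μ ^ 2) ^ ((p - 2) / 2) * ‖Q‖ * ‖x - y‖
  elliptic_lower : ∀ x ∈ Ω, ∀ Q P : Mat n N, Q ≠ 0 →
    χ.cQ * (‖P‖ ^ 2 * (χ.μ ^ 2 + ‖Q‖ ^ 2) ^ ((p - 2) / 2)) ≤
      inner ℝ (fderiv ℝ (stress F x) Q P) P
  elliptic_upper : ∀ x ∈ Ω, ∀ Q P : Mat n N, Q ≠ 0 →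
    inner ℝ (fderiv ℝ (stress F x) Q P) P ≤
      χ.CQ * (‖P‖ ^ 2 * (χ.μ ^ 2 + ‖Q‖ ^ 2) ^ ((p - 2) / 2))

/-- `V(Q) = (φ'(|Q| + μ) / (|Q| + μ))^{1/2} Q`. -/
def Vφ {n N : ℕ} (φ : ℝ → ℝ) (μ : ℝ) (Q : Mat n N) : Mat n N :=
  Real.sqrt (dφ φ (‖Q‖ + μ) / (‖Q‖ + μ)) • Q

/-- Orlicz growth. -/
structure OrliczGrowth {n N : ℕ} (φ : ℝ → ℝ) (χ : Characteristics) (Ω : Set (Vec n))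
    (F : Vec n → Mat n N → ℝ) : Prop where
  valid : χ.Valid
  basic : BasicAssumption Ω F
  coercive : ∀ x ∈ Ω, ∀ Q : Mat n N,
    χ.lam * (dφ φ (‖Q‖ + χ.μ) / (‖Q‖ + χ.μ)) * ‖Q‖ ^ 2 ≤ inner ℝ (stress F x Q) Q
  growth : ∀ x ∈ Ω, ∀ Q : Mat n N, ‖stress F x Q‖ ≤ χ.Lam * ddφ φ (‖Q‖ + χ.μ) * ‖Q‖
  monotone_lower : ∀ x ∈ Ω, ∀ Q P : Mat n N,
    χ.cV * ‖Vφ φ χ.μ Q - Vφ φ χ.μ P‖ ^ 2 ≤ inner ℝ (stress F x Q - stress F x P) (Q - P)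
  monotone_upper : ∀ x ∈ Ω, ∀ Q P : Mat n N,
    inner ℝ (stress F x Q - stress F x P) (Q - P) ≤ χ.CV * ‖Vφ φ χ.μ Q - Vφ φ χ.μ P‖ ^ 2
  space_deriv : ∀ x ∈ Ω, ∀ y ∈ Ω, segment ℝ x y ⊆ Ω → ∀ Q : Mat n N,
    ‖stress F x Q - stress F y Q‖ ≤ χ.cx * dφ φ (‖Q‖ + χ.μ) * ‖x - y‖
  elliptic_lower : ∀ x ∈ Ω, ∀ Q P : Mat n N, Q ≠ 0 →
    χ.cQ * (‖P‖ ^ 2 * ddφ φ (‖Q‖ + χ.μ)) ≤ inner ℝ (fderiv ℝ (stress F x) Q P) P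
  elliptic_upper : ∀ x ∈ Ω, ∀ Q P : Mat n N, Q ≠ 0 →
    inner ℝ (fderiv ℝ (stress F x) Q P) P ≤ χ.CQ * (‖P‖ ^ 2 * ddφ φ (‖Q‖ + χ.μ))

/-- The additional symmetry assumption, made only when the symmetric gradient is considered:
`A(x, Q)` is symmetric for symmetric `Q`. -/
def SystemKind.StressSymm : {n N : ℕ} → SystemKind n N → Set (Vec n) →
    (Vec n → Mat n N → ℝ) → Prop
  | _, _, .fullGradient _ _ => fun _ _ => True
  | _, _, .symGradient _ => fun Ω F =>
      ∀ x ∈ Ω, ∀ Q, transpose Q = Q → transpose (stress F x Q) = stress F x Q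
  | _, _, .stokes _ => fun Ω F =>
      ∀ x ∈ Ω, ∀ Q, transpose Q = Q → transpose (stress F x Q) = stress F x Q

/-! ### Function spaces -/

/-- `g` is the weak time derivative of `f` in `(0,T) × Ω`. -/
def IsWeakTimeDeriv {n N : ℕ} (T : ℝ) (Ω : Set (Vec n)) (f g : ℝ × Vec n → Vec N) : Prop :=
  ∀ ζ : ℝ × Vec n → Vec N, IsTest (Ioo 0 T) Ω ζ →
    ∫ z in cylinder T Ω, inner ℝ (f z) (timeDeriv ζ z) = -∫ z in cylinder T Ω, inner ℝ (g z) (ζ z)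

/-- `f ∈ W^{1,2}((0,T), L²(Ω))` with `∂ₜ f = g`. -/
structure MemW12 {n N : ℕ} (T : ℝ) (Ω : Set (Vec n)) (f g : ℝ × Vec n → Vec N) : Prop where
  memLp : MemLp f 2 (volume.restrict (cylinder T Ω))
  memLp_deriv : MemLp g 2 (volume.restrict (cylinder T Ω))
  weakDeriv : IsWeakTimeDeriv T Ω f g

/-- `f ∈ L^{φ*}((0,T), (V₀^{1,φ}(Ω))*)`: the functional `ψ ↦ ∫_Ω f(t) · ψ`, given on the dense
subspace `C_c^∞(Ω)`, has dual norm at most `g(t)` for almost every `t`, and `∫₀ᵀ φ*(g) < ∞`. -/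
def MemDualOrlicz {n N : ℕ} (φ : ℝ → ℝ) (T : ℝ) (Ω : Set (Vec n))
    (f : ℝ × Vec n → Vec N) : Prop :=
  ∃ g : ℝ → ℝ, Measurable g ∧ (∀ t, 0 ≤ g t) ∧ ∫⁻ t in Ioo 0 T, conj φ (g t) < ⊤ ∧
    ∀ᵐ t ∂(volume.restrict (Ioo 0 T)), ∀ ψ : Vec n → Vec N, ContDiff ℝ ∞ ψ →
      HasCompactSupport ψ → tsupport ψ ⊆ Ω →
      ENNReal.ofReal |∫ x in Ω, inner ℝ (f (t, x)) (ψ x)| ≤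
        ENNReal.ofReal (g t) *
          luxemburgNorm φ Ω (fun x => spaceGrad (fun z : ℝ × Vec n => ψ z.2) (t, x))

/-- `u ∈ L^φ((0,T), V₀^{1,φ}(Ω)) ∩ L^∞((0,T), L²(Ω))` with `∇u = G`; for the Stokes system
`V₀^{1,φ}` is replaced by the closure of the solenoidal functions.
The space is the closure of the smooth functions with compact support in `ℝ × Ω`, in `L²` for the
functions and in `L^φ` for the gradients. Modular convergence is convergence in norm as `φ` is
doubling. The condition `energy` says that the convergence also takes place in the energy of the
system; it follows from the condition `gradient` if `μ = 0` or `Ω` has finite measure. -/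
structure InSolutionSpace {n N : ℕ} (k : SystemKind n N) (φ : ℝ → ℝ) (μ T : ℝ)
    (Ω : Set (Vec n)) (u : ℝ × Vec n → Vec N) (G : ℝ × Vec n → Mat n N) : Prop where
  measurable : AEStronglyMeasurable u (volume.restrict (cylinder T Ω))
  measurable_grad : AEStronglyMeasurable G (volume.restrict (cylinder T Ω))
  bounded : ∃ C : ℝ≥0, ∀ᵐ t ∂(volume.restrict (Ioo 0 T)),
    eLpNorm (fun x => u (t, x)) 2 (volume.restrict Ω) ≤ C
  approx : ∃ ψ : ℕ → ℝ × Vec n → Vec N,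
    (∀ j, IsTest univ Ω (ψ j) ∧ k.Constraint (ψ j)) ∧
    -- convergence in `L²`
    Tendsto (fun j => eLpNorm (ψ j - u) 2 (volume.restrict (cylinder T Ω))) atTop (𝓝 0) ∧
    -- `gradient`: convergence of the gradients in `L^φ`
    Tendsto (fun j => ∫⁻ z in cylinder T Ω, ENNReal.ofReal (φ ‖spaceGrad (ψ j) z - G z‖))
      atTop (𝓝 0) ∧
    -- `energy`: convergence with respect to `s ↦ φ'(s + μ) s² / (s + μ)`
    Tendsto (fun j => ∫⁻ z in cylinder T Ω,
      ENNReal.ofReal (dφ φ (‖k.D (spaceGrad (ψ j) z - G z)‖ + μ) /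
        (‖k.D (spaceGrad (ψ j) z - G z)‖ + μ) * ‖k.D (spaceGrad (ψ j) z - G z)‖ ^ 2))
      atTop (𝓝 0)

/-- `u`, with spatial gradient `G`, is a weak solution with initial value `u₀` and force `f`. For
the Stokes system the test functions are solenoidal, which removes the pressure. -/
structure IsWeakSolution {n N : ℕ} (k : SystemKind n N) (φ : ℝ → ℝ) (μ T : ℝ) (Ω : Set (Vec n))
    (F : Vec n → Mat n N → ℝ) (f : ℝ × Vec n → Vec N) (u₀ : Vec n → Vec N)
    (u : ℝ × Vec n → Vec N) (G : ℝ × Vec n → Mat n N) : Prop where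
  mem : InSolutionSpace k φ μ T Ω u G
  weak : ∀ ξ : ℝ × Vec n → Vec N, IsTest (Iio T) Ω ξ → k.Constraint ξ →
    -(∫ z in cylinder T Ω, inner ℝ (u z) (timeDeriv ξ z))
      + (∫ z in cylinder T Ω, inner ℝ (stress F z.2 (k.D (G z))) (k.D (spaceGrad ξ z)))
      - (∫ x in Ω, inner ℝ (u₀ x) (ξ (0, x)))
    = ∫ z in cylinder T Ω, inner ℝ (f z) (ξ z)

/-- The norm of the Bochner–Nikolskij space `N^{α,q}((a,b), L²(Ω))`:
`‖g‖^q = sup_{h>0} ∫ₐ^{b-h} ‖(g(t+h) - g(t)) / h^α‖^q dt + ∫ₐᵇ ‖g(t)‖^q dt`. -/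
def nikolskijNorm {n N : ℕ} (α q a b : ℝ) (Ω : Set (Vec n)) (g : ℝ × Vec n → Vec N) : ℝ≥0∞ :=
  ((⨆ (h : ℝ) (_ : 0 < h), ∫⁻ t in Ioo a (b - h),
      (eLpNorm (fun x => g (t + h, x) - g (t, x)) 2 (volume.restrict Ω)
        / ENNReal.ofReal (h ^ α)) ^ q)
    + ∫⁻ t in Ioo a b, (eLpNorm (fun x => g (t, x)) 2 (volume.restrict Ω)) ^ q) ^ (1 / q)

end DegParabolic

end

noncomputable section

namespace DegParabolic

/-! ### Convex potentials with monotone gradient -/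

section Subgradient

variable {E : Type*} [NormedAddCommGroup E] [InnerProductSpace ℝ E] [CompleteSpace E]

/-! Only a convex structure of the system enters. Monotonicity of the stress makes `F(x, ·)` convex
with subgradient `A(x, ·)` (`subgradient_of_monotone`), and the growth conditions bound `A(x, Q) ·
Q` by a doubling density `m(|Q|)`. No strong monotonicity, no second derivative in space and no
regularity in `x` is needed: all estimates compare the solution with its own time translates. The
constants therefore depend only on `T` and on the bound `M` of the data.

The solution is read as a curve `U` in `L²(Ω)`. A time derivative is not yet available, but for
almost all `t₁, t₂, s` the equation reads `⟨U(t₂) - U(t₁), U(s)⟩ = ∫ r(τ, s) dτ` over `(t₁, t₂)`,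
where `r(τ, s) = -a(τ, s) + ⟨f(τ), U(s)⟩` and `a(τ, s)` pairs the stress at time `τ` with `Du(s)`
(`weak_section`). Thus sections of the solution at other times are admissible test elements.
Continuity of translations in energy turns this into the chain rule `norm_sq_sub_norm_sq_eq` for
`‖U‖²` and for the squared norm of the increments of `U`.

Let `E(t, s) = ⟨A(Du(t)) - A(Du(s)), Du(t) - Du(s)⟩ ≥ 0`, let `X(h, c)` be the integral of `‖U(t +
h) - U(t)‖²` over `(c, T - h)` and `EE(h, c)` that of `E(t + h, t)`. Two inequalities feed each
other. The energy identity for increments gives `EE(h, 2c) ≲ X(h, c) / c + c h²` (`EE_le`).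
Conversely, the equation on `(t, t + h)` tested with `U(t + h) - U(t)`, together with convexity,
leaves a telescoping difference of the potential plus values of `E`, so that `X(h, 2c) ≲ h² / c + h
sup_{g < h} EE(g, c) + h²` (`X_le_of_EE_le`). Starting from `X = O(1)`, two rounds give `X =
O((h/c)²)` and one more application of the first inequality gives `EE = O(h² / c³)`.

For second differences the equations on two adjacent intervals are subtracted and tested with the
second difference itself. The potential values now cancel around a cycle of four times and only `E`
remains, hence `∫ ‖U(t + 2h) - 2U(t + h) + U(t)‖² = O((h/c)³)` (`integral_W2_sq_le`,
`exists_const_evolution`).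

Finally, the difference quotients with steps `2h` and `h` differ by a second difference over `2h`,
which is `O(h^{1/2})` in `L²`. The quotients with steps `h / 2^k` thus converge geometrically to the
weak derivative `u_t`, with error `O(h^{1/2})`. An increment of `u_t` over time `h` equals a second
difference over `h` up to two such errors, which is the Nikolskij bound of order one half
(`DifferenceBounds.nikolskijNorm_le`). -/

/-- Mean value theorem along a segment whose interior avoids the origin. -/
theorem exists_inner_eq_sub_of_hasGradientAt {F : E → ℝ} {A : E → E} (hF : Continuous F)
    (hd : ∀ Q, Q ≠ 0 → HasGradientAt F (A Q) Q) (P Q : E)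
    (h0 : ∀ t ∈ Ioo (0 : ℝ) 1, P + t • (Q - P) ≠ 0) :
    ∃ t ∈ Ioo (0 : ℝ) 1, F Q - F P = inner ℝ (A (P + t • (Q - P))) (Q - P) := by
  have hg : ∀ t ∈ Ioo (0 : ℝ) 1, HasDerivAt (fun t : ℝ => F (P + t • (Q - P)))
      (inner ℝ (A (P + t • (Q - P))) (Q - P)) t := by
    intro t ht
    have h1 := (hd _ (h0 t ht)).hasFDerivAt
    have h2 : HasDerivAt (fun t : ℝ => P + t • (Q - P)) (Q - P) t := by
      simpa using ((hasDerivAt_id t).smul_const (Q - P)).const_add P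
    exact (h1.comp_hasDerivAt t h2).congr_deriv (by simp)
  obtain ⟨t, ht, h⟩ := exists_hasDerivAt_eq_slope (fun t : ℝ => F (P + t • (Q - P)))
    (fun t => inner ℝ (A (P + t • (Q - P))) (Q - P)) zero_lt_one
    (by fun_prop) hg
  exact ⟨t, ht, by rw [h]; simp⟩

/-- A continuous function, differentiable away from the origin with a monotone gradient field `A`,
satisfies the subgradient inequality with `A`. -/
theorem subgradient_of_monotone {F : E → ℝ} {A : E → E} (hF : Continuous F)
    (hd : ∀ Q, Q ≠ 0 → HasGradientAt F (A Q) Q)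
    (hA : ∀ Q P, 0 ≤ inner ℝ (A Q - A P) (Q - P)) (P Q : E) :
    F P + inner ℝ (A P) (Q - P) ≤ F Q := by
  have key : ∀ P Q : E, (∀ t ∈ Ioo (0 : ℝ) 1, P + t • (Q - P) ≠ 0) →
      F P + inner ℝ (A P) (Q - P) ≤ F Q := by
    intro P Q h0
    obtain ⟨t, ht, h⟩ := exists_inner_eq_sub_of_hasGradientAt hF hd P Q h0
    have h1 := hA (P + t • (Q - P)) P
    rw [add_sub_cancel_left, inner_smul_right, inner_sub_left] at h1
    have := nonneg_of_mul_nonneg_right h1 ht.1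
    linarith
  by_cases h0 : ∀ t ∈ Ioo (0 : ℝ) 1, P + t • (Q - P) ≠ 0
  · exact key P Q h0
  push Not at h0
  obtain ⟨t, ht, h0⟩ := h0
  have hP : P = -(t / (1 - t)) • Q := by
    have h1 : (1 - t) • P = -(t • Q) := by
      rw [sub_smul, one_smul, eq_neg_iff_add_eq_zero, ← h0, smul_sub]; abel
    have h2 : (1 - t) ≠ 0 := by linarith [ht.2]
    rw [← inv_smul_smul₀ h2 P, h1, neg_smul, smul_neg, smul_smul, div_eq_inv_mul]
  by_cases hQ : Q = 0
  · have : P = 0 := by rw [hP, hQ, smul_zero]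
    rw [this, hQ]; simp
  have h1 := key P 0 (fun s hs => by
    intro h
    have hP0 : P = 0 := by
      have : (1 - s) • P = 0 := by rw [sub_smul, one_smul, ← h, zero_sub, smul_neg]; abel
      exact (smul_eq_zero.1 this).resolve_left (by linarith [hs.2])
    rw [hP0] at hP
    have := smul_eq_zero.1 hP.symm
    have ht' : 0 < t / (1 - t) := div_pos ht.1 (by linarith [ht.2])
    rcases this with h | h
    · linarith
    · exact hQ h)
  obtain ⟨s, hs, h2⟩ := exists_inner_eq_sub_of_hasGradientAt hF hd 0 Q (fun s hs => by
    simpa using ⟨hs.1.ne', hQ⟩)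
  have h3 := hA (0 + s • (Q - 0)) P
  -- The intermediate point `sQ` differs from `P` by a positive multiple of `Q`, so monotonicity
  -- compares the slope on the second half with `A P`.
  have h4 : 0 + s • (Q - 0) - P = (s + t / (1 - t)) • Q := by
    rw [hP]; simp [add_smul]
  rw [h4, inner_smul_right, inner_sub_left] at h3
  have h5 := nonneg_of_mul_nonneg_right h3 (add_pos hs.1 (div_pos ht.1 (by linarith [ht.2])))
  simp only [sub_zero, zero_sub, inner_neg_right, inner_sub_right] at h1 h2 h5 ⊢
  linarith

end Subgradient

/-! ### Modular functions -/

/-- The properties of the energy density `m` that the regularity theory uses. -/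
structure Modular (m : ℝ → ℝ) : Prop where
  continuousOn : ContinuousOn m (Ici 0)
  zero : m 0 = 0
  nonneg : ∀ s, 0 ≤ s → 0 ≤ m s
  mono : ∀ s t, 0 ≤ s → s ≤ t → m s ≤ m t
  scale : ∀ l : ℝ, 1 ≤ l → ∃ C : ℝ, 0 ≤ C ∧ ∀ s, 0 ≤ s → m (l * s) ≤ C * m s

/-- Monotonicity and doubling replace the triangle inequality, since `s + t ≤ 2 max(s, t)`. -/
theorem Modular.exists_add_le {m : ℝ → ℝ} (hm : Modular m) :
    ∃ C : ℝ, 0 ≤ C ∧ ∀ s t, 0 ≤ s → 0 ≤ t → m (s + t) ≤ C * (m s + m t) := by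
  obtain ⟨C, hC, h⟩ := hm.scale 2 one_le_two
  refine ⟨C, hC, fun s t hs ht => ?_⟩
  have hs' := hm.nonneg s hs
  have ht' := hm.nonneg t ht
  rcases le_total s t with hst | hst
  · calc m (s + t) ≤ m (2 * t) := hm.mono _ _ (by positivity) (by linarith)
      _ ≤ C * m t := h t ht
      _ ≤ _ := by gcongr; linarith
  · calc m (s + t) ≤ m (2 * s) := hm.mono _ _ (by positivity) (by linarith)
      _ ≤ C * m s := h s hs
      _ ≤ _ := by gcongr; linarith

theorem Modular.exists_norm_add_le {m : ℝ → ℝ} (hm : Modular m) (E : Type*)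
    [SeminormedAddCommGroup E] :
    ∃ C : ℝ, 0 ≤ C ∧ ∀ v w : E, m ‖v + w‖ ≤ C * (m ‖v‖ + m ‖w‖) := by
  obtain ⟨C, hC, h⟩ := hm.exists_add_le
  exact ⟨C, hC, fun v w => (hm.mono _ _ (norm_nonneg _) (norm_add_le v w)).trans
    (h _ _ (norm_nonneg _) (norm_nonneg _))⟩

theorem Modular.continuous_norm {m : ℝ → ℝ} (hm : Modular m) (E : Type*)
    [SeminormedAddCommGroup E] : Continuous fun v : E => m ‖v‖ :=
  hm.continuousOn.comp_continuous _root_.continuous_norm fun v => norm_nonneg v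

/-- What the growth assumptions say about the potential `F` and its gradient. -/
structure ConvexStress {n N : ℕ} (Ω : Set (Vec n)) (F : Vec n → Mat n N → ℝ) (m : ℝ → ℝ) :
    Prop where
  measurable : Measurable fun z : Vec n × Mat n N => F z.1 z.2
  zero : ∀ x ∈ Ω, F x 0 = 0
  stress_zero : ∀ x ∈ Ω, stress F x 0 = 0
  hasGradientAt : ∀ x ∈ Ω, ∀ Q : Mat n N, Q ≠ 0 → HasGradientAt (F x) (stress F x Q) Q
  subgradient : ∀ x ∈ Ω, ∀ P Q : Mat n N, F x P + inner ℝ (stress F x P) (Q - P) ≤ F x Q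
  exists_bound : ∃ C : ℝ, 0 ≤ C ∧ ∀ x ∈ Ω, ∀ Q : Mat n N, inner ℝ (stress F x Q) Q ≤ C * m ‖Q‖

/-- Since the stress vanishes at `0`, the origin is a minimum of the convex function `F x`, with
value zero. -/
theorem ConvexStress.nonneg {n N : ℕ} {Ω : Set (Vec n)} {F : Vec n → Mat n N → ℝ} {m : ℝ → ℝ}
    (h : ConvexStress Ω F m) {x : Vec n} (hx : x ∈ Ω) (Q : Mat n N) : 0 ≤ F x Q := by
  have := h.subgradient x hx 0 Q
  simpa [h.zero x hx, h.stress_zero x hx] using this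

theorem ConvexStress.le_inner {n N : ℕ} {Ω : Set (Vec n)} {F : Vec n → Mat n N → ℝ} {m : ℝ → ℝ}
    (h : ConvexStress Ω F m) {x : Vec n} (hx : x ∈ Ω) (Q : Mat n N) :
    F x Q ≤ inner ℝ (stress F x Q) Q := by
  have := h.subgradient x hx Q 0
  simp only [zero_sub, inner_neg_right, h.zero x hx] at this
  linarith

/-- Young's inequality for the pairing with the stress. -/
theorem ConvexStress.exists_young {n N : ℕ} {Ω : Set (Vec n)} {F : Vec n → Mat n N → ℝ}
    {m : ℝ → ℝ} (h : ConvexStress Ω F m) (hm : Modular m) {δ : ℝ} (hδ : 0 < δ) :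
    ∃ C : ℝ, 0 ≤ C ∧ ∀ x ∈ Ω, ∀ Q w : Mat n N,
      |inner ℝ (stress F x Q) w| ≤ δ * m ‖Q‖ + C * m ‖w‖ := by
  obtain ⟨C₀, hC₀, hb⟩ := h.exists_bound
  -- The subgradient inequality is used with `w / ε` in place of `w`: after multiplication by `ε`
  -- the term in `Q` carries `ε C₀ ≤ δ`, and doubling absorbs the factor `1 / ε` inside `m`.
  set ε : ℝ := min 1 (δ / (C₀ + 1)) with hε
  have hε0 : 0 < ε := by positivity
  have hε1 : ε ≤ 1 := min_le_left _ _
  have hεC : ε * C₀ ≤ δ := by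
    have : ε ≤ δ / (C₀ + 1) := min_le_right _ _
    rw [le_div_iff₀ (by positivity)] at this
    nlinarith
  obtain ⟨C, hC, hs⟩ := hm.scale ε⁻¹ ((one_le_inv₀ hε0).2 hε1)
  refine ⟨ε * C₀ * C, by positivity, fun x hx Q w => ?_⟩
  have key : ∀ w : Mat n N, inner ℝ (stress F x Q) w ≤ δ * m ‖Q‖ + ε * C₀ * C * m ‖w‖ := by
    intro w
    have h1 := h.subgradient x hx Q (ε⁻¹ • w)
    have h2 := h.nonneg hx Q
    have h3 := (h.le_inner hx (ε⁻¹ • w)).trans (hb x hx _)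
    have h4 := hs ‖w‖ (norm_nonneg w)
    rw [norm_smul, Real.norm_of_nonneg (inv_nonneg.2 hε0.le)] at h3
    rw [inner_sub_right, inner_smul_right] at h1
    have h5 := hb x hx Q
    have h6 : ε⁻¹ * inner ℝ (stress F x Q) w ≤ C₀ * m ‖Q‖ + C₀ * (C * m ‖w‖) := by
      have := mul_le_mul_of_nonneg_left h4 hC₀
      linarith
    have h7 := mul_le_mul_of_nonneg_left h6 hε0.le
    rw [mul_inv_cancel_left₀ hε0.ne'] at h7
    have h8 := mul_le_mul_of_nonneg_right hεC (hm.nonneg ‖Q‖ (norm_nonneg _))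
    nlinarith
  rw [abs_le]
  refine ⟨?_, key w⟩
  have := key (-w)
  rw [inner_neg_right, norm_neg] at this
  linarith

/-! ### Consequences of the growth assumptions -/

/-- The energy density `m(s) = φ'(s + μ) s² / (s + μ)`. -/
def energyDensity (φ : ℝ → ℝ) (μ s : ℝ) : ℝ := dφ φ (s + μ) / (s + μ) * s ^ 2

/-! ### Orlicz functions: monotonicity, doubling and the energy density. -/

namespace OrliczFunction

variable {d₁ d₂ : ℝ} {φ : ℝ → ℝ}

theorem dφ_eq_deriv {t : ℝ} (ht : 0 < t) : dφ φ t = deriv φ t :=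
  derivWithin_of_mem_nhds (Ici_mem_nhds ht)

theorem hasDerivAt (h : OrliczFunction d₁ d₂ φ) {t : ℝ} (ht : 0 < t) :
    HasDerivAt φ (dφ φ t) t := by
  rw [dφ_eq_deriv ht]
  exact ((h.contDiffOn_two.differentiableOn (by norm_num) t ht).differentiableAt
    (Ioi_mem_nhds ht)).hasDerivAt

theorem hasDerivAt_dφ (h : OrliczFunction d₁ d₂ φ) {t : ℝ} (ht : 0 < t) :
    HasDerivAt (dφ φ) (ddφ φ t) t := by
  have h1 : ContDiffOn ℝ 1 (deriv φ) (Ioi 0) :=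
    ((contDiffOn_succ_iff_deriv_of_isOpen (n := 1) isOpen_Ioi).1 h.contDiffOn_two).2.2
  have h2 : HasDerivAt (deriv φ) (ddφ φ t) t :=
    ((h1.differentiableOn (by norm_num) t ht).differentiableAt (Ioi_mem_nhds ht)).hasDerivAt
  exact h2.congr_of_eventuallyEq ((eventually_gt_nhds ht).mono fun s hs => dφ_eq_deriv hs)

theorem continuousOn_dφ (h : OrliczFunction d₁ d₂ φ) : ContinuousOn (dφ φ) (Ici 0) :=
  h.contDiffOn_one.continuousOn_derivWithin (uniqueDiffOn_Ici 0) le_rfl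

theorem dφ_nonneg (h : OrliczFunction d₁ d₂ φ) {t : ℝ} (ht : 0 ≤ t) : 0 ≤ dφ φ t := by
  rcases ht.eq_or_lt with rfl | ht
  · exact h.deriv_zero.ge
  · exact (h.deriv_pos t ht).le

theorem ddφ_nonneg (h : OrliczFunction d₁ d₂ φ) {t : ℝ} (ht : 0 < t) : 0 ≤ ddφ φ t := by
  have h1 := h.lower t ht
  have h2 : 0 ≤ d₁ * φ t := mul_nonneg h.d₁_pos.le (h.nonneg t ht.le)
  exact nonneg_of_mul_nonneg_left (h2.trans h1) (by positivity)

theorem dφ_mono (h : OrliczFunction d₁ d₂ φ) : MonotoneOn (dφ φ) (Ici 0) := by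
  apply monotoneOn_of_deriv_nonneg (convex_Ici 0) h.continuousOn_dφ
  · intro t ht
    rw [interior_Ici] at ht
    exact (h.hasDerivAt_dφ ht).differentiableAt.differentiableWithinAt
  · intro t ht
    rw [interior_Ici] at ht
    rw [(h.hasDerivAt_dφ ht).deriv]
    exact h.ddφ_nonneg ht

theorem mono (h : OrliczFunction d₁ d₂ φ) : MonotoneOn φ (Ici 0) := by
  apply monotoneOn_of_deriv_nonneg (convex_Ici 0) h.contDiffOn_one.continuousOn
  · intro t ht
    rw [interior_Ici] at ht
    exact (h.hasDerivAt ht).differentiableAt.differentiableWithinAt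
  · intro t ht
    rw [interior_Ici] at ht
    rw [(h.hasDerivAt ht).deriv]
    exact h.dφ_nonneg (le_of_lt ht)

/-- `φ(0) = 0`: otherwise `φ''` would not be integrable at the origin. -/
theorem map_zero (h : OrliczFunction d₁ d₂ φ) : φ 0 = 0 := by
  by_contra hne
  have hpos : 0 < d₁ * φ 0 := mul_pos h.d₁_pos ((h.nonneg 0 le_rfl).lt_of_ne' hne)
  set c := d₁ * φ 0 with hc
  have hder : ∀ t, 0 < t → HasDerivAt (fun t => dφ φ t + c * t⁻¹) (ddφ φ t - c * (t ^ 2)⁻¹) t := by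
    intro t ht
    have h1 := (hasDerivAt_inv ht.ne').const_mul c
    exact ((h.hasDerivAt_dφ ht).add h1).congr_deriv (by ring)
  -- If `φ(0) > 0`, then `φ'' ≥ c / t²`, so `φ' + c / t` is nondecreasing and bounded by `K` on `(0,
  -- 1]`; this fails at `t ≤ c / (2K)`.
  have hmono : MonotoneOn (fun t => dφ φ t + c * t⁻¹) (Ioi 0) := by
    apply monotoneOn_of_deriv_nonneg (convex_Ioi 0)
    · exact fun t ht => (hder t ht).continuousAt.continuousWithinAt
    · intro t ht
      rw [interior_Ioi] at ht
      exact (hder t ht).differentiableAt.differentiableWithinAt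
    · intro t ht
      rw [interior_Ioi] at ht
      rw [(hder t ht).deriv]
      have ht' : (0 : ℝ) < t := ht
      have h1 : c ≤ ddφ φ t * t ^ 2 :=
        (mul_le_mul_of_nonneg_left (h.mono self_mem_Ici ht'.le ht'.le) h.d₁_pos.le).trans
          (h.lower t ht)
      have h2 : c * (t ^ 2)⁻¹ ≤ ddφ φ t := by
        rw [← div_eq_mul_inv, div_le_iff₀ (by positivity)]; exact h1
      linarith
  set K := dφ φ 1 + c with hK
  have hKpos : 0 < K := add_pos_of_nonneg_of_pos (h.dφ_nonneg zero_le_one) hpos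
  set t := min 1 (c / (2 * K)) with ht
  have ht0 : 0 < t := by positivity
  have h1 := hmono ht0 (zero_lt_one : (0 : ℝ) < 1) (min_le_left _ _)
  simp only [inv_one, mul_one] at h1
  have h2 := h.dφ_nonneg ht0.le
  have h3 : c * t⁻¹ ≤ K := by linarith
  rw [← div_eq_mul_inv, div_le_iff₀ ht0] at h3
  have h4 : t ≤ c / (2 * K) := min_le_right _ _
  rw [le_div_iff₀ (by positivity)] at h4
  nlinarith

/-- `t φ''(t) ≤ d₂ φ'(t)`. -/
theorem ddφ_mul_le (h : OrliczFunction d₁ d₂ φ) {t : ℝ} (ht : 0 < t) :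
    ddφ φ t * t ≤ d₂ * dφ φ t := by
  have h1 := h.upper t ht
  have hd₂ : 0 ≤ d₂ := by
    have h2 := h.ddφ_nonneg ht
    exact nonneg_of_mul_nonneg_left ((mul_nonneg h2 (sq_nonneg t)).trans h1) (h.pos t ht)
  -- Mean value theorem on `[0, t]` with `φ(0) = 0`; `φ'` is nondecreasing.
  have h2 : φ t ≤ t * dφ φ t := by
    obtain ⟨s, hs, h3⟩ := exists_hasDerivAt_eq_slope φ (dφ φ) ht
      (h.contDiffOn_one.continuousOn.mono Icc_subset_Ici_self)
      (fun s hs => h.hasDerivAt hs.1)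
    rw [h.map_zero, sub_zero, sub_zero, eq_div_iff ht.ne'] at h3
    rw [← h3, mul_comm]
    exact mul_le_mul_of_nonneg_left (h.dφ_mono hs.1.le ht.le hs.2.le) ht.le
  have h3 : ddφ φ t * t * t ≤ d₂ * dφ φ t * t := by nlinarith
  exact le_of_mul_le_mul_right h3 ht

theorem d₂_nonneg (h : OrliczFunction d₁ d₂ φ) : 0 ≤ d₂ := by
  have h1 := h.upper 1 one_pos
  exact nonneg_of_mul_nonneg_left
    ((mul_nonneg (h.ddφ_nonneg one_pos) (sq_nonneg 1)).trans h1) (h.pos 1 one_pos)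

/-- `φ'` is doubling. -/
theorem dφ_mul_le (h : OrliczFunction d₁ d₂ φ) {l t : ℝ} (hl : 1 ≤ l) (ht : 0 < t) :
    dφ φ (l * t) ≤ l ^ d₂ * dφ φ t := by
  have hder : ∀ t, 0 < t → HasDerivAt (fun t => dφ φ t * t ^ (-d₂))
      (ddφ φ t * t ^ (-d₂) + dφ φ t * (-d₂ * t ^ (-d₂ - 1))) t := fun t ht =>
    (h.hasDerivAt_dφ ht).mul (Real.hasDerivAt_rpow_const (Or.inl ht.ne'))
  -- The bound `t φ'' ≤ d₂ φ'` says exactly that `φ'(t) t ^ (-d₂)` is nonincreasing.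
  have hanti : AntitoneOn (fun t => dφ φ t * t ^ (-d₂)) (Ioi 0) := by
    apply antitoneOn_of_deriv_nonpos (convex_Ioi 0)
    · exact fun t ht => (hder t ht).continuousAt.continuousWithinAt
    · intro t ht
      rw [interior_Ioi] at ht
      exact (hder t ht).differentiableAt.differentiableWithinAt
    · intro t ht
      rw [interior_Ioi] at ht
      rw [(hder t ht).deriv]
      have ht' : (0 : ℝ) < t := ht
      have e : t ^ (-d₂) = t ^ (-d₂ - 1) * t := by
        rw [Real.rpow_sub_one ht'.ne', div_mul_cancel₀ _ ht'.ne']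
      rw [e]
      have h1 := h.ddφ_mul_le ht'
      have h2 : 0 ≤ t ^ (-d₂ - 1) := by positivity
      nlinarith [mul_le_mul_of_nonneg_left h1 h2]
  have hl0 : 0 < l := by linarith
  have hlt : t ≤ l * t := by nlinarith
  have h1 := hanti (show t ∈ Ioi 0 from ht) (show l * t ∈ Ioi 0 from mul_pos hl0 ht) hlt
  simp only at h1
  rw [Real.mul_rpow hl0.le ht.le] at h1
  have h2 : 0 < t ^ (-d₂) := by positivity
  have h3 : dφ φ (l * t) * l ^ (-d₂) ≤ dφ φ t := by
    refine le_of_mul_le_mul_right ?_ h2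
    linarith
  rw [Real.rpow_neg hl0.le, ← div_eq_mul_inv, div_le_iff₀ (by positivity)] at h3
  linarith

theorem energyDensity_eq_zero_left (μ : ℝ) : energyDensity φ μ 0 = 0 := by
  simp [energyDensity]

/-- The energy density of an Orlicz function is a modular. -/
theorem modular (h : OrliczFunction d₁ d₂ φ) {μ : ℝ} (hμ : 0 ≤ μ) :
    Modular (energyDensity φ μ) where
  continuousOn := by
    have hc : ContinuousOn (fun s => dφ φ (s + μ)) (Ici 0) :=
      h.continuousOn_dφ.comp (by fun_prop) (fun s hs => add_nonneg (show (0 : ℝ) ≤ s from hs) hμ)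
    rcases hμ.eq_or_lt with rfl | hμ
    -- For `μ = 0` the quotient is singular at the origin; cancelling one factor `s`, which is
    -- legitimate at `s = 0` because division by zero gives zero, restores continuity.
    · have : EqOn (energyDensity φ 0) (fun s => dφ φ (s + 0) * s) (Ici 0) := by
        intro s _
        simp only [energyDensity, add_zero]
        rcases eq_or_ne s 0 with rfl | hs
        · simp
        · field_simp
      exact (hc.mul continuousOn_id).congr this
    · unfold energyDensity
      refine (hc.div (by fun_prop) fun s hs => ?_).mul (by fun_prop)
      have : (0 : ℝ) ≤ s := hs
      positivity
  zero := energyDensity_eq_zero_left μ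
  nonneg s hs := mul_nonneg (div_nonneg (h.dφ_nonneg (by positivity)) (by positivity))
    (sq_nonneg s)
  mono s t hs hst := by
    rcases hs.eq_or_lt with rfl | hs0
    · rw [energyDensity_eq_zero_left]
      exact mul_nonneg (div_nonneg (h.dφ_nonneg (by positivity)) (by positivity)) (sq_nonneg t)
    have ht0 : 0 < t := hs0.trans_le hst
    have h1 : dφ φ (s + μ) ≤ dφ φ (t + μ) :=
      h.dφ_mono (by simp; positivity) (by simp; positivity) (by linarith)
    -- The density is `φ'(s + μ)` times `s² / (s + μ)`, and both factors are nondecreasing.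
    have h2 : s ^ 2 / (s + μ) ≤ t ^ 2 / (t + μ) := by
      rw [div_le_div_iff₀ (by positivity) (by positivity)]
      nlinarith [mul_nonneg hμ (sub_nonneg.2 hst), mul_pos hs0 ht0,
        mul_nonneg (mul_pos hs0 ht0).le (sub_nonneg.2 hst)]
    have e : ∀ r, energyDensity φ μ r = dφ φ (r + μ) * (r ^ 2 / (r + μ)) := fun r => by
      simp only [energyDensity]; ring
    rw [e, e]
    exact mul_le_mul h1 h2 (by positivity) (h.dφ_nonneg (by positivity))
  scale l hl := by
    have hl0 : 0 < l := by linarith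
    refine ⟨l ^ d₂ * l ^ 2, by positivity, fun s hs => ?_⟩
    rcases hs.eq_or_lt with rfl | hs0
    · simp [energyDensity]
    -- Since `l ≥ 1`, `l s + μ ≤ l (s + μ)`.
    have h1 : dφ φ (l * s + μ) ≤ l ^ d₂ * dφ φ (s + μ) :=
      (h.dφ_mono (by simp; positivity) (by simp; positivity) (by nlinarith)).trans
        (h.dφ_mul_le hl (by positivity : 0 < s + μ))
    have h3 : 0 ≤ dφ φ (s + μ) := h.dφ_nonneg (by positivity)
    simp only [energyDensity]
    calc dφ φ (l * s + μ) / (l * s + μ) * (l * s) ^ 2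
        ≤ (l ^ d₂ * dφ φ (s + μ)) / (s + μ) * (l * s) ^ 2 := by
          gcongr
          nlinarith
      _ = _ := by ring

end OrliczFunction

/-! ### Powers as Orlicz functions. -/

theorem dφ_rpow {p : ℝ} (hp : 1 < p) {t : ℝ} (ht : 0 ≤ t) :
    dφ (fun t => t ^ p) t = p * t ^ (p - 1) :=
  ((Real.hasDerivAt_rpow_const (Or.inr hp.le)).hasDerivWithinAt).derivWithin
    (uniqueDiffOn_Ici 0 t ht)

theorem ddφ_rpow {p : ℝ} (hp : 1 < p) {t : ℝ} (ht : 0 < t) :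
    ddφ (fun t => t ^ p) t = p * ((p - 1) * t ^ (p - 2)) := by
  have h1 : deriv (fun t : ℝ => t ^ p) = fun t => p * t ^ (p - 1) := by
    ext t; exact (Real.hasDerivAt_rpow_const (Or.inr hp.le)).deriv
  rw [ddφ, h1, (((Real.hasDerivAt_rpow_const (Or.inl ht.ne')).const_mul p).deriv)]
  ring_nf

theorem ddφ_rpow_mul_sq {p : ℝ} (hp : 1 < p) {t : ℝ} (ht : 0 < t) :
    ddφ (fun t => t ^ p) t * t ^ 2 = p * (p - 1) * t ^ p := by
  have : t ^ p = t ^ (p - 2) * t ^ 2 := by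
    rw [← Real.rpow_natCast t 2, ← Real.rpow_add ht]; norm_num
  rw [ddφ_rpow hp ht, this]
  ring

/-- The power `t ↦ t ^ p` is an Orlicz function. -/
theorem orliczFunction_rpow {p : ℝ} (hp : 1 < p) :
    OrliczFunction (p * (p - 1)) (p * (p - 1)) (fun t => t ^ p) where
  contDiffOn_two := fun t ht =>
    (Real.contDiffAt_rpow_const_of_ne (ne_of_gt ht)).contDiffWithinAt
  contDiffOn_one := (Real.contDiff_rpow_const_of_le (by exact_mod_cast hp.le)).contDiffOn
  nonneg t ht := Real.rpow_nonneg ht p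
  pos t ht := Real.rpow_pos_of_pos ht p
  convexOn := convexOn_rpow hp.le
  deriv_zero := by
    rw [dφ_rpow hp le_rfl, Real.zero_rpow (by linarith), mul_zero]
  deriv_pos t ht := by rw [dφ_rpow hp ht.le]; positivity
  d₁_pos := by nlinarith
  lower t ht := (ddφ_rpow_mul_sq hp ht).ge
  upper t ht := (ddφ_rpow_mul_sq hp ht).le

/-- `(s² + μ²)^{(p-2)/2} ≤ C (s + μ)^{p-2}`. -/
theorem rpow_sq_add_sq_le {p μ s : ℝ} (hμ : 0 ≤ μ) (hs : 0 < s) :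
    (s ^ 2 + μ ^ 2) ^ ((p - 2) / 2) ≤ (1 + 2 ^ (-((p - 2) / 2))) * (s + μ) ^ (p - 2) := by
  have hsμ : 0 < s + μ := by positivity
  have e : (s + μ) ^ (p - 2) = ((s + μ) ^ 2) ^ ((p - 2) / 2) := by
    rw [← Real.rpow_natCast (s + μ) 2, ← Real.rpow_mul hsμ.le]; congr 1; push_cast; ring
  rw [e]
  set q := (p - 2) / 2
  rcases le_total 0 q with hq | hq
  -- The two sums are comparable, `(s + μ)² / 2 ≤ s² + μ² ≤ (s + μ)²`; the sign of the exponent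
  -- decides which side is used.
  · have h1 : (s ^ 2 + μ ^ 2) ^ q ≤ ((s + μ) ^ 2) ^ q :=
      Real.rpow_le_rpow (by positivity) (by nlinarith) hq
    have h2 : 0 ≤ 2 ^ (-q) * ((s + μ) ^ 2) ^ q := by positivity
    linarith
  · have h1 : (s ^ 2 + μ ^ 2) ^ q ≤ ((s + μ) ^ 2 / 2) ^ q :=
      Real.rpow_le_rpow_of_nonpos (by positivity) (by nlinarith [sq_nonneg (s - μ)]) hq
    rw [Real.div_rpow (by positivity) (by norm_num), div_eq_inv_mul,
      ← Real.rpow_neg (by norm_num)] at h1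
    have h2 : 0 ≤ ((s + μ) ^ 2) ^ q := by positivity
    linarith

/-! ### From the growth assumptions to a convex potential. -/

theorem BasicAssumption.hasGradientAt {n N : ℕ} {Ω : Set (Vec n)} {F : Vec n → Mat n N → ℝ}
    (h : BasicAssumption Ω F) {x : Vec n} (hx : x ∈ Ω) {Q : Mat n N} (hQ : Q ≠ 0) :
    HasGradientAt (F x) (stress F x Q) Q :=
  (((h.contDiffOn x hx).differentiableOn (by norm_num) Q hQ).differentiableAt
    (isOpen_compl_singleton.mem_nhds hQ)).hasGradientAt

/-- Convexity is drawn from monotonicity of the stress alone. The bound is asked for `Q ≠ 0` only,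
because the Orlicz growth condition involves `φ''`, which is controlled away from the origin. -/
theorem BasicAssumption.convexStress {n N : ℕ} {Ω : Set (Vec n)} {F : Vec n → Mat n N → ℝ}
    {m : ℝ → ℝ} (h : BasicAssumption Ω F) (h0 : ∀ x ∈ Ω, stress F x 0 = 0)
    (hmono : ∀ x ∈ Ω, ∀ Q P : Mat n N, 0 ≤ inner ℝ (stress F x Q - stress F x P) (Q - P))
    (hb : ∃ C : ℝ, 0 ≤ C ∧ ∀ x ∈ Ω, ∀ Q : Mat n N, Q ≠ 0 → ‖stress F x Q‖ * ‖Q‖ ≤ C * m ‖Q‖)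
    (hm : m 0 = 0) :
    ConvexStress Ω F m where
  measurable := h.measurable
  zero := h.zero
  stress_zero := h0
  hasGradientAt x hx Q hQ := h.hasGradientAt hx hQ
  subgradient x hx P Q := subgradient_of_monotone (h.lipschitz x hx).continuous
    (fun Q hQ => h.hasGradientAt hx hQ) (hmono x hx) P Q
  exists_bound := by
    obtain ⟨C, hC, hb⟩ := hb
    refine ⟨C, hC, fun x hx Q => ?_⟩
    by_cases hQ : Q = 0
    · simp [hQ, hm]
    · exact (real_inner_le_norm _ _).trans (hb x hx Q hQ)

/-- The inequality `s φ''(s) ≤ d₂ φ'(s)` converts the growth bound, stated with `φ''`, into the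
energy density. At `Q = 0` the growth bound forces the stress to vanish. -/
theorem OrliczGrowth.convexStress {n N : ℕ} {Ω : Set (Vec n)} {F : Vec n → Mat n N → ℝ}
    {φ : ℝ → ℝ} {d₁ d₂ : ℝ} {χ : Characteristics} (hφ : OrliczFunction d₁ d₂ φ)
    (h : OrliczGrowth φ χ Ω F) : ConvexStress Ω F (energyDensity φ χ.μ) := by
  refine h.basic.convexStress (fun x hx => ?_) (fun x hx Q P => ?_)
    ⟨|χ.Lam| * d₂, mul_nonneg (abs_nonneg _) hφ.d₂_nonneg, fun x hx Q hQ => ?_⟩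
    (OrliczFunction.energyDensity_eq_zero_left _)
  · have := h.growth x hx 0
    rw [norm_zero, mul_zero] at this
    exact norm_le_zero_iff.1 this
  · exact (mul_nonneg h.valid.cV_pos.le (sq_nonneg _)).trans (h.monotone_lower x hx Q P)
  · have hQ' : 0 < ‖Q‖ := norm_pos_iff.2 hQ
    have hμ := h.valid.μ_nonneg
    have hs : 0 < ‖Q‖ + χ.μ := by positivity
    have h1 := h.growth x hx Q
    have h2 := hφ.ddφ_mul_le hs
    have h3 : ddφ φ (‖Q‖ + χ.μ) ≤ d₂ * dφ φ (‖Q‖ + χ.μ) / (‖Q‖ + χ.μ) := by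
      rwa [le_div_iff₀ hs]
    have h4 := hφ.ddφ_nonneg hs
    calc ‖stress F x Q‖ * ‖Q‖ ≤ (χ.Lam * ddφ φ (‖Q‖ + χ.μ) * ‖Q‖) * ‖Q‖ := by gcongr
      _ ≤ (|χ.Lam| * ddφ φ (‖Q‖ + χ.μ) * ‖Q‖) * ‖Q‖ := by gcongr; exact le_abs_self _
      _ ≤ (|χ.Lam| * (d₂ * dφ φ (‖Q‖ + χ.μ) / (‖Q‖ + χ.μ)) * ‖Q‖) * ‖Q‖ := by gcongr
      _ = _ := by simp only [energyDensity]; ring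

/-- The `p`-growth case is brought to the same density by comparing `(s² + μ²)^{(p-2)/2}` with `(s +
μ)^{p-2}`. -/
theorem PGrowth.convexStress {n N : ℕ} {Ω : Set (Vec n)} {F : Vec n → Mat n N → ℝ}
    {p : ℝ} {χ : Characteristics} (h : PGrowth p χ Ω F) :
    ConvexStress Ω F (energyDensity (fun t => t ^ p) χ.μ) := by
  have hp := h.one_lt
  refine h.basic.convexStress (fun x hx => ?_) (fun x hx Q P => ?_)
    ⟨|χ.Lam| * ((1 + 2 ^ (-((p - 2) / 2))) * p⁻¹), by positivity, fun x hx Q hQ => ?_⟩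
    (OrliczFunction.energyDensity_eq_zero_left _)
  · have := h.growth x hx 0
    rw [norm_zero, mul_zero] at this
    exact norm_le_zero_iff.1 this
  · exact (mul_nonneg h.valid.cV_pos.le (sq_nonneg _)).trans (h.monotone_lower x hx Q P)
  · have hQ' : 0 < ‖Q‖ := norm_pos_iff.2 hQ
    have hμ := h.valid.μ_nonneg
    have hs : 0 < ‖Q‖ + χ.μ := by positivity
    have h1 := h.growth x hx Q
    have h2 := rpow_sq_add_sq_le (p := p) hμ hQ'
    have e : energyDensity (fun t => t ^ p) χ.μ ‖Q‖ = p * (‖Q‖ + χ.μ) ^ (p - 2) * ‖Q‖ ^ 2 := by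
      rw [energyDensity, dφ_rpow hp hs.le, mul_div_assoc, ← Real.rpow_sub_one hs.ne']
      ring_nf
    calc ‖stress F x Q‖ * ‖Q‖
        ≤ (χ.Lam * (‖Q‖ ^ 2 + χ.μ ^ 2) ^ ((p - 2) / 2) * ‖Q‖) * ‖Q‖ := by gcongr
      _ ≤ (|χ.Lam| * (‖Q‖ ^ 2 + χ.μ ^ 2) ^ ((p - 2) / 2) * ‖Q‖) * ‖Q‖ := by
          gcongr; exact le_abs_self _
      _ ≤ (|χ.Lam| * ((1 + 2 ^ (-((p - 2) / 2))) * (‖Q‖ + χ.μ) ^ (p - 2)) * ‖Q‖) * ‖Q‖ := by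
          gcongr
      _ = _ := by rw [e]; field_simp

/-- The growth assumptions in the form used below. -/
theorem convexStress_of_growth {n N : ℕ} {Ω : Set (Vec n)} {F : Vec n → Mat n N → ℝ}
    {φ : ℝ → ℝ} {p d₁ d₂ : ℝ} {χ : Characteristics}
    (h : (φ = fun t => t ^ p) ∧ PGrowth p χ Ω F ∨ OrliczFunction d₁ d₂ φ ∧ OrliczGrowth φ χ Ω F) :
    Modular (energyDensity φ χ.μ) ∧ ConvexStress Ω F (energyDensity φ χ.μ) := by
  rcases h with ⟨rfl, h⟩ | ⟨hφ, h⟩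
  · exact ⟨(orliczFunction_rpow h.one_lt).modular h.valid.μ_nonneg, h.convexStress⟩
  · exact ⟨hφ.modular h.valid.μ_nonneg, h.convexStress hφ⟩

/-! ### Shifted integrals -/

/-- The shear `(σ, t) ↦ (σ, t + κ(σ))` preserves the product measure. This supplies the dominating
functions for every double integral over a time and a time shift. -/
theorem integrable_comp_add_fst {γ : ℝ → ℝ} (hγ : Integrable γ) (μ : Measure ℝ)
    [IsFiniteMeasure μ] {κ : ℝ → ℝ} (hκ : Measurable κ) :
    Integrable (fun p : ℝ × ℝ => γ (p.2 + κ p.1)) (μ.prod volume) := by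
  have h1 : MeasurePreserving (fun p : ℝ × ℝ => (p.1, p.2 + κ p.1)) (μ.prod volume)
      (μ.prod volume) :=
    (MeasurePreserving.id μ).skew_product (g := fun σ t => t + κ σ) (by fun_prop)
      (ae_of_all _ fun σ => (measurePreserving_add_right volume (κ σ)).map_eq)
  exact h1.integrable_comp_of_integrable (g := fun p : ℝ × ℝ => γ p.2) (hγ.comp_snd μ)

theorem ae_comp_add {p : ℝ → Prop} (hp : ∀ᵐ t : ℝ, p t) (h : ℝ) : ∀ᵐ t : ℝ, p (t + h) :=
  (measurePreserving_add_right volume h).quasiMeasurePreserving.ae hp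

/-- Shifting a nonnegative function can only decrease its integral over a set which the shift maps
into a larger one. -/
theorem setIntegral_comp_add_le {γ : ℝ → ℝ} (hγ : Integrable γ) (h0 : ∀ t, 0 ≤ γ t) {s s' : Set ℝ}
    (hs : MeasurableSet s) (hs' : MeasurableSet s') (h : ℝ) (hss : ∀ t ∈ s, t + h ∈ s') :
    ∫ t in s, γ (t + h) ≤ ∫ t in s', γ t := by
  rw [← integral_indicator hs, ← integral_indicator hs',
    ← integral_add_right_eq_self (s'.indicator γ) h]
  refine integral_mono ((hγ.comp_add_right h).indicator hs)
    ((hγ.indicator hs').comp_add_right h) fun t => ?_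
  by_cases ht : t ∈ s
  · simp [ht, hss t ht]
  · rw [indicator_of_notMem ht]
    exact indicator_nonneg (fun t _ => h0 t) _

/-! ### The chain rule for the squared norm -/

section ChainRule

variable {H : Type*} [NormedAddCommGroup H] [InnerProductSpace ℝ H]

/-- If `⟨V(t₂) - V(t₁), V(s)⟩ = ∫_{t₁}^{t₂} R(τ, s) dτ` for almost all times and `R` is continuous in
the mean in its second argument, then `‖V‖²` has the derivative `2 R(t, t)`. -/
theorem norm_sq_sub_norm_sq_eq {V : ℝ → H} {R θ : ℝ → ℝ → ℝ} {γ : ℝ → ℝ} {S : Set ℝ} {L : ℝ}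
    (hS : ∀ᵐ t : ℝ, t ∈ Ioo 0 L → t ∈ S)
    (hV : Integrable fun t => ‖V t‖ ^ 2)
    (hweak : ∀ t₁ ∈ S, ∀ t₂ ∈ S, ∀ s ∈ S, inner ℝ (V t₂ - V t₁) (V s) = ∫ τ in t₁..t₂, R τ s)
    (hR : Measurable (Function.uncurry R)) (hγ : Integrable γ) (hγ0 : ∀ t, 0 ≤ γ t)
    (hRγ : ∀ t s, |R t s| ≤ γ t + γ s)
    (hθ : Measurable (Function.uncurry θ)) (hθ0 : ∀ t s, 0 ≤ θ t s)
    (hθγ : ∀ t s, θ t s ≤ γ t + γ s) (hθs : ∀ t s, θ t s = θ s t)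
    (hyoung : ∀ δ : ℝ, 0 < δ → ∃ C : ℝ, 0 ≤ C ∧ ∀ τ ∈ S, ∀ s ∈ S, ∀ s' ∈ S,
      |R τ s - R τ s'| ≤ δ * γ τ + C * θ s s')
    (hθt : Tendsto (fun ε => ∫ t in Ioo 0 (L - ε), θ t (t + ε)) (𝓝[>] 0) (𝓝 0)) :
    ∃ Z : Set ℝ, (∀ᵐ t : ℝ, t ∈ Z) ∧ ∀ c ∈ Z, ∀ d ∈ Z, 0 < c → c < d → d < L →
      ‖V d‖ ^ 2 - ‖V c‖ ^ 2 = 2 * ∫ t in c..d, R t t := by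
  set N : ℝ → ℝ := fun t => ‖V t‖ ^ 2 with hN
  -- The admissible end points are the times at which the primitive of `‖V‖²` has derivative `‖V‖²`.
  refine ⟨{x | ∀ c, HasDerivAt (fun x => ∫ t in c..x, N t) (N x) x},
    _root_.LocallyIntegrable.ae_hasDerivAt_integral hV.locallyIntegrable, fun c hc d hd hc0 hcd hdL => ?_⟩
  have hRdiag : Measurable fun t => R t t :=
    hR.comp (measurable_id.prodMk measurable_id)
  have hr : Integrable fun t => R t t :=
    ((hγ.add hγ)).mono' hRdiag.aestronglyMeasurable (ae_of_all _ fun t => hRγ t t)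
  have hR2 : ∀ {X : Type} [MeasurableSpace X] {p q : X → ℝ}, Measurable p → Measurable q →
      Measurable fun x => R (p x) (q x) := fun hp hq => hR.comp (hp.prodMk hq)
  have hθ2 : ∀ {X : Type} [MeasurableSpace X] {p q : X → ℝ}, Measurable p → Measurable q →
      Measurable fun x => θ (p x) (q x) := fun hp hq => hθ.comp (hp.prodMk hq)
  set J : ℝ → ℝ := fun σ => ∫ t in c..d, R (t + σ) (t + σ) with hJ
  have hJcont : Continuous J := by
    have h1 : J = fun σ => (∫ t in (0)..(d + σ), R t t) - ∫ t in (0)..(c + σ), R t t := by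
      ext σ
      rw [hJ]
      simp only
      rw [intervalIntegral.integral_comp_add_right (fun t => R t t) σ,
        intervalIntegral.integral_interval_sub_left hr.intervalIntegrable hr.intervalIntegrable]
    rw [h1]
    have h2 := intervalIntegral.continuous_primitive (fun a b => hr.intervalIntegrable
      (a := a) (b := b)) 0
    exact (h2.comp (by fun_prop)).sub (h2.comp (by fun_prop))
  -- The limit of `D` as `ε → 0` is computed twice: by differentiating the primitive of `‖V‖²` at
  -- `c` and `d`, and by the equation.
  set D : ℝ → ℝ := fun ε => ε⁻¹ * ((∫ t in c..d, N (t + ε)) - ∫ t in c..d, N t) with hD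
  have hDlim : Tendsto D (𝓝[>] 0) (𝓝 (N d - N c)) := by
    have h1 := (hd 0).tendsto_slope_zero_right.sub (hc 0).tendsto_slope_zero_right
    refine h1.congr fun ε => ?_
    simp only [hD, smul_eq_mul]
    rw [intervalIntegral.integral_comp_add_right N ε, ← mul_sub,
      ← intervalIntegral.integral_interval_sub_left (a := 0) (b := d + ε) (c := c + ε)
        hV.intervalIntegrable hV.intervalIntegrable,
      ← intervalIntegral.integral_interval_sub_left (a := 0) (b := d) (c := c)
        hV.intervalIntegrable hV.intervalIntegrable]
    ring
  suffices hD2 : Tendsto D (𝓝[>] 0) (𝓝 (2 * J 0)) by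
    have := tendsto_nhds_unique hDlim hD2
    rw [hN] at this
    simpa [hJ] using this
  rw [Metric.tendsto_nhds]
  intro e he
  set Γ := ∫ t, γ t with hΓ
  have hΓ0 : 0 ≤ Γ := integral_nonneg hγ0
  -- Error budget: the `δ`-part of Young's inequality and the oscillation part cost at most `e/4`
  -- each, and twice the continuity error of `J` costs `e/4`, so `3e/4 < e` in total.
  set δ := e / (8 * (Γ + 1)) with hδ
  have hδ0 : 0 < δ := by positivity
  have hδΓ : 2 * δ * Γ ≤ e / 4 := by
    have : 2 * δ * Γ = e / 4 * (Γ / (Γ + 1)) := by rw [hδ]; field_simp; ring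
    rw [this]
    exact mul_le_of_le_one_right (by positivity) ((div_le_one (by positivity)).2 (by linarith))
  obtain ⟨C, hC, hy⟩ := hyoung δ hδ0
  set η := e / (8 * (C + 1)) with hη
  have hη0 : 0 < η := by positivity
  have hCη : 2 * C * η ≤ e / 4 := by
    have : 2 * C * η = e / 4 * (C / (C + 1)) := by rw [hη]; field_simp; ring
    rw [this]
    exact mul_le_of_le_one_right (by positivity) ((div_le_one (by positivity)).2 (by linarith))
  have hθ1 : ∀ᶠ ε in 𝓝[>] (0 : ℝ), ∫ t in Ioo 0 (L - ε), θ t (t + ε) < η :=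
    hθt.eventually (gt_mem_nhds hη0)
  have hJ1 : ∀ᶠ σ in 𝓝[>] (0 : ℝ), |J σ - J 0| < e / 8 := by
    have := (Metric.tendsto_nhds.1 (hJcont.continuousAt (x := 0)) (e / 8) (by positivity))
    exact nhdsWithin_le_nhds this
  obtain ⟨ε₀, hε₀, hε₀'⟩ := mem_nhdsGT_iff_exists_Ioo_subset.1 (hθ1.and hJ1)
  filter_upwards [Ioo_mem_nhdsGT hε₀, Ioo_mem_nhdsGT (sub_pos.2 hdL)] with ε ⟨hε0, hεε₀⟩ hε1
  have hdε : d + ε < L := by linarith [hε1.2]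
  -- Here `‖V(t+ε)‖² - ‖V(t)‖² = ⟨V(t+ε) - V(t), V(t+ε) + V(t)⟩`, and the equation is tested with
  -- both `V(t+ε)` and `V(t)`.
  have hΘ : ∀ᵐ t : ℝ, t ∈ Ioc c d →
      N (t + ε) - N t = ∫ σ in (0)..ε, (R (t + σ) (t + ε) + R (t + σ) t) := by
    filter_upwards [hS, ae_comp_add hS ε] with t h1 h2 ht
    have h1 := h1 ⟨hc0.trans ht.1, by linarith [ht.2]⟩
    have h2 := h2 ⟨by linarith [ht.1], by linarith [ht.2]⟩
    have h3 := hweak t h1 (t + ε) h2 (t + ε) h2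
    have h4 := hweak t h1 (t + ε) h2 t h1
    have hRi : ∀ s : ℝ, IntervalIntegrable (fun τ => R τ s) volume t (t + ε) := by
      intro s
      have : IntervalIntegrable (fun τ => γ τ + γ s) volume t (t + ε) :=
        hγ.intervalIntegrable.add intervalIntegrable_const
      exact this.mono_fun' (hR.comp (measurable_id.prodMk measurable_const)).aestronglyMeasurable
        (ae_of_all _ fun τ => hRγ τ s)
    have h5 : N (t + ε) - N t = inner ℝ (V (t + ε) - V t) (V (t + ε)) +
        inner ℝ (V (t + ε) - V t) (V t) := by
      simp only [hN, inner_sub_left, ← real_inner_self_eq_norm_sq]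
      rw [real_inner_comm (V t) (V (t + ε))]
      ring
    have h6 : ∀ s : ℝ, ∫ σ in (0)..ε, R (t + σ) s = ∫ τ in t..(t + ε), R τ s := fun s => by
      rw [intervalIntegral.integral_comp_add_left (fun τ => R τ s) t, add_zero]
    have h7 : ∀ s : ℝ, IntervalIntegrable (fun σ => R (t + σ) s) volume 0 ε := fun s => by
      have := (hRi s).comp_add_left (c := t)
      simpa using this
    rw [h5, h3, h4, intervalIntegral.integral_add (h7 _) (h7 _), h6, h6]
  have hint : ∀ κ₁ κ₂ : ℝ → ℝ, Measurable κ₁ → Measurable κ₂ →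
      Integrable (fun p : ℝ × ℝ => R (p.2 + κ₁ p.1) (p.2 + κ₂ p.1))
        ((volume.restrict (Ioc 0 ε)).prod (volume.restrict (Ioc c d))) := by
    intro κ₁ κ₂ h1 h2
    have h3 : Integrable (fun p : ℝ × ℝ => R (p.2 + κ₁ p.1) (p.2 + κ₂ p.1))
        ((volume.restrict (Ioc 0 ε)).prod volume) :=
      ((integrable_comp_add_fst hγ _ h1).add (integrable_comp_add_fst hγ _ h2)).mono'
        (hR2 (by fun_prop) (by fun_prop)).aestronglyMeasurable (ae_of_all _ fun p => hRγ _ _)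
    exact h3.mono_measure (Measure.prod_mono le_rfl Measure.restrict_le_self)
  have hΘi := (hint (fun σ => σ) (fun _ => ε) (by fun_prop) (by fun_prop)).add
    (hint (fun σ => σ) (fun _ => 0) (by fun_prop) (by fun_prop))
  simp only [add_zero, Pi.add_def] at hΘi
  -- Fubini puts the average over `σ ∈ (0, ε)` outside, so a bound uniform in `σ` suffices.
  have hDε : D ε = ε⁻¹ * ∫ σ in (0)..ε, ∫ t in c..d, (R (t + σ) (t + ε) + R (t + σ) t) := by
    simp only [hD]
    rw [← intervalIntegral.integral_sub (hV.comp_add_right ε).intervalIntegrable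
      hV.intervalIntegrable]
    congr 1
    rw [intervalIntegral.integral_of_le hcd.le, intervalIntegral.integral_of_le hε0.le]
    rw [setIntegral_congr_ae measurableSet_Ioc hΘ]
    simp_rw [intervalIntegral.integral_of_le hε0.le, intervalIntegral.integral_of_le hcd.le]
    exact (integral_integral_swap
      (f := fun σ t => R (t + σ) (t + ε) + R (t + σ) t) hΘi).symm
  -- Both terms are compared with the diagonal value at `t + σ`. The second arguments move by `ε -
  -- σ` and `σ`, each in `(0, ε)`, where the translation integral of `θ` is below `η`.
  have hslice : ∀ σ ∈ Ioo 0 ε,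
      |(∫ t in c..d, (R (t + σ) (t + ε) + R (t + σ) t)) - 2 * J 0| ≤ 3 * e / 4 := by
    intro σ hσ
    have hRi : ∀ p q : ℝ, Integrable fun t => R (t + p) (t + q) := fun p q =>
      ((hγ.comp_add_right p).add (hγ.comp_add_right q)).mono'
        (hR2 (by fun_prop) (by fun_prop)).aestronglyMeasurable (ae_of_all _ fun t => hRγ _ _)
    have hθi : ∀ p q : ℝ, Integrable fun t => θ (t + p) (t + q) := fun p q =>
      ((hγ.comp_add_right p).add (hγ.comp_add_right q)).mono'
        (hθ2 (by fun_prop) (by fun_prop)).aestronglyMeasurable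
        (ae_of_all _ fun t => by
          rw [Real.norm_of_nonneg (hθ0 _ _)]; exact hθγ _ _)
    have hRi0 : Integrable fun t => R (t + σ) t := by simpa using hRi σ 0
    have hθi0 : Integrable fun t => θ t (t + σ) := by simpa using hθi 0 σ
    have h1 : |(∫ t in c..d, (R (t + σ) (t + ε) + R (t + σ) t)) - 2 * J σ| ≤
        ∫ t in c..d, (2 * δ * γ (t + σ) + C * (θ (t + σ) (t + ε) + θ t (t + σ))) := by
      rw [hJ]
      simp only
      rw [← intervalIntegral.integral_const_mul, ← intervalIntegral.integral_sub
        ((hRi _ _).fun_add hRi0).intervalIntegrable ((hRi σ σ).const_mul 2).intervalIntegrable,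
        ← Real.norm_eq_abs]
      refine intervalIntegral.norm_integral_le_of_norm_le hcd.le ?_
        ((((hγ.comp_add_right σ).const_mul (2 * δ)).add
          (((hθi _ _).add hθi0).const_mul C)).intervalIntegrable)
      filter_upwards [hS, ae_comp_add hS ε, ae_comp_add hS σ] with t g1 g2 g3 ht
      have g1 := g1 ⟨hc0.trans ht.1, by linarith [ht.2]⟩
      have g2 := g2 ⟨by linarith [ht.1], by linarith [ht.2]⟩
      have g3 := g3 ⟨by linarith [ht.1, hσ.1], by linarith [ht.2, hσ.2]⟩
      have y1 := hy _ g3 _ g2 _ g3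
      have y2 := hy _ g3 _ g1 _ g3
      rw [hθs (t + ε)] at y1
      rw [Real.norm_eq_abs]
      have : R (t + σ) (t + ε) + R (t + σ) t - 2 * R (t + σ) (t + σ) =
        (R (t + σ) (t + ε) - R (t + σ) (t + σ)) + (R (t + σ) t - R (t + σ) (t + σ)) := by ring
      rw [this]
      refine (abs_add_le _ _).trans ?_
      linarith
    have hbd : ∀ e' ∈ Ioo 0 ε, ∫ t in Ioo 0 (L - e'), θ t (t + e') ≤ η := fun e' he' =>
      (hε₀' ⟨he'.1, he'.2.trans hεε₀⟩).1.le
    have w1 : ∫ t in c..d, θ (t + σ) (t + ε) ≤ η := by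
      rw [intervalIntegral.integral_of_le hcd.le]
      have := setIntegral_comp_add_le (γ := fun t => θ t (t + (ε - σ)))
        (by simpa using hθi 0 (ε - σ)) (fun t => hθ0 _ _) (s := Ioc c d)
        (s' := Ioo 0 (L - (ε - σ))) measurableSet_Ioc measurableSet_Ioo σ
        (fun t ht => ⟨by linarith [ht.1, hσ.1], by linarith [ht.2]⟩)
      refine le_trans (le_of_eq ?_) (this.trans (hbd _ ⟨by linarith [hσ.2], by linarith [hσ.1]⟩))
      congr 1; ext t; congr 1; ring
    have w2 : ∫ t in c..d, θ t (t + σ) ≤ η := by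
      rw [intervalIntegral.integral_of_le hcd.le]
      refine (setIntegral_mono_set hθi0.integrableOn (ae_of_all _ fun t => hθ0 _ _)
        (LE.le.eventuallyLE fun t ht => ?_)).trans (hbd σ hσ)
      exact ⟨hc0.trans ht.1, by linarith [ht.2, hσ.2]⟩
    have w3 : ∫ t in c..d, γ (t + σ) ≤ Γ := by
      rw [intervalIntegral.integral_of_le hcd.le]
      have := setIntegral_comp_add_le hγ hγ0 (s := Ioc c d) measurableSet_Ioc MeasurableSet.univ σ
        (fun t _ => mem_univ _)
      rwa [setIntegral_univ] at this
    rw [intervalIntegral.integral_add ((hγ.comp_add_right σ).const_mul (2 * δ)).intervalIntegrable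
      (((hθi _ _).fun_add hθi0).const_mul C).intervalIntegrable,
      intervalIntegral.integral_const_mul, intervalIntegral.integral_const_mul,
      intervalIntegral.integral_add (hθi _ _).intervalIntegrable hθi0.intervalIntegrable] at h1
    have h2 := (hε₀' ⟨hσ.1, hσ.2.trans hεε₀⟩).2
    have h3 : C * ((∫ t in c..d, θ (t + σ) (t + ε)) + ∫ t in c..d, θ t (t + σ)) ≤ C * (η + η) := by
      gcongr
    have h4 : 2 * δ * ∫ t in c..d, γ (t + σ) ≤ 2 * δ * Γ := by gcongr
    rw [abs_le] at h1 ⊢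
    rw [abs_lt] at h2
    constructor <;> linarith [h1.1, h1.2, h2.1, h2.2]
  have hfin : |(∫ σ in (0)..ε, ∫ t in c..d, (R (t + σ) (t + ε) + R (t + σ) t)) - ε * (2 * J 0)| ≤
      3 * e / 4 * ε := by
    have hi : IntervalIntegrable (fun σ => ∫ t in c..d, (R (t + σ) (t + ε) + R (t + σ) t))
        volume 0 ε := by
      rw [intervalIntegrable_iff_integrableOn_Ioc_of_le hε0.le]
      simp_rw [intervalIntegral.integral_of_le hcd.le]
      exact hΘi.integral_prod_left
    have h1 : (∫ σ in (0)..ε, ∫ t in c..d, (R (t + σ) (t + ε) + R (t + σ) t)) - ε * (2 * J 0) =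
        ∫ σ in (0)..ε, ((∫ t in c..d, (R (t + σ) (t + ε) + R (t + σ) t)) - 2 * J 0) := by
      rw [intervalIntegral.integral_sub hi intervalIntegrable_const]
      simp
      ring
    rw [h1, ← Real.norm_eq_abs]
    have h2 := intervalIntegral.norm_integral_le_of_norm_le hε0.le (g := fun _ => 3 * e / 4)
      (f := fun σ => (∫ t in c..d, (R (t + σ) (t + ε) + R (t + σ) t)) - 2 * J 0)
      (μ := volume) (by
        filter_upwards [show ∀ᵐ σ : ℝ, σ ≠ ε by simp [ae_iff, measure_singleton]] with σ h3 h4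
        exact hslice σ ⟨h4.1, lt_of_le_of_ne h4.2 h3⟩) intervalIntegrable_const
    refine h2.trans (le_of_eq ?_)
    simp
    ring
  rw [hDε, Real.dist_eq]
  have : ε⁻¹ * (∫ σ in (0)..ε, ∫ t in c..d, (R (t + σ) (t + ε) + R (t + σ) t)) - 2 * J 0 =
      ε⁻¹ * ((∫ σ in (0)..ε, ∫ t in c..d, (R (t + σ) (t + ε) + R (t + σ) t)) - ε * (2 * J 0)) := by
    field_simp
  rw [this, abs_mul, abs_of_pos (inv_pos.2 hε0), inv_mul_lt_iff₀ hε0]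
  refine hfin.trans_lt ?_
  nlinarith

end ChainRule

/-! ### Selection of good times -/

/-- A function does not exceed its mean everywhere on a set of full measure. Choosing such a
starting time plays the role of a cut-off function in time. -/
theorem exists_mem_Ioo_mul_le {y : ℝ → ℝ} {c d : ℝ} (hcd : c < d) (hy : IntegrableOn y (Ioo c d))
    {p : ℝ → Prop} (hp : ∀ᵐ t : ℝ, t ∈ Ioo c d → p t) :
    ∃ t ∈ Ioo c d, p t ∧ (d - c) * y t ≤ ∫ t in Ioo c d, y t := by
  have hne : volume.restrict (Ioo c d) ≠ 0 := by
    rw [Ne, Measure.restrict_eq_zero, Real.volume_Ioo, ENNReal.ofReal_eq_zero]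
    linarith
  have hN : (volume.restrict (Ioo c d)) {t | ¬ (t ∈ Ioo c d ∧ p t)} = 0 := by
    have h1 : ∀ᵐ t ∂(volume.restrict (Ioo c d)), t ∈ Ioo c d ∧ p t := by
      rw [ae_restrict_iff' measurableSet_Ioo]
      filter_upwards [hp] with t ht hm using ⟨hm, ht hm⟩
    exact h1
  obtain ⟨t, ht, h⟩ := exists_notMem_null_le_average hne hy hN
  simp only [mem_ofPred_eq, not_not] at ht
  refine ⟨t, ht.1, ht.2, ?_⟩
  rw [setAverage_eq, smul_eq_mul, Real.volume_real_Ioo_of_le hcd.le, le_inv_mul_iff₀ (by linarith)]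
    at h
  exact h

/-- An inequality for a continuous function that holds almost everywhere extends to the right
endpoint. -/
theorem le_of_ae_le_of_continuous {P : ℝ → ℝ} (hP : Continuous P) {c L A : ℝ} (hcL : c < L)
    (h : ∀ᵐ t : ℝ, t ∈ Ioo c L → P t ≤ A) : P L ≤ A := by
  by_contra! hlt
  have h1 : ∀ᶠ t in 𝓝[<] L, A < P t :=
    nhdsWithin_le_nhds (hP.continuousAt.eventually (lt_mem_nhds hlt))
  obtain ⟨l, hl, hl'⟩ := mem_nhdsLT_iff_exists_Ioo_subset.1 h1
  have hl0 : l < L := hl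
  obtain ⟨t, ht, hpt, -⟩ := exists_mem_Ioo_mul_le (y := fun _ => 0) (max_lt hl0 hcL)
    integrableOn_zero (p := fun t => P t ≤ A) (by
      filter_upwards [h] with t h ht
      exact h ⟨(le_max_right _ _).trans_lt ht.1, ht.2⟩)
  have h2 : A < P t := hl' ⟨(le_max_left _ _).trans_lt ht.1, ht.2⟩
  linarith

/-- After exchanging the integrals every slice in `σ` contributes at most `B`. The end point `σ = h`
is null, so only shifts strictly between `0` and `h` are needed. -/
theorem setIntegral_intervalIntegral_le {Φ : ℝ → ℝ → ℝ} {h B : ℝ} {s : Set ℝ} (hh : 0 < h)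
    (hΦ : Integrable (Function.uncurry Φ)
      ((volume.restrict (Ioc 0 h)).prod (volume.restrict s)))
    (hB : ∀ σ ∈ Ioo 0 h, ∫ t in s, Φ σ t ≤ B) :
    ∫ t in s, ∫ σ in (0)..h, Φ σ t ≤ h * B := by
  simp_rw [intervalIntegral.integral_of_le hh.le]
  rw [← integral_integral_swap hΦ]
  have h1 : IntegrableOn (fun σ => ∫ t in s, Φ σ t) (Ioc 0 h) := hΦ.integral_prod_left
  calc ∫ σ in Ioc 0 h, ∫ t in s, Φ σ t ≤ ∫ _ in Ioc 0 h, B := by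
        refine setIntegral_mono_on_ae h1 (integrableOn_const (by simp)) measurableSet_Ioc ?_
        filter_upwards [show ∀ᵐ σ : ℝ, σ ≠ h by simp [ae_iff, measure_singleton]] with σ h3 h4
        exact hB σ ⟨h4.1, lt_of_le_of_ne h4.2 h3⟩
    _ = h * B := by simp [hh.le]

/-! ### Abstract evolution equations with convex potential -/

/-- A solution `U` of `U' + A(U) = f` in a Hilbert space, where `A` is the derivative of a convex
potential: `a(t, s)` stands for `⟨A(U(t)), U(s)⟩` and `F(t)` for the potential at `U(t)`. The
relations hold for times in a set `S` of full measure in `(0, T)`; `osc` measures the distance of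
`U(t)` and `U(s)`, `α` dominates all quantities. -/
structure EvolutionData (H : Type*) [NormedAddCommGroup H] [InnerProductSpace ℝ H]
    (T M : ℝ) where
  (U f g : ℝ → H)
  (u₀ : H)
  (a osc : ℝ → ℝ → ℝ)
  (F α : ℝ → ℝ)
  (S : Set ℝ)
  T_pos : 0 < T
  S_subset : S ⊆ Ioo 0 T
  S_ae : ∀ᵐ t : ℝ, t ∈ Ioo 0 T → t ∈ S
  U_meas : StronglyMeasurable U
  f_meas : StronglyMeasurable f
  g_meas : StronglyMeasurable g
  α_nonneg : ∀ t, 0 ≤ α t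
  α_int : Integrable α
  U_sq_le : ∀ t, ‖U t‖ ^ 2 ≤ α t
  f_sq_le : ∀ t, ‖f t‖ ^ 2 ≤ α t
  g_sq_le : ∀ t, ‖g t‖ ^ 2 ≤ α t
  U_off : ∀ t, t ∉ S → U t = 0
  u₀_le : ‖u₀‖ ^ 2 ≤ M ^ 2
  f_le : ∫ t, ‖f t‖ ^ 2 ≤ M ^ 2
  g_le : ∫ t, ‖g t‖ ^ 2 ≤ M ^ 2
  a_meas : Measurable (Function.uncurry a)
  a_le : ∀ t s, |a t s| ≤ α t + α s
  a_off_left : ∀ t s, t ∉ S → a t s = 0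
  a_off_right : ∀ t s, s ∉ S → a t s = 0
  F_meas : Measurable F
  F_nonneg : ∀ t, 0 ≤ F t
  F_le : ∀ t, F t ≤ a t t
  subgradient : ∀ t ∈ S, ∀ s ∈ S, a t s - a t t ≤ F s - F t
  osc_meas : Measurable (Function.uncurry osc)
  osc_nonneg : ∀ t s, 0 ≤ osc t s
  osc_le : ∀ t s, osc t s ≤ α t + α s
  osc_symm : ∀ t s, osc t s = osc s t
  U_sub_le : ∀ t ∈ S, ∀ s ∈ S, ‖U t - U s‖ ^ 2 ≤ osc t s
  young : ∀ δ : ℝ, 0 < δ → ∃ C : ℝ, 0 ≤ C ∧ ∀ τ ∈ S, ∀ s ∈ S, ∀ s' ∈ S,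
    |a τ s - a τ s'| ≤ δ * α τ + C * osc s s'
  osc_tendsto : Tendsto (fun ε => ∫ t in Ioo 0 (T - ε), osc t (t + ε)) (𝓝[>] 0) (𝓝 0)
  weak : ∀ t ∈ S, ∀ s ∈ S,
    inner ℝ (U t - u₀) (U s) = ∫ τ in (0)..t, (-a τ s + inner ℝ (f τ) (U s))
  weak_f : ∀ t₁ ∈ S, ∀ t₂ ∈ S, ∀ s ∈ S,
    inner ℝ (f t₂ - f t₁) (U s) = ∫ τ in t₁..t₂, inner ℝ (g τ) (U s)

namespace EvolutionData

variable {H : Type*} [NormedAddCommGroup H] [InnerProductSpace ℝ H] {T M : ℝ}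
  (D : EvolutionData H T M)

/-- The right-hand side `⟨f(t) - A(U(t)), U(s)⟩`. -/
def r (t s : ℝ) : ℝ := -D.a t s + inner ℝ (D.f t) (D.U s)

/-- The symmetrized distance `⟨A(U(t)) - A(U(s)), U(t) - U(s)⟩`. -/
def E (t s : ℝ) : ℝ := D.a t t - D.a t s - D.a s t + D.a s s

theorem E_symm (t s : ℝ) : D.E t s = D.E s t := by simp only [E]; ring

theorem E_abs_le (t s : ℝ) : |D.E t s| ≤ 4 * (D.α t + D.α s) := by
  have h1 := abs_le.1 (D.a_le t t)
  have h2 := abs_le.1 (D.a_le t s)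
  have h3 := abs_le.1 (D.a_le s t)
  have h4 := abs_le.1 (D.a_le s s)
  rw [E, abs_le]
  constructor <;> linarith [h1.1, h1.2, h2.1, h2.2, h3.1, h3.2, h4.1, h4.2]

theorem a_self_nonneg (t : ℝ) : 0 ≤ D.a t t := (D.F_nonneg t).trans (D.F_le t)

/-- The two subgradient inequalities between `t` and `s` add up to this. If one time is not in `S`,
the mixed terms vanish and only nonnegative diagonal terms remain. -/
theorem E_nonneg (t s : ℝ) : 0 ≤ D.E t s := by
  by_cases ht : t ∈ D.S
  · by_cases hs : s ∈ D.S
    · have h1 := D.subgradient t ht s hs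
      have h2 := D.subgradient s hs t ht
      simp only [E]
      linarith
    · simp [E, D.a_off_left s _ hs, D.a_off_right _ s hs, D.a_self_nonneg]
  · simp [E, D.a_off_left t _ ht, D.a_off_right _ t ht, D.a_self_nonneg]

/-- Three-point inequality. -/
theorem a_sub_le {t s τ : ℝ} (ht : t ∈ D.S) (hs : s ∈ D.S) (hτ : τ ∈ D.S) :
    D.a τ t - D.a τ s ≤ D.F t - D.F s + D.E s τ := by
  -- Going from `s` through `τ` to `t`, the potential at `τ` cancels and the remaining pairings are
  -- exactly `E s τ`.
  have h1 := D.subgradient τ hτ t ht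
  have h2 := D.subgradient s hs τ hτ
  simp only [E]
  linarith

/-- Four-point inequality. -/
theorem a_sub_a_le {p q t s : ℝ} (hp : p ∈ D.S) (hq : q ∈ D.S) (ht : t ∈ D.S) (hs : s ∈ D.S) :
    (D.a p t - D.a p s) - (D.a q t - D.a q s) ≤ D.E t q + D.E s p := by
  -- The four inequalities run around the cycle `p, t, q, s`, so all values of the potential cancel.
  have h1 := D.subgradient p hp t ht
  have h2 := D.subgradient s hs p hp
  have h3 := D.subgradient q hq s hs
  have h4 := D.subgradient t ht q hq
  simp only [E]
  linarith

theorem measurable_E : Measurable (Function.uncurry D.E) := by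
  have h : ∀ {p q : ℝ × ℝ → ℝ}, Measurable p → Measurable q →
      Measurable fun x => D.a (p x) (q x) := fun hp hq => D.a_meas.comp (hp.prodMk hq)
  exact (((h measurable_fst measurable_fst).sub (h measurable_fst measurable_snd)).sub
    (h measurable_snd measurable_fst)).add (h measurable_snd measurable_snd)

theorem measurable_r : Measurable (Function.uncurry D.r) := by
  have h1 : StronglyMeasurable fun p : ℝ × ℝ => D.f p.1 := D.f_meas.comp_measurable measurable_fst
  have h2 : StronglyMeasurable fun p : ℝ × ℝ => D.U p.2 := D.U_meas.comp_measurable measurable_snd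
  exact D.a_meas.neg.add (h1.inner h2).measurable

theorem integrable_E_prod {κ₁ κ₂ : ℝ → ℝ} (h1 : Measurable κ₁) (h2 : Measurable κ₂)
    (μ : Measure ℝ) [IsFiniteMeasure μ] (s : Set ℝ) :
    Integrable (fun p : ℝ × ℝ => D.E (p.2 + κ₁ p.1) (p.2 + κ₂ p.1))
      (μ.prod (volume.restrict s)) := by
  have h3 : Integrable (fun p : ℝ × ℝ => D.E (p.2 + κ₁ p.1) (p.2 + κ₂ p.1)) (μ.prod volume) :=
    (((integrable_comp_add_fst D.α_int _ h1).add
      (integrable_comp_add_fst D.α_int _ h2)).const_mul 4).mono'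
      (D.measurable_E.comp (Measurable.prodMk (by fun_prop) (by fun_prop))).aestronglyMeasurable
      (ae_of_all _ fun p => D.E_abs_le _ _)
  exact h3.mono_measure (Measure.prod_mono le_rfl Measure.restrict_le_self)

theorem integrable_E (p q : ℝ) : Integrable fun t => D.E (t + p) (t + q) :=
  (((D.α_int.comp_add_right p).add (D.α_int.comp_add_right q)).const_mul 4).mono'
    (D.measurable_E.comp (Measurable.prodMk (by fun_prop) (by fun_prop))).aestronglyMeasurable
    (ae_of_all _ fun p => D.E_abs_le _ _)

theorem integrable_a_diag : Integrable fun t => D.a t t :=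
  (D.α_int.add D.α_int).mono' (D.a_meas.comp (measurable_id.prodMk measurable_id)).aestronglyMeasurable
    (ae_of_all _ fun t => D.a_le t t)

theorem integrable_F : Integrable D.F :=
  D.integrable_a_diag.mono' D.F_meas.aestronglyMeasurable
    (ae_of_all _ fun t => by rw [Real.norm_of_nonneg (D.F_nonneg t)]; exact D.F_le t)

theorem integrable_sq {V : ℝ → H} (hV : StronglyMeasurable V) (h : ∀ t, ‖V t‖ ^ 2 ≤ D.α t) :
    Integrable fun t => ‖V t‖ ^ 2 :=
  D.α_int.mono' (hV.norm.pow 2).aestronglyMeasurable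
    (ae_of_all _ fun t => by rw [Real.norm_of_nonneg (by positivity)]; exact h t)

theorem integrable_U_sq : Integrable fun t => ‖D.U t‖ ^ 2 := D.integrable_sq D.U_meas D.U_sq_le
theorem integrable_f_sq : Integrable fun t => ‖D.f t‖ ^ 2 := D.integrable_sq D.f_meas D.f_sq_le
theorem integrable_g_sq : Integrable fun t => ‖D.g t‖ ^ 2 := D.integrable_sq D.g_meas D.g_sq_le

theorem abs_inner_le_weighted (x y : H) {l : ℝ} (hl : 0 < l) :
    |inner ℝ x y| ≤ (l * ‖x‖ ^ 2 + l⁻¹ * ‖y‖ ^ 2) / 2 := by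
  have h1 := abs_real_inner_le_norm x y
  have h2 : 0 ≤ l⁻¹ * (l * ‖x‖ - ‖y‖) ^ 2 := by positivity
  have h3 : l⁻¹ * (l * ‖x‖ - ‖y‖) ^ 2 = l * ‖x‖ ^ 2 + l⁻¹ * ‖y‖ ^ 2 - 2 * (‖x‖ * ‖y‖) := by
    field_simp; ring
  linarith

theorem r_abs_le (t s : ℝ) : |D.r t s| ≤ 2 * D.α t + 2 * D.α s := by
  have h1 := abs_le.1 (D.a_le t s)
  have h2 := abs_le.1 (abs_inner_le_weighted (D.f t) (D.U s) one_pos)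
  rw [inv_one, one_mul, one_mul] at h2
  have h3 := D.f_sq_le t
  have h4 := D.U_sq_le s
  have h5 := D.α_nonneg t
  have h6 := D.α_nonneg s
  rw [r, abs_le]
  constructor <;> linarith [h1.1, h1.2, h2.1, h2.2]

/-- The force contributes `δ ‖f‖² + δ⁻¹ ‖U(s) - U(s')‖²` up to constants, and the last norm is part
of `osc`. -/
theorem r_young (δ : ℝ) (hδ : 0 < δ) : ∃ C : ℝ, 0 ≤ C ∧ ∀ τ ∈ D.S, ∀ s ∈ D.S, ∀ s' ∈ D.S,
    |D.r τ s - D.r τ s'| ≤ δ * D.α τ + C * D.osc s s' := by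
  obtain ⟨C, hC, h⟩ := D.young (δ / 2) (by positivity)
  refine ⟨C + δ⁻¹, by positivity, fun τ hτ s hs s' hs' => ?_⟩
  have h1 := h τ hτ s hs s' hs'
  have h2 := abs_inner_le_weighted (D.f τ) (D.U s - D.U s') hδ
  have h3 := mul_le_mul_of_nonneg_left (D.f_sq_le τ) hδ.le
  have h4 := mul_le_mul_of_nonneg_left (D.U_sub_le s hs s' hs') (inv_nonneg.2 hδ.le)
  have h5 : 0 ≤ δ⁻¹ * D.osc s s' := mul_nonneg (inv_nonneg.2 hδ.le) (D.osc_nonneg _ _)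
  have e : D.r τ s - D.r τ s' = -(D.a τ s - D.a τ s') + inner ℝ (D.f τ) (D.U s - D.U s') := by
    simp only [r, inner_sub_right]; ring
  rw [e]
  refine (abs_add_le _ _).trans ?_
  rw [abs_neg]
  linarith

theorem intervalIntegrable_r (s x y : ℝ) : IntervalIntegrable (fun τ => D.r τ s) volume x y := by
  have h1 : IntervalIntegrable (fun τ => 2 * D.α τ + 2 * D.α s) volume x y :=
    (D.α_int.const_mul 2).intervalIntegrable.add intervalIntegrable_const
  exact h1.mono_fun' (D.measurable_r.comp (measurable_id.prodMk measurable_const)).aestronglyMeasurable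
    (ae_of_all _ fun τ => D.r_abs_le τ s)

theorem integrable_r_diag : Integrable fun t => D.r t t :=
  ((D.α_int.const_mul 2).add (D.α_int.const_mul 2)).mono'
    (D.measurable_r.comp (measurable_id.prodMk measurable_id)).aestronglyMeasurable
    (ae_of_all _ fun t => D.r_abs_le t t)

theorem weak_sub {t₁ t₂ s : ℝ} (h₁ : t₁ ∈ D.S) (h₂ : t₂ ∈ D.S) (hs : s ∈ D.S) :
    inner ℝ (D.U t₂ - D.U t₁) (D.U s) = ∫ τ in t₁..t₂, D.r τ s := by
  have h3 := D.weak t₁ h₁ s hs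
  have h4 := D.weak t₂ h₂ s hs
  have h5 := intervalIntegral.integral_interval_sub_left (D.intervalIntegrable_r s 0 t₂)
    (D.intervalIntegrable_r s 0 t₁)
  rw [← h5]
  simp only [r]
  rw [← h3, ← h4, ← inner_sub_left]
  congr 1
  abel

/-! #### The energy estimate -/

theorem exists_energy_eq : ∃ Z : Set ℝ, (∀ᵐ t : ℝ, t ∈ Z) ∧ ∀ c ∈ Z, ∀ d ∈ Z, 0 < c → c < d → d < T →
    ‖D.U d‖ ^ 2 - ‖D.U c‖ ^ 2 = 2 * ∫ t in c..d, D.r t t := by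
  have h2α : ∀ t, D.α t ≤ 2 * D.α t := fun t => by linarith [D.α_nonneg t]
  exact norm_sq_sub_norm_sq_eq (R := D.r) (θ := D.osc) (γ := fun t => 2 * D.α t) D.S_ae
    D.integrable_U_sq (fun t₁ h₁ t₂ h₂ s hs => D.weak_sub h₁ h₂ hs) D.measurable_r
    (D.α_int.const_mul 2) (fun t => by linarith [D.α_nonneg t]) D.r_abs_le D.osc_meas D.osc_nonneg
    (fun t s => (D.osc_le t s).trans (add_le_add (h2α t) (h2α s))) D.osc_symm
    (fun δ hδ => by
      obtain ⟨C, hC, h⟩ := D.r_young δ hδ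
      exact ⟨C, hC, fun τ hτ s hs s' hs' => (h τ hτ s hs s' hs').trans (by
        have := mul_le_mul_of_nonneg_left (h2α τ) hδ.le
        linarith)⟩) D.osc_tendsto

/-- The energy identity holds only from positive times, and the initial value is attained only
weakly. At small good times `c` the equation tested with `U(c)` together with `‖U(c)‖² ≤ ‖u₀‖² +
2⟨U(c) - u₀, U(c)⟩` bridges the gap, with an error tending to zero. -/
theorem ae_energy_le : ∀ᵐ d : ℝ, d ∈ Ioo 0 T →
    ‖D.U d‖ ^ 2 ≤ M ^ 2 + 2 * ∫ t in (0)..d, D.r t t := by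
  obtain ⟨Z, hZ, hE⟩ := D.exists_energy_eq
  filter_upwards [hZ] with d hd hdT
  set γ : ℝ → ℝ := fun t => 2 * D.α t with hγ
  have hγi : Integrable γ := D.α_int.const_mul 2
  have hγ0 : ∀ t, 0 ≤ γ t := fun t => by have := D.α_nonneg t; positivity
  have hr := D.integrable_r_diag
  have key : ∀ ε ∈ Ioo 0 d, ‖D.U d‖ ^ 2 ≤ M ^ 2 + 2 * (∫ t in (0)..d, D.r t t) +
      8 * ∫ t in (0)..ε, γ t := by
    intro ε hε
    -- The integrand `r(τ, c)` is bounded by `γ(τ) + γ(c)`, so `c γ(c)` must be small as well; a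
    -- time where `γ` is below its mean achieves this.
    obtain ⟨c, hc, ⟨hcZ, hcS⟩, hcγ⟩ := exists_mem_Ioo_mul_le (y := γ) hε.1 hγi.integrableOn
      (p := fun t => t ∈ Z ∧ t ∈ D.S) (by
        filter_upwards [hZ, D.S_ae] with t h1 h2 ht
        exact ⟨h1, h2 ⟨ht.1, by linarith [ht.2, hε.2, hdT.2]⟩⟩)
    have h1 := hE c hcZ d hd hc.1 (hc.2.trans hε.2) hdT.2
    have h2 := D.weak c hcS c hcS
    change _ = ∫ τ in (0)..c, D.r τ c at h2
    have hΓ : ∫ t in (0)..c, γ t ≤ ∫ t in (0)..ε, γ t :=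
      intervalIntegral.integral_mono_interval le_rfl hc.1.le hc.2.le (ae_of_all _ hγ0)
        hγi.intervalIntegrable
    have hcγ' : c * γ c ≤ ∫ t in (0)..ε, γ t := by
      rw [intervalIntegral.integral_of_le hε.1.le, integral_Ioc_eq_integral_Ioo]
      refine le_trans ?_ hcγ
      rw [sub_zero]
      exact mul_le_mul_of_nonneg_right hc.2.le (hγ0 c)
    have h3 : ∫ τ in (0)..c, D.r τ c ≤ 2 * ∫ t in (0)..ε, γ t := by
      have : ∫ τ in (0)..c, D.r τ c ≤ ∫ τ in (0)..c, (γ τ + γ c) :=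
        intervalIntegral.integral_mono_on hc.1.le (D.intervalIntegrable_r c 0 c)
          (hγi.intervalIntegrable.add intervalIntegrable_const)
          (fun τ _ => (le_abs_self _).trans (D.r_abs_le τ c))
      rw [intervalIntegral.integral_add hγi.intervalIntegrable intervalIntegrable_const,
        intervalIntegral.integral_const, sub_zero, smul_eq_mul] at this
      linarith
    have h4 : -(∫ t in (0)..c, D.r t t) ≤ 2 * ∫ t in (0)..ε, γ t := by
      rw [← intervalIntegral.integral_neg]
      have : ∫ t in (0)..c, -D.r t t ≤ ∫ t in (0)..c, (γ t + γ t) :=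
        intervalIntegral.integral_mono_on hc.1.le hr.neg.intervalIntegrable
          (hγi.intervalIntegrable.add hγi.intervalIntegrable)
          (fun τ _ => (neg_le_abs _).trans (D.r_abs_le τ τ))
      rw [intervalIntegral.integral_add hγi.intervalIntegrable hγi.intervalIntegrable] at this
      linarith
    have h5 : ‖D.U c‖ ^ 2 ≤ M ^ 2 + 2 * inner ℝ (D.U c - D.u₀) (D.U c) := by
      have h6 := D.u₀_le
      have h7 := norm_sub_sq_real (D.U c) D.u₀
      have h8 := sq_nonneg ‖D.U c - D.u₀‖
      rw [inner_sub_left, real_inner_self_eq_norm_sq, real_inner_comm]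
      rw [real_inner_comm] at h7
      have h9 := real_inner_comm D.u₀ (D.U c)
      linarith
    have h6 := intervalIntegral.integral_interval_sub_left (a := 0) (b := d) (c := c)
      hr.intervalIntegrable hr.intervalIntegrable
    rw [h2] at h5
    linarith
  have hlim : Tendsto (fun ε => M ^ 2 + 2 * (∫ t in (0)..d, D.r t t) + 8 * ∫ t in (0)..ε, γ t)
      (𝓝[>] 0) (𝓝 (M ^ 2 + 2 * (∫ t in (0)..d, D.r t t) + 8 * ∫ t in (0)..0, γ t)) := by
    have hc := intervalIntegral.continuous_primitive
      (fun a b => hγi.intervalIntegrable (a := a) (b := b)) 0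
    exact ((continuous_const.add (continuous_const.mul hc)).continuousAt).mono_left
      nhdsWithin_le_nhds
  have := ge_of_tendsto hlim (by filter_upwards [Ioo_mem_nhdsGT hdT.1] with ε hε using key ε hε)
  simpa using this

/-- The bound of `∫ ‖U‖²`. -/
def _root_.DegParabolic.energyConst (T M : ℝ) : ℝ := 2 * T * M ^ 2 + 4 * T ^ 2 * M ^ 2

/-- The stress enters with a favourable sign; the free weight `l` serves to absorb `∫ ‖U‖²` later.
-/
theorem integral_r_diag_le {l : ℝ} (hl : 0 < l) {d : ℝ} (hd : 0 ≤ d) :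
    2 * ∫ t in (0)..d, D.r t t ≤
      l * M ^ 2 + l⁻¹ * (∫ t, ‖D.U t‖ ^ 2) - 2 * ∫ t in (0)..d, D.a t t := by
  have hi1 := (D.integrable_f_sq.const_mul l).add (D.integrable_U_sq.const_mul l⁻¹)
  have h1 : 2 * (∫ t in (0)..d, D.r t t) + 2 * (∫ t in (0)..d, D.a t t) ≤
      ∫ t in (0)..d, (l * ‖D.f t‖ ^ 2 + l⁻¹ * ‖D.U t‖ ^ 2) := by
    rw [← mul_add, ← intervalIntegral.integral_add D.integrable_r_diag.intervalIntegrable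
      D.integrable_a_diag.intervalIntegrable, ← intervalIntegral.integral_const_mul]
    refine intervalIntegral.integral_mono_on hd
      ((D.integrable_r_diag.add D.integrable_a_diag).const_mul 2).intervalIntegrable
      hi1.intervalIntegrable fun t _ => ?_
    have := (le_abs_self _).trans (abs_inner_le_weighted (D.f t) (D.U t) hl)
    simp only [r]
    linarith
  have h2 : ∫ t in (0)..d, (l * ‖D.f t‖ ^ 2 + l⁻¹ * ‖D.U t‖ ^ 2) ≤
      ∫ t, (l * ‖D.f t‖ ^ 2 + l⁻¹ * ‖D.U t‖ ^ 2) := by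
    rw [intervalIntegral.integral_of_le hd]
    exact setIntegral_le_integral hi1 (ae_of_all _ fun t => by positivity)
  rw [integral_add (D.integrable_f_sq.const_mul l) (D.integrable_U_sq.const_mul l⁻¹),
    integral_const_mul, integral_const_mul] at h2
  have h3 := mul_le_mul_of_nonneg_left D.f_le hl.le
  linarith

theorem integral_U_sq_le : ∫ t, ‖D.U t‖ ^ 2 ≤ energyConst T M := by
  have hT := D.T_pos
  set Y := ∫ t, ‖D.U t‖ ^ 2 with hY
  have h1 : ∀ᵐ d : ℝ, d ∈ Ioo 0 T → ‖D.U d‖ ^ 2 ≤ M ^ 2 + 2 * T * M ^ 2 + (2 * T)⁻¹ * Y := by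
    filter_upwards [D.ae_energy_le] with d hd hdT
    -- With the weight `2T`, integrating over an interval of length `T` returns exactly half of `Y`,
    -- which is absorbed. This avoids Gronwall's inequality.
    have h2 := D.integral_r_diag_le (l := 2 * T) (by positivity) hdT.1.le
    have h3 : 0 ≤ ∫ t in (0)..d, D.a t t :=
      intervalIntegral.integral_nonneg hdT.1.le fun t _ => D.a_self_nonneg t
    have := hd hdT
    linarith
  have h2 : Y = ∫ t in Ioo 0 T, ‖D.U t‖ ^ 2 := by
    rw [hY, setIntegral_eq_integral_of_forall_compl_eq_zero]
    intro t ht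
    rw [D.U_off t fun h => ht (D.S_subset h)]
    simp
  have h3 : Y ≤ T * (M ^ 2 + 2 * T * M ^ 2 + (2 * T)⁻¹ * Y) := by
    calc Y = ∫ t in Ioo 0 T, ‖D.U t‖ ^ 2 := h2
      _ ≤ ∫ _ in Ioo 0 T, (M ^ 2 + 2 * T * M ^ 2 + (2 * T)⁻¹ * Y) :=
        setIntegral_mono_on_ae D.integrable_U_sq.integrableOn (integrableOn_const (by simp))
          measurableSet_Ioo h1
      _ = _ := by simp [hT.le]
  have h4 : T * ((2 * T)⁻¹ * Y) = Y / 2 := by field_simp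
  rw [energyConst]
  nlinarith

/-- The total dissipation is bounded by dropping `‖U(d)‖²` from the energy inequality at almost
every `d` and letting `d` tend to `T` by continuity of the primitive. -/
theorem integral_a_diag_le : ∫ t, D.a t t ≤ M ^ 2 + energyConst T M / 2 := by
  have h1 : ∀ᵐ d : ℝ, d ∈ Ioo 0 T →
      ∫ t in (0)..d, D.a t t ≤ M ^ 2 + energyConst T M / 2 := by
    filter_upwards [D.ae_energy_le] with d hd hdT
    have h2 := D.integral_r_diag_le one_pos hdT.1.le
    have h3 := D.integral_U_sq_le
    have h4 := hd hdT
    have h5 := sq_nonneg ‖D.U d‖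
    rw [inv_one] at h2
    linarith
  have h2 := le_of_ae_le_of_continuous (intervalIntegral.continuous_primitive
    (fun a b => D.integrable_a_diag.intervalIntegrable (a := a) (b := b)) 0) D.T_pos h1
  rw [intervalIntegral.integral_of_le D.T_pos.le, integral_Ioc_eq_integral_Ioo,
    setIntegral_eq_integral_of_forall_compl_eq_zero] at h2
  · exact h2
  · intro t ht
    exact D.a_off_left t t fun h => ht (D.S_subset h)

end EvolutionData

/-! ### Mean squares over short time intervals. -/

section SqInt

variable {H : Type*} [NormedAddCommGroup H]

/-- `∫_t^{t+h} ‖v‖²`. -/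
def sqInt (v : ℝ → H) (h t : ℝ) : ℝ := ∫ σ in (0)..h, ‖v (t + σ)‖ ^ 2

theorem sqInt_nonneg (v : ℝ → H) {h : ℝ} (hh : 0 ≤ h) (t : ℝ) : 0 ≤ sqInt v h t :=
  intervalIntegral.integral_nonneg hh fun _ _ => by positivity

theorem integrable_sqInt_prod {v : ℝ → H} (hv : Integrable fun t => ‖v t‖ ^ 2) (h : ℝ)
    (s : Set ℝ) :
    Integrable (fun p : ℝ × ℝ => ‖v (p.2 + p.1)‖ ^ 2)
      ((volume.restrict (Ioc 0 h)).prod (volume.restrict s)) :=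
  (integrable_comp_add_fst hv (volume.restrict (Ioc 0 h)) measurable_id).mono_measure
    (Measure.prod_mono le_rfl Measure.restrict_le_self)

theorem integrable_sqInt {v : ℝ → H} (hv : Integrable fun t => ‖v t‖ ^ 2) {h : ℝ} (hh : 0 ≤ h) :
    Integrable (sqInt v h) := by
  have h1 := (integrable_sqInt_prod hv h univ).integral_prod_right
  rw [Measure.restrict_univ] at h1
  refine h1.congr (ae_of_all _ fun t => ?_)
  simp only [sqInt]
  rw [intervalIntegral.integral_of_le hh]

/-- Integrating in `t` first, each shift contributes at most the full integral; this produces the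
factor `h`. -/
theorem setIntegral_sqInt_le {v : ℝ → H} (hv : Integrable fun t => ‖v t‖ ^ 2) {h : ℝ} (hh : 0 < h)
    (s : Set ℝ) : ∫ t in s, sqInt v h t ≤ h * ∫ t, ‖v t‖ ^ 2 := by
  refine setIntegral_intervalIntegral_le hh (integrable_sqInt_prod hv h s) fun σ _ => ?_
  refine (setIntegral_le_integral (hv.comp_add_right σ) (ae_of_all _ fun t => by positivity)).trans
    (le_of_eq (integral_add_right_eq_self (fun t => ‖v t‖ ^ 2) σ))

end SqInt

namespace EvolutionData

variable {H : Type*} [NormedAddCommGroup H] [InnerProductSpace ℝ H] {T M : ℝ}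
  (D : EvolutionData H T M)

/-! #### Difference quotients in time -/

/-- The increment `U(t + h) - U(t)`. -/
def W (h t : ℝ) : H := D.U (t + h) - D.U t

/-- `∫_c^{T-h} ‖U(t + h) - U(t)‖² dt`. -/
def X (h c : ℝ) : ℝ := ∫ t in Ioo c (T - h), ‖D.W h t‖ ^ 2

/-- `∫_c^{T-h} E(t + h, t) dt`. -/
def EE (h c : ℝ) : ℝ := ∫ t in Ioo c (T - h), D.E (t + h) t

theorem stronglyMeasurable_W (h : ℝ) : StronglyMeasurable (D.W h) :=
  (D.U_meas.comp_measurable (by fun_prop : Measurable fun t : ℝ => t + h)).sub D.U_meas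

theorem W_sq_le (h t : ℝ) : ‖D.W h t‖ ^ 2 ≤ 2 * ‖D.U (t + h)‖ ^ 2 + 2 * ‖D.U t‖ ^ 2 := by
  have h1 := norm_sub_le (D.U (t + h)) (D.U t)
  have h2 := norm_nonneg (D.U (t + h) - D.U t)
  rw [W]
  nlinarith [sq_nonneg (‖D.U (t + h)‖ - ‖D.U t‖)]

theorem integrable_W_sq (h : ℝ) : Integrable fun t => ‖D.W h t‖ ^ 2 :=
  (((D.integrable_U_sq.comp_add_right h).const_mul 2).add (D.integrable_U_sq.const_mul 2)).mono'
    ((D.stronglyMeasurable_W h).norm.pow 2).aestronglyMeasurable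
    (ae_of_all _ fun t => by rw [Real.norm_of_nonneg (by positivity)]; exact D.W_sq_le h t)

theorem integrable_E_add (h : ℝ) : Integrable fun t => D.E (t + h) t := by
  simpa using D.integrable_E h 0

theorem X_nonneg (h c : ℝ) : 0 ≤ D.X h c := integral_nonneg fun _ => by positivity

theorem X_le (h c : ℝ) : D.X h c ≤ 4 * energyConst T M := by
  have hi := ((D.integrable_U_sq.comp_add_right h).const_mul 2).add
    (D.integrable_U_sq.const_mul 2)
  calc D.X h c ≤ ∫ t, ‖D.W h t‖ ^ 2 :=
        setIntegral_le_integral (D.integrable_W_sq h) (ae_of_all _ fun t => by positivity)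
    _ ≤ ∫ t, (2 * ‖D.U (t + h)‖ ^ 2 + 2 * ‖D.U t‖ ^ 2) :=
        integral_mono (D.integrable_W_sq h) hi fun t => D.W_sq_le h t
    _ ≤ 4 * energyConst T M := by
        rw [integral_add ((D.integrable_U_sq.comp_add_right h).const_mul 2)
          (D.integrable_U_sq.const_mul 2), integral_const_mul, integral_const_mul,
          integral_add_right_eq_self (fun t => ‖D.U t‖ ^ 2) h]
        linarith [D.integral_U_sq_le]

theorem X_eq_zero {h c : ℝ} (hc : T - h ≤ c) : D.X h c = 0 := by
  simp [X, Ioo_eq_empty hc.not_gt]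

theorem EE_eq_zero {h c : ℝ} (hc : T - h ≤ c) : D.EE h c = 0 := by
  simp [EE, Ioo_eq_empty hc.not_gt]

theorem X_anti {h c c' : ℝ} (hc : c ≤ c') : D.X h c' ≤ D.X h c :=
  setIntegral_mono_set (D.integrable_W_sq h).integrableOn (ae_of_all _ fun t => by positivity)
    (LE.le.eventuallyLE (Ioo_subset_Ioo_left hc))

theorem EE_anti {h c c' : ℝ} (hc : c ≤ c') : D.EE h c' ≤ D.EE h c :=
  setIntegral_mono_set (D.integrable_E_add h).integrableOn
    (ae_of_all _ fun _ => D.E_nonneg _ _) (LE.le.eventuallyLE (Ioo_subset_Ioo_left hc))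

/-- The pointwise weight is `l h`, so that after integration over an interval of length `h` the
coefficient of `‖w‖²` no longer depends on `h`. -/
theorem abs_integral_inner_le {v : ℝ → H}
    (hv2 : Integrable fun t => ‖v t‖ ^ 2) (w : H) {h l : ℝ}
    (hh : 0 < h) (hl : 0 < l) (t : ℝ) :
    |∫ σ in (0)..h, inner ℝ (v (t + σ)) w| ≤ (l * h * sqInt v h t + l⁻¹ * ‖w‖ ^ 2) / 2 := by
  have hi : Integrable fun σ => ‖v (t + σ)‖ ^ 2 := hv2.comp_add_left t
  have h1 : |∫ σ in (0)..h, inner ℝ (v (t + σ)) w| ≤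
      ∫ σ in (0)..h, (l * h / 2 * ‖v (t + σ)‖ ^ 2 + (l * h)⁻¹ * ‖w‖ ^ 2 / 2) := by
    rw [← Real.norm_eq_abs]
    refine intervalIntegral.norm_integral_le_of_norm_le hh.le (ae_of_all _ fun σ _ => ?_)
      ((hi.const_mul _).intervalIntegrable.add intervalIntegrable_const)
    have := abs_inner_le_weighted (v (t + σ)) w (mul_pos hl hh)
    rw [Real.norm_eq_abs]
    linarith
  rw [intervalIntegral.integral_add (hi.const_mul _).intervalIntegrable intervalIntegrable_const,
    intervalIntegral.integral_const_mul, intervalIntegral.integral_const, sub_zero, smul_eq_mul]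
    at h1
  have h2 : h * ((l * h)⁻¹ * ‖w‖ ^ 2 / 2) = l⁻¹ * ‖w‖ ^ 2 / 2 := by field_simp
  rw [h2] at h1
  refine h1.trans (le_of_eq ?_)
  simp only [sqInt]
  ring

/-- The increment of `f` is controlled by its derivative. -/
theorem abs_inner_f_sub_le {t h l : ℝ} (hh : 0 < h) (hl : 0 < l) (ht : t ∈ D.S)
    (hth : t + h ∈ D.S) {w : H} (hw : w ∈ Submodule.span ℝ (D.U '' D.S)) :
    |inner ℝ (D.f (t + h) - D.f t) w| ≤ (l * h * sqInt D.g h t + l⁻¹ * ‖w‖ ^ 2) / 2 := by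
  have hgi : Integrable fun t => ‖D.g t‖ ^ 2 := D.integrable_g_sq
  have hii : ∀ w : H, IntervalIntegrable (fun τ => inner ℝ (D.g τ) w) volume t (t + h) := by
    intro w
    have h1 : IntervalIntegrable (fun τ => (1 * ‖D.g τ‖ ^ 2 + 1⁻¹ * ‖w‖ ^ 2) / 2) volume t (t + h) :=
      (((hgi.const_mul 1).intervalIntegrable.add intervalIntegrable_const).div_const 2)
    exact h1.mono_fun' (D.g_meas.inner stronglyMeasurable_const).aestronglyMeasurable
      (ae_of_all _ fun τ => abs_inner_le_weighted _ _ one_pos)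
  -- The formula for increments of `f` is known only against the values of `U` at good times;
  -- linearity extends it to their span, which contains all first and second differences of `U`.
  have key : inner ℝ (D.f (t + h) - D.f t) w = ∫ τ in t..(t + h), inner ℝ (D.g τ) w := by
    induction hw using Submodule.span_induction with
    | mem x hx =>
      obtain ⟨s, hs, rfl⟩ := hx
      exact D.weak_f t ht (t + h) hth s hs
    | zero => simp
    | add x y _ _ hx hy =>
      simp only [inner_add_right]
      rw [intervalIntegral.integral_add (hii x) (hii y), hx, hy]
    | smul c x _ hx =>
      simp only [inner_smul_right]
      rw [intervalIntegral.integral_const_mul, hx]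
  rw [key]
  have h1 := intervalIntegral.integral_comp_add_left (a := 0) (b := h)
    (fun τ => inner ℝ (D.g τ) w) t
  rw [add_zero] at h1
  rw [← h1]
  exact abs_integral_inner_le hgi w hh hl t

theorem U_mem_span {t : ℝ} (ht : t ∈ D.S) : D.U t ∈ Submodule.span ℝ (D.U '' D.S) :=
  Submodule.subset_span ⟨t, ht, rfl⟩

theorem W_mem_span {t h : ℝ} (ht : t ∈ D.S) (hth : t + h ∈ D.S) :
    D.W h t ∈ Submodule.span ℝ (D.U '' D.S) :=
  Submodule.sub_mem _ (D.U_mem_span hth) (D.U_mem_span ht)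

/-- The right-hand side of the equation for the increments. -/
def rW (h t s : ℝ) : ℝ := D.r (t + h) (s + h) - D.r (t + h) s - D.r t (s + h) + D.r t s

/-- On the diagonal the four stress pairings combine into minus the symmetrized distance, which is
the dissipation in the energy identity for increments. -/
theorem rW_diag (h t : ℝ) :
    D.rW h t t = -D.E (t + h) t + inner ℝ (D.f (t + h) - D.f t) (D.W h t) := by
  simp only [rW, r, E, W, inner_sub_left, inner_sub_right]
  ring

theorem measurable_rW (h : ℝ) : Measurable (Function.uncurry (D.rW h)) := by
  have hm : ∀ {p q : ℝ × ℝ → ℝ}, Measurable p → Measurable q →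
      Measurable fun x => D.r (p x) (q x) := fun hp hq => D.measurable_r.comp (hp.prodMk hq)
  exact (((hm (by fun_prop) (by fun_prop)).sub (hm (by fun_prop) (by fun_prop))).sub
    (hm (by fun_prop) (by fun_prop))).add (hm (by fun_prop) (by fun_prop))

theorem rW_abs_le (h t s : ℝ) :
    |D.rW h t s| ≤ 4 * (D.α (t + h) + D.α t) + 4 * (D.α (s + h) + D.α s) := by
  have h1 := abs_le.1 (D.r_abs_le (t + h) (s + h))
  have h2 := abs_le.1 (D.r_abs_le (t + h) s)
  have h3 := abs_le.1 (D.r_abs_le t (s + h))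
  have h4 := abs_le.1 (D.r_abs_le t s)
  rw [rW, abs_le]
  constructor <;> linarith [h1.1, h1.2, h2.1, h2.2, h3.1, h3.2, h4.1, h4.2]

theorem integrable_rW_diag (h : ℝ) : Integrable fun t => D.rW h t t := by
  have h1 := ((D.α_int.comp_add_right h).add D.α_int).const_mul 4
  exact (h1.add h1).mono'
    ((D.measurable_rW h).comp (measurable_id.prodMk measurable_id)).aestronglyMeasurable
    (ae_of_all _ fun t => D.rW_abs_le h t t)

/-- The increments satisfy an equation of the same kind on `(0, T - h)`, obtained by subtracting the
equation from its translate. The chain rule applies with those times for which both `t` and `t + h`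
are good. -/
theorem exists_energy_eq_W {h : ℝ} (hh : 0 < h) :
    ∃ Z : Set ℝ, (∀ᵐ t : ℝ, t ∈ Z) ∧ ∀ c ∈ Z, ∀ d ∈ Z, 0 < c → c < d → d < T - h →
    ‖D.W h d‖ ^ 2 - ‖D.W h c‖ ^ 2 = 2 * ∫ t in c..d, D.rW h t t := by
  have hα := D.α_nonneg
  have hm : ∀ {p q : ℝ × ℝ → ℝ}, Measurable p → Measurable q →
      Measurable fun x => D.osc (p x) (q x) := fun hp hq => D.osc_meas.comp (hp.prodMk hq)
  refine norm_sq_sub_norm_sq_eq (S := {t | t ∈ D.S ∧ t + h ∈ D.S}) (R := D.rW h)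
    (θ := fun s s' => D.osc (s + h) (s' + h) + D.osc s s')
    (γ := fun t => 4 * (D.α (t + h) + D.α t)) ?_ (D.integrable_W_sq h) ?_ (D.measurable_rW h)
    (((D.α_int.comp_add_right h).add D.α_int).const_mul 4) ?_ ?_ ?_ ?_ ?_ ?_ ?_ ?_
  · filter_upwards [D.S_ae, ae_comp_add D.S_ae h] with t h1 h2 ht
    exact ⟨h1 ⟨ht.1, by linarith [ht.2]⟩, h2 ⟨by linarith [ht.1], by linarith [ht.2]⟩⟩
  · rintro t₁ ⟨h₁, h₁'⟩ t₂ ⟨h₂, h₂'⟩ s ⟨hs, hs'⟩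
    have e1 := D.weak_sub h₁' h₂' hs'
    have e2 := D.weak_sub h₁' h₂' hs
    have e3 := D.weak_sub h₁ h₂ hs'
    have e4 := D.weak_sub h₁ h₂ hs
    have sh : ∀ s : ℝ, ∫ τ in (t₁ + h)..(t₂ + h), D.r τ s = ∫ τ in t₁..t₂, D.r (τ + h) s :=
      fun s => (intervalIntegral.integral_comp_add_right (fun τ => D.r τ s) h).symm
    have ii : ∀ s : ℝ, IntervalIntegrable (fun τ => D.r (τ + h) s) volume t₁ t₂ := fun s => by
      have := (D.intervalIntegrable_r s (t₁ + h) (t₂ + h)).comp_add_right (c := h)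
      simpa using this
    have ii' : ∀ s : ℝ, IntervalIntegrable (fun τ => D.r τ s) volume t₁ t₂ := fun s =>
      D.intervalIntegrable_r s t₁ t₂
    rw [sh] at e1 e2
    simp only [rW]
    rw [intervalIntegral.integral_add (((ii _).sub (ii _)).sub (ii' _)) (ii' _),
      intervalIntegral.integral_sub ((ii _).sub (ii _)) (ii' _),
      intervalIntegral.integral_sub (ii _) (ii _), ← e1, ← e2, ← e3, ← e4]
    simp only [W, inner_sub_left, inner_sub_right]
    ring
  · intro t
    have h1 := hα t
    have h2 := hα (t + h)
    positivity
  · intro t s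
    exact D.rW_abs_le h t s
  · exact (hm (by fun_prop) (by fun_prop)).add D.osc_meas
  · exact fun t s => add_nonneg (D.osc_nonneg _ _) (D.osc_nonneg _ _)
  · intro t s
    have h1 := D.osc_le (t + h) (s + h)
    have h2 := D.osc_le t s
    linarith [hα t, hα (t + h), hα s, hα (s + h)]
  · intro t s
    rw [D.osc_symm t s, D.osc_symm (t + h)]
  · intro δ hδ
    obtain ⟨C, hC, hy⟩ := D.r_young δ hδ
    refine ⟨2 * C, by positivity, ?_⟩
    rintro τ ⟨hτ, hτ'⟩ s ⟨hs, hs'⟩ s' ⟨hs₁, hs₁'⟩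
    have h1 := abs_le.1 (hy _ hτ' _ hs' _ hs₁')
    have h2 := abs_le.1 (hy _ hτ' _ hs _ hs₁)
    have h3 := abs_le.1 (hy _ hτ _ hs' _ hs₁')
    have h4 := abs_le.1 (hy _ hτ _ hs _ hs₁)
    have h5 := mul_nonneg hδ.le (hα τ)
    have h6 := mul_nonneg hδ.le (hα (τ + h))
    rw [rW, rW, abs_le]
    constructor <;> nlinarith [h1.1, h1.2, h2.1, h2.2, h3.1, h3.2, h4.1, h4.2]
  · have oi : ∀ p q : ℝ, Integrable fun t => D.osc (t + p) (t + q) := fun p q =>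
      ((D.α_int.comp_add_right p).add (D.α_int.comp_add_right q)).mono'
        (D.osc_meas.comp (Measurable.prodMk (by fun_prop) (by fun_prop))).aestronglyMeasurable
        (ae_of_all _ fun t => by rw [Real.norm_of_nonneg (D.osc_nonneg _ _)]; exact D.osc_le _ _)
    have hlim := D.osc_tendsto.const_mul 2
    rw [mul_zero] at hlim
    refine squeeze_zero' (Eventually.of_forall fun ε => integral_nonneg fun t =>
      add_nonneg (D.osc_nonneg _ _) (D.osc_nonneg _ _)) ?_ hlim
    filter_upwards [self_mem_nhdsWithin] with ε hε
    have i1 : Integrable fun t => D.osc t (t + ε) := by simpa using oi 0 ε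
    have i2 : Integrable fun t => D.osc (t + h) (t + ε + h) := by
      simpa [add_assoc] using oi h (ε + h)
    have h1 : ∫ t in Ioo 0 (T - h - ε), D.osc (t + h) (t + ε + h) ≤
        ∫ t in Ioo 0 (T - ε), D.osc t (t + ε) := by
      have := setIntegral_comp_add_le i1 (fun t => D.osc_nonneg _ _) (s := Ioo 0 (T - h - ε))
        (s' := Ioo 0 (T - ε)) measurableSet_Ioo measurableSet_Ioo h
        (fun t ht => ⟨by linarith [ht.1], by linarith [ht.2]⟩)
      simpa only [add_right_comm] using this
    have h2 : ∫ t in Ioo 0 (T - h - ε), D.osc t (t + ε) ≤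
        ∫ t in Ioo 0 (T - ε), D.osc t (t + ε) :=
      setIntegral_mono_set i1.integrableOn (ae_of_all _ fun t => D.osc_nonneg _ _)
        (LE.le.eventuallyLE (Ioo_subset_Ioo_right (by linarith)))
    rw [integral_add i2.integrableOn i1.integrableOn]
    linarith

/-- Caccioppoli inequality for the increments. -/
theorem EE_le {h c : ℝ} (hh : 0 < h) (hc : 0 < c) :
    D.EE h (2 * c) ≤ c⁻¹ * D.X h c + c / 2 * h ^ 2 * M ^ 2 := by
  rcases le_or_gt (T - h) (2 * c) with hT | hT
  · rw [D.EE_eq_zero hT]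
    have := D.X_nonneg h c
    positivity
  obtain ⟨Z, hZ, hE⟩ := D.exists_energy_eq_W hh
  -- A starting time in `(c, 2c)` where `‖U(t+h) - U(t)‖²` is at most its mean, which yields the
  -- factor `c⁻¹`.
  obtain ⟨t₁, ht₁, ht₁Z, hy⟩ := exists_mem_Ioo_mul_le (c := c) (d := 2 * c) (by linarith)
    (D.integrable_W_sq h).integrableOn (p := fun t => t ∈ Z) (hZ.mono fun t ht _ => ht)
  have hEi := D.integrable_E_add h
  have hWi := D.integrable_W_sq h
  have hqi := integrable_sqInt D.integrable_g_sq hh.le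
  have hy' : ‖D.W h t₁‖ ^ 2 ≤ c⁻¹ * D.X h c := by
    rw [le_inv_mul_iff₀ hc]
    refine le_trans (le_trans (le_of_eq (by ring)) hy) ?_
    exact setIntegral_mono_set hWi.integrableOn (ae_of_all _ fun t => by positivity)
      (LE.le.eventuallyLE (Ioo_subset_Ioo_right hT.le))
  have hbi : Integrable fun t => (c * h * sqInt D.g h t + c⁻¹ * ‖D.W h t‖ ^ 2) / 2 :=
    ((hqi.const_mul (c * h)).add (hWi.const_mul c⁻¹)).div_const 2
  have hb0 : ∀ t, 0 ≤ (c * h * sqInt D.g h t + c⁻¹ * ‖D.W h t‖ ^ 2) / 2 := fun t => by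
    have := sqInt_nonneg D.g hh.le t
    positivity
  have hB : ∫ t in Ioo c (T - h), (c * h * sqInt D.g h t + c⁻¹ * ‖D.W h t‖ ^ 2) / 2 ≤
      (c * h * (h * M ^ 2) + c⁻¹ * D.X h c) / 2 := by
    rw [integral_div, integral_add (hqi.const_mul _).integrableOn (hWi.const_mul _).integrableOn,
      integral_const_mul, integral_const_mul]
    have h1 := (setIntegral_sqInt_le D.integrable_g_sq hh (Ioo c (T - h))).trans
      (mul_le_mul_of_nonneg_left D.g_le hh.le)
    have h2 := mul_le_mul_of_nonneg_left h1 (mul_pos hc hh).le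
    rw [X]
    linarith
  -- The nonnegative norm at `d` is dropped. The force is split with weight `c`, so that its share
  -- of the increments is again `c⁻¹ X`.
  have hd : ∀ᵐ d : ℝ, d ∈ Ioo t₁ (T - h) →
      ∫ t in t₁..d, D.E (t + h) t ≤ c⁻¹ * D.X h c + c / 2 * h ^ 2 * M ^ 2 := by
    filter_upwards [hZ] with d hdZ hd
    have h1 := hE t₁ ht₁Z d hdZ (hc.trans ht₁.1) hd.1 hd.2
    have hri := D.integrable_rW_diag h
    have h2 : (∫ t in t₁..d, D.rW h t t) + ∫ t in t₁..d, D.E (t + h) t ≤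
        ∫ t in t₁..d, (c * h * sqInt D.g h t + c⁻¹ * ‖D.W h t‖ ^ 2) / 2 := by
      rw [← intervalIntegral.integral_add hri.intervalIntegrable hEi.intervalIntegrable]
      refine intervalIntegral.integral_mono_ae_restrict hd.1.le
        (hri.add hEi).intervalIntegrable hbi.intervalIntegrable ?_
      rw [EventuallyLE, ae_restrict_iff' measurableSet_Icc]
      filter_upwards [D.S_ae, ae_comp_add D.S_ae h] with t g1 g2 ht
      have g1 := g1 ⟨by linarith [ht.1, ht₁.1], by linarith [ht.2, hd.2]⟩
      have g2 := g2 ⟨by linarith [ht.1, ht₁.1], by linarith [ht.2, hd.2]⟩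
      have g3 := (le_abs_self _).trans
        (D.abs_inner_f_sub_le hh hc g1 g2 (D.W_mem_span g1 g2))
      rw [D.rW_diag]
      linarith
    have h4 : ∫ t in t₁..d, (c * h * sqInt D.g h t + c⁻¹ * ‖D.W h t‖ ^ 2) / 2 ≤
        ∫ t in Ioo c (T - h), (c * h * sqInt D.g h t + c⁻¹ * ‖D.W h t‖ ^ 2) / 2 := by
      rw [intervalIntegral.integral_of_le hd.1.le]
      exact setIntegral_mono_set hbi.integrableOn (ae_of_all _ hb0)
        (LE.le.eventuallyLE fun t ht => ⟨ht₁.1.trans ht.1, ht.2.trans_lt hd.2⟩)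
    have h5 := sq_nonneg ‖D.W h d‖
    linarith
  have h3 := le_of_ae_le_of_continuous (intervalIntegral.continuous_primitive
    (fun a b => hEi.intervalIntegrable (a := a) (b := b)) t₁) (ht₁.2.trans hT) hd
  refine le_trans ?_ h3
  rw [intervalIntegral.integral_of_le (ht₁.2.trans hT).le, integral_Ioc_eq_integral_Ioo]
  exact D.EE_anti ht₁.2.le

/-- The increments are controlled by the potential and the symmetrized distances. -/
theorem X_le_of_EE_le {h c κ : ℝ} (hh : 0 < h) (hc : 0 < c) (hκ : 0 ≤ κ)
    (hEE : ∀ g ∈ Ioo 0 h, D.EE g c ≤ κ) :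
    D.X h (2 * c) ≤ 2 * h ^ 2 * c⁻¹ * (M ^ 2 + energyConst T M / 2) + 2 * h * κ + h ^ 2 * M ^ 2 := by
  have hA : 0 ≤ ∫ t, D.a t t := integral_nonneg D.a_self_nonneg
  have hA' : 0 ≤ M ^ 2 + energyConst T M / 2 := hA.trans D.integral_a_diag_le
  rcases le_or_gt (T - h) (2 * c) with hT | hT
  · rw [D.X_eq_zero hT]
    positivity
  have hFi := D.integrable_F
  have hFF : Integrable fun c' => ∫ σ in (0)..h, D.F (c' + σ) := by
    have h1 := (integrable_comp_add_fst hFi (volume.restrict (Ioc 0 h))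
      measurable_id).integral_prod_right
    refine h1.congr (ae_of_all _ fun t => ?_)
    simp only [id_eq]
    rw [intervalIntegral.integral_of_le hh.le]
  -- The telescoping potential will leave `∫ F` over `(c', c' + h)`; a good starting time makes this
  -- at most `h / c` times the total potential.
  obtain ⟨c', hc', -, hcF⟩ := exists_mem_Ioo_mul_le (c := c) (d := 2 * c) (by linarith)
    hFF.integrableOn (p := fun _ => True) (ae_of_all _ fun _ _ => trivial)
  have hF1 : ∫ t in Ioo c (2 * c), ∫ σ in (0)..h, D.F (t + σ) ≤
      h * (M ^ 2 + energyConst T M / 2) := by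
    refine setIntegral_intervalIntegral_le (Φ := fun σ t => D.F (t + σ)) hh
      ((integrable_comp_add_fst hFi (volume.restrict (Ioc 0 h)) measurable_id).mono_measure
        (Measure.prod_mono le_rfl Measure.restrict_le_self)) fun σ _ => ?_
    calc ∫ t in Ioo c (2 * c), D.F (t + σ) ≤ ∫ t, D.F (t + σ) :=
          setIntegral_le_integral (hFi.comp_add_right σ) (ae_of_all _ fun t => D.F_nonneg _)
      _ = ∫ t, D.F t := integral_add_right_eq_self D.F σ
      _ ≤ ∫ t, D.a t t := integral_mono hFi D.integrable_a_diag D.F_le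
      _ ≤ _ := D.integral_a_diag_le
  have hF2 : ∫ t in c'..(c' + h), D.F t ≤ h * c⁻¹ * (M ^ 2 + energyConst T M / 2) := by
    have h1 := intervalIntegral.integral_comp_add_left (a := 0) (b := h) D.F c'
    rw [add_zero] at h1
    rw [← h1, mul_comm h, mul_assoc, le_inv_mul_iff₀ hc]
    refine le_trans (le_of_eq (by ring)) (hcF.trans hF1)
  set I := Ioo c' (T - h) with hI
  have hc'T : c' < T - h := hc'.2.trans hT
  have hWi := D.integrable_W_sq h
  have hqi := integrable_sqInt D.integrable_f_sq hh.le
  have hEprod := D.integrable_E_prod (κ₁ := fun _ => h) (κ₂ := fun σ => σ) (by fun_prop)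
    (by fun_prop) (volume.restrict (Ioc 0 h)) I
  have hEint : IntegrableOn (fun t => ∫ σ in (0)..h, D.E (t + h) (t + σ)) I := by
    refine hEprod.integral_prod_right.congr (ae_of_all _ fun t => ?_)
    simp only
    rw [intervalIntegral.integral_of_le hh.le]
  have hFd : Integrable fun t => h * (D.F t - D.F (t + h)) :=
    (hFi.sub (hFi.comp_add_right h)).const_mul h
  -- The equation on `(t, t + h)` is tested with the increment itself; the three-point inequality
  -- with intermediate time `t + σ` replaces the stress pairing by potentials and `E`.
  have hpt : ∀ᵐ t : ℝ, t ∈ I → ‖D.W h t‖ ^ 2 ≤ h * (D.F t - D.F (t + h)) +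
      (∫ σ in (0)..h, D.E (t + h) (t + σ)) + (h * sqInt D.f h t + ‖D.W h t‖ ^ 2) / 2 := by
    filter_upwards [D.S_ae, ae_comp_add D.S_ae h] with t g1 g2 ht
    have g1 := g1 ⟨by linarith [ht.1, hc'.1], by linarith [ht.2]⟩
    have g2 := g2 ⟨by linarith [ht.1, hc'.1], by linarith [ht.2]⟩
    have ii : ∀ s : ℝ, IntervalIntegrable (fun σ => D.r (t + σ) s) volume 0 h := fun s => by
      have := (D.intervalIntegrable_r s t (t + h)).comp_add_left (c := t)
      simpa using this
    have e1 : ‖D.W h t‖ ^ 2 = ∫ σ in (0)..h, (D.r (t + σ) (t + h) - D.r (t + σ) t) := by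
      rw [intervalIntegral.integral_sub (ii _) (ii _),
        intervalIntegral.integral_comp_add_left (fun τ => D.r τ (t + h)) t,
        intervalIntegral.integral_comp_add_left (fun τ => D.r τ t) t, add_zero,
        ← D.weak_sub g1 g2 g2, ← D.weak_sub g1 g2 g1, ← inner_sub_right,
        ← real_inner_self_eq_norm_sq]
      rfl
    have hfW : ∀ w : H, IntervalIntegrable (fun σ => inner ℝ (D.f (t + σ)) w) volume 0 h := by
      intro w
      have h1 : Integrable fun σ => ‖D.f (t + σ)‖ ^ 2 := D.integrable_f_sq.comp_add_left t
      have h2 : IntervalIntegrable (fun σ => (1 * ‖D.f (t + σ)‖ ^ 2 + 1⁻¹ * ‖w‖ ^ 2) / 2)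
          volume 0 h :=
        (((h1.const_mul 1).intervalIntegrable.add intervalIntegrable_const).div_const 2)
      exact h2.mono_fun' ((D.f_meas.comp_measurable (by fun_prop)).inner
        stronglyMeasurable_const).aestronglyMeasurable
        (ae_of_all _ fun τ => abs_inner_le_weighted _ _ one_pos)
    have hEt : IntervalIntegrable (fun σ => D.E (t + h) (t + σ)) volume 0 h := by
      have h1 : IntervalIntegrable (fun σ => 4 * (D.α (t + h) + D.α (t + σ))) volume 0 h :=
        (intervalIntegrable_const.add (D.α_int.comp_add_left t).intervalIntegrable).const_mul 4
      exact h1.mono_fun' (D.measurable_E.comp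
        (Measurable.prodMk (by fun_prop) (by fun_prop))).aestronglyMeasurable
        (ae_of_all _ fun σ => D.E_abs_le _ _)
    have e2 : ∫ σ in (0)..h, (D.r (t + σ) (t + h) - D.r (t + σ) t) ≤
        ∫ σ in (0)..h, ((D.F t - D.F (t + h)) + D.E (t + h) (t + σ) +
          inner ℝ (D.f (t + σ)) (D.W h t)) := by
      refine intervalIntegral.integral_mono_ae_restrict hh.le ((ii _).sub (ii _))
        ((intervalIntegrable_const.add hEt).add (hfW _)) ?_
      rw [EventuallyLE, ae_restrict_iff' measurableSet_Icc]
      filter_upwards [(measurePreserving_add_left volume t).quasiMeasurePreserving.ae D.S_ae]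
        with σ g3 hσ
      have g3 := g3 ⟨by linarith [ht.1, hc'.1, hσ.1], by linarith [ht.2, hσ.2]⟩
      have g4 := D.a_sub_le g1 g2 g3
      simp only [r, W, inner_sub_right]
      linarith
    rw [intervalIntegral.integral_add (intervalIntegrable_const.add hEt) (hfW _),
      intervalIntegral.integral_add intervalIntegrable_const hEt,
      intervalIntegral.integral_const, sub_zero, smul_eq_mul] at e2
    have e3 := (le_abs_self _).trans
      (abs_integral_inner_le D.integrable_f_sq (D.W h t) hh one_pos t)
    rw [one_mul, inv_one, one_mul] at e3
    linarith
  have hbi : IntegrableOn (fun t => h * (D.F t - D.F (t + h)) +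
      (∫ σ in (0)..h, D.E (t + h) (t + σ)) + (h * sqInt D.f h t + ‖D.W h t‖ ^ 2) / 2) I :=
    (hFd.integrableOn.add hEint).add (((hqi.const_mul h).add hWi).div_const 2).integrableOn
  have hint := setIntegral_mono_on_ae hWi.integrableOn hbi measurableSet_Ioo hpt
  rw [integral_add (hFd.integrableOn.fun_add hEint)
      (((hqi.const_mul h).fun_add hWi).div_const 2).integrableOn,
    integral_add hFd.integrableOn hEint, integral_div,
    integral_add (hqi.const_mul h).integrableOn hWi.integrableOn,
    integral_const_mul, integral_const_mul,
    integral_sub hFi.integrableOn (hFi.comp_add_right h).integrableOn] at hint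
  -- Telescoping: the shifted integral cancels everything but an initial strip of length `h`; the
  -- final strip has the right sign.
  have k1 : (∫ t in I, D.F t) - ∫ t in I, D.F (t + h) ≤ ∫ t in c'..(c' + h), D.F t := by
    have iF : ∀ x y : ℝ, IntervalIntegrable D.F volume x y := fun x y => hFi.intervalIntegrable
    have e : ∀ G : ℝ → ℝ, ∫ t in I, G t = ∫ t in c'..(T - h), G t := fun G => by
      rw [intervalIntegral.integral_of_le hc'T.le, integral_Ioc_eq_integral_Ioo]
    rw [e, e, intervalIntegral.integral_comp_add_right D.F h, sub_add_cancel]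
    have h1 := intervalIntegral.integral_add_adjacent_intervals (iF c' (c' + h)) (iF (c' + h) T)
    have h2 := intervalIntegral.integral_add_adjacent_intervals (iF c' (T - h)) (iF (T - h) T)
    have h3 : 0 ≤ ∫ t in (T - h)..T, D.F t :=
      intervalIntegral.integral_nonneg (by linarith) fun t _ => D.F_nonneg t
    linarith
  -- The times `t + h` and `t + σ` are `h - σ` apart, so translation by `σ` reduces the slice to `EE
  -- (h - σ) c`.
  have k2 : ∫ t in I, ∫ σ in (0)..h, D.E (t + h) (t + σ) ≤ h * κ := by
    refine setIntegral_intervalIntegral_le (Φ := fun σ t => D.E (t + h) (t + σ)) hh hEprod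
      fun σ hσ => ?_
    refine le_trans ?_ (hEE (h - σ) ⟨by linarith [hσ.2], by linarith [hσ.1]⟩)
    have := setIntegral_comp_add_le (D.integrable_E_add (h - σ)) (fun t => D.E_nonneg _ _)
      (s := I) (s' := Ioo c (T - (h - σ))) measurableSet_Ioo measurableSet_Ioo σ
      (fun t ht => ⟨by linarith [ht.1, hc'.1, hσ.1], by linarith [ht.2]⟩)
    refine le_trans (le_of_eq ?_) this
    congr 1; ext t; congr 1; ring
  have k3 := (setIntegral_sqInt_le D.integrable_f_sq hh I).trans
    (mul_le_mul_of_nonneg_left D.f_le hh.le)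
  have k4 := D.X_anti (h := h) hc'.2.le
  have k5 : D.X h c' = ∫ t in I, ‖D.W h t‖ ^ 2 := rfl
  have k6 := mul_le_mul_of_nonneg_left (k1.trans hF2) hh.le
  have k7 := mul_le_mul_of_nonneg_left k3 hh.le
  rw [k5] at k4
  linarith

end EvolutionData

namespace EvolutionData

variable {H : Type*} [NormedAddCommGroup H] [InnerProductSpace ℝ H] {T M : ℝ}
  (D : EvolutionData H T M)

/-! #### Second differences -/

/-- The second difference `U(t + 2h) - 2 U(t + h) + U(t)`. -/
def W2 (h t : ℝ) : H := D.W h (t + h) - D.W h t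

theorem integrable_W2_sq (h : ℝ) : Integrable fun t => ‖D.W2 h t‖ ^ 2 := by
  refine ((((D.integrable_W_sq h).comp_add_right h).const_mul 2).add
    ((D.integrable_W_sq h).const_mul 2)).mono'
    ((((D.stronglyMeasurable_W h).comp_measurable (by fun_prop : Measurable fun t : ℝ => t + h)).sub
      (D.stronglyMeasurable_W h)).norm.pow 2).aestronglyMeasurable
    (ae_of_all _ fun t => ?_)
  rw [Real.norm_of_nonneg (by positivity)]
  have h1 := norm_sub_le (D.W h (t + h)) (D.W h t)
  have h2 := norm_nonneg (D.W h (t + h) - D.W h t)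
  simp only [Pi.add_apply]
  change ‖D.W h (t + h) - D.W h t‖ ^ 2 ≤ _
  nlinarith [sq_nonneg (‖D.W h (t + h)‖ - ‖D.W h t‖)]

/-- The equations on `(t, t + h)` and `(t + h, t + 2h)` are subtracted and tested with the second
difference, written as a difference of two increments. Two four-point inequalities leave only values
of `E`: there is no boundary term in the potential, and this gives the gain over first differences.
-/
theorem integral_W2_sq_le {h c κ : ℝ} (hh : 0 < h) (hc : 0 < c)
    (hEE : ∀ g ∈ Ioo 0 (2 * h), D.EE g c ≤ κ) :
    ∫ t in Ioo c (T - 2 * h), ‖D.W2 h t‖ ^ 2 ≤ 8 * h * κ + h ^ 4 * M ^ 2 := by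
  set I := Ioo c (T - 2 * h) with hI
  have hqi := integrable_sqInt D.integrable_g_sq hh.le
  -- The four-point inequality is applied with `p = t + h + σ`, `q = t + σ` to the pairs `(t + h, t
  -- + 2h)` and `(t + h, t)`; both produce `E(t + h, t + σ)`, whence the factor `2`.
  set Ψ : ℝ → ℝ → ℝ := fun σ t => 2 * D.E (t + h) (t + σ) + D.E (t + 2 * h) (t + (h + σ)) +
    D.E (t + (h + σ)) (t + 0) with hΨ
  have hP := fun (κ₁ κ₂ : ℝ → ℝ) (h1 : Measurable κ₁) (h2 : Measurable κ₂) =>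
    D.integrable_E_prod h1 h2 (volume.restrict (Ioc 0 h)) I
  have hP1 := hP (fun _ => h) (fun σ => σ) (by fun_prop) (by fun_prop)
  have hP2 := hP (fun _ => 2 * h) (fun σ => h + σ) (by fun_prop) (by fun_prop)
  have hP3 := hP (fun σ => h + σ) (fun _ => 0) (by fun_prop) (by fun_prop)
  have hΨi : Integrable (Function.uncurry Ψ)
      ((volume.restrict (Ioc 0 h)).prod (volume.restrict I)) :=
    ((hP1.const_mul 2).add hP2).add hP3
  have hΨint : IntegrableOn (fun t => ∫ σ in (0)..h, Ψ σ t) I := by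
    refine hΨi.integral_prod_right.congr (ae_of_all _ fun t => ?_)
    simp only [Function.uncurry]
    rw [intervalIntegral.integral_of_le hh.le]
  have hQprod : Integrable (Function.uncurry fun σ t => sqInt D.g h (t + σ))
      ((volume.restrict (Ioc 0 h)).prod (volume.restrict I)) :=
    (integrable_comp_add_fst hqi (volume.restrict (Ioc 0 h)) measurable_id).mono_measure
      (Measure.prod_mono le_rfl Measure.restrict_le_self)
  have hQint : IntegrableOn (fun t => ∫ σ in (0)..h, sqInt D.g h (t + σ)) I := by
    refine hQprod.integral_prod_right.congr (ae_of_all _ fun t => ?_)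
    simp only [Function.uncurry]
    rw [intervalIntegral.integral_of_le hh.le]
  have hZi := D.integrable_W2_sq h
  have hpt : ∀ᵐ t : ℝ, t ∈ I → ‖D.W2 h t‖ ^ 2 ≤ (∫ σ in (0)..h, Ψ σ t) +
      (h ^ 2 * (∫ σ in (0)..h, sqInt D.g h (t + σ)) + ‖D.W2 h t‖ ^ 2) / 2 := by
    filter_upwards [D.S_ae, ae_comp_add D.S_ae h, ae_comp_add D.S_ae (2 * h)] with t g0 g1 g2 ht
    have g0 := g0 ⟨by linarith [ht.1], by linarith [ht.2]⟩
    have g1 := g1 ⟨by linarith [ht.1], by linarith [ht.2]⟩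
    have g2 := g2 ⟨by linarith [ht.1], by linarith [ht.2]⟩
    have th : t + h + h = t + 2 * h := by ring
    have eW2 : D.W2 h t = (D.U (t + 2 * h) - D.U (t + h)) - (D.U (t + h) - D.U t) := by
      simp only [W2, W, th]
    have ii : ∀ s p : ℝ, IntervalIntegrable (fun σ => D.r (t + (p + σ)) s) volume 0 h :=
      fun s p => by
        have := (D.intervalIntegrable_r s (t + p) (t + p + h)).comp_add_left (c := t + p)
        simpa [add_assoc] using this
    have ii0 : ∀ s : ℝ, IntervalIntegrable (fun σ => D.r (t + σ) s) volume 0 h :=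
      fun s => by simpa using ii s 0
    have sh1 : ∀ s ∈ D.S, ∫ σ in (0)..h, D.r (t + (h + σ)) s =
        inner ℝ (D.U (t + 2 * h) - D.U (t + h)) (D.U s) := by
      intro s hs
      rw [D.weak_sub g1 g2 hs]
      have := intervalIntegral.integral_comp_add_left (a := 0) (b := h)
        (fun τ => D.r τ s) (t + h)
      rw [add_zero, th] at this
      simpa only [add_assoc] using this
    have sh0 : ∀ s ∈ D.S, ∫ σ in (0)..h, D.r (t + σ) s =
        inner ℝ (D.U (t + h) - D.U t) (D.U s) := by
      intro s hs
      rw [D.weak_sub g0 g1 hs]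
      have := intervalIntegral.integral_comp_add_left (a := 0) (b := h) (fun τ => D.r τ s) t
      rwa [add_zero] at this
    have jj : ∀ s : ℝ, IntervalIntegrable (fun σ => D.r (t + (h + σ)) s - D.r (t + σ) s)
        volume 0 h := fun s => (ii s h).sub (ii0 s)
    have sd : ∀ s ∈ D.S, ∫ σ in (0)..h, (D.r (t + (h + σ)) s - D.r (t + σ) s) =
        inner ℝ (D.W2 h t) (D.U s) := by
      intro s hs
      rw [intervalIntegral.integral_sub (ii s h) (ii0 s), sh1 s hs, sh0 s hs, eW2,
        ← inner_sub_left]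
    have e1 : ‖D.W2 h t‖ ^ 2 = ∫ σ in (0)..h,
        ((D.r (t + (h + σ)) (t + 2 * h) - D.r (t + σ) (t + 2 * h)) -
          2 * (D.r (t + (h + σ)) (t + h) - D.r (t + σ) (t + h)) +
          (D.r (t + (h + σ)) t - D.r (t + σ) t)) := by
      rw [intervalIntegral.integral_add ((jj _).sub ((jj _).const_mul 2)) (jj _),
        intervalIntegral.integral_sub (jj _) ((jj _).const_mul 2),
        intervalIntegral.integral_const_mul, sd _ g2, sd _ g1, sd _ g0,
        ← real_inner_self_eq_norm_sq]
      nth_rw 2 [eW2]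
      simp only [inner_sub_right]
      ring
    have hαi : ∀ p : ℝ, IntervalIntegrable (fun σ => D.α (t + (p + σ))) volume 0 h := fun p => by
      have := D.α_int.comp_add_left (t + p)
      simp only [add_assoc] at this
      exact this.intervalIntegrable
    have hα0 : IntervalIntegrable (fun σ => D.α (t + σ)) volume 0 h := by simpa using hαi 0
    have hEt : ∀ {p q : ℝ → ℝ}, Measurable p → Measurable q →
        IntervalIntegrable (fun σ => D.α (p σ)) volume 0 h →
        IntervalIntegrable (fun σ => D.α (q σ)) volume 0 h →
        IntervalIntegrable (fun σ => D.E (p σ) (q σ)) volume 0 h := by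
      intro p q hp hq h1 h2
      exact ((h1.add h2).const_mul 4).mono_fun'
        (D.measurable_E.comp (hp.prodMk hq)).aestronglyMeasurable
        (ae_of_all _ fun σ => D.E_abs_le _ _)
    have hΨt : IntervalIntegrable (fun σ => Ψ σ t) volume 0 h :=
      (((hEt (by fun_prop) (by fun_prop) intervalIntegrable_const hα0).const_mul 2).add
        (hEt (by fun_prop) (by fun_prop) intervalIntegrable_const (hαi h))).add
        (hEt (by fun_prop) (by fun_prop) (hαi h) intervalIntegrable_const)
    have hQt : IntervalIntegrable (fun σ => sqInt D.g h (t + σ)) volume 0 h :=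
      (hqi.comp_add_left t).intervalIntegrable
    have hspan : D.W2 h t ∈ Submodule.span ℝ (D.U '' D.S) := by
      rw [eW2]
      exact Submodule.sub_mem _ (Submodule.sub_mem _ (D.U_mem_span g2) (D.U_mem_span g1))
        (Submodule.sub_mem _ (D.U_mem_span g1) (D.U_mem_span g0))
    have hbt : IntervalIntegrable (fun σ => Ψ σ t + (h * h * sqInt D.g h (t + σ) +
        h⁻¹ * ‖D.W2 h t‖ ^ 2) / 2) volume 0 h :=
      hΨt.add (((hQt.const_mul (h * h)).add intervalIntegrable_const).div_const 2)
    have e2 : ‖D.W2 h t‖ ^ 2 ≤ ∫ σ in (0)..h, (Ψ σ t + (h * h * sqInt D.g h (t + σ) +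
        h⁻¹ * ‖D.W2 h t‖ ^ 2) / 2) := by
      refine e1.trans_le (intervalIntegral.integral_mono_ae_restrict hh.le
        (((jj _).sub ((jj _).const_mul 2)).add (jj _)) hbt ?_)
      rw [EventuallyLE, ae_restrict_iff' measurableSet_Icc]
      filter_upwards [(measurePreserving_add_left volume t).quasiMeasurePreserving.ae D.S_ae,
        (measurePreserving_add_left volume (t + h)).quasiMeasurePreserving.ae D.S_ae]
        with σ g3 g4 hσ
      have g3 := g3 ⟨by linarith [ht.1, hσ.1], by linarith [ht.2, hσ.2]⟩
      have g4 := g4 ⟨by linarith [ht.1, hσ.1], by linarith [ht.2, hσ.2]⟩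
      rw [add_assoc] at g4
      have g5 : t + σ + h = t + (h + σ) := by ring
      have f1 := D.a_sub_a_le g4 g3 g1 g2
      have f2 := D.a_sub_a_le g4 g3 g1 g0
      have f3 := (le_abs_self _).trans
        (D.abs_inner_f_sub_le hh hh g3 (by rw [g5]; exact g4) hspan)
      rw [g5] at f3
      have f4 : inner ℝ (D.f (t + (h + σ)) - D.f (t + σ)) (D.W2 h t) =
          (inner ℝ (D.f (t + (h + σ))) (D.U (t + 2 * h)) -
            inner ℝ (D.f (t + σ)) (D.U (t + 2 * h))) -
          2 * (inner ℝ (D.f (t + (h + σ))) (D.U (t + h)) - inner ℝ (D.f (t + σ)) (D.U (t + h))) +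
          (inner ℝ (D.f (t + (h + σ))) (D.U t) - inner ℝ (D.f (t + σ)) (D.U t)) := by
        rw [eW2]
        simp only [inner_sub_left, inner_sub_right]
        ring
      rw [D.E_symm t] at f2
      simp only [hΨ, add_zero, r]
      linarith
    rw [intervalIntegral.integral_add hΨt
      (((hQt.const_mul (h * h)).add intervalIntegrable_const).div_const 2),
      intervalIntegral.integral_div, intervalIntegral.integral_add (hQt.const_mul (h * h))
        intervalIntegrable_const, intervalIntegral.integral_const_mul,
      intervalIntegral.integral_const, sub_zero, smul_eq_mul, mul_inv_cancel_left₀ hh.ne'] at e2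
    rw [pow_two h]
    exact e2
  have hbi : IntegrableOn (fun t => (∫ σ in (0)..h, Ψ σ t) +
      (h ^ 2 * (∫ σ in (0)..h, sqInt D.g h (t + σ)) + ‖D.W2 h t‖ ^ 2) / 2) I :=
    hΨint.add (((hQint.const_mul _).add hZi.integrableOn).div_const 2)
  have hint := setIntegral_mono_on_ae hZi.integrableOn hbi measurableSet_Ioo hpt
  rw [integral_add hΨint (((hQint.const_mul _).fun_add hZi.integrableOn).div_const 2),
    integral_div, integral_add (hQint.const_mul _) hZi.integrableOn, integral_const_mul] at hint
  have k1 : ∫ t in I, ∫ σ in (0)..h, Ψ σ t ≤ h * (4 * κ) := by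
    refine setIntegral_intervalIntegral_le hh hΨi fun σ hσ => ?_
    have i1 := (D.integrable_E h σ).integrableOn (s := I)
    have i2 := (D.integrable_E (2 * h) (h + σ)).integrableOn (s := I)
    have i3 := (D.integrable_E (h + σ) 0).integrableOn (s := I)
    -- Each term of `Ψ` compares times whose distance lies in `(0, 2h)`; a translation by the
    -- smaller shift identifies it with a value of `EE`.
    have b : ∀ p q : ℝ, 0 ≤ q → q < p → p ≤ 2 * h → p - q < 2 * h →
        ∫ t in I, D.E (t + p) (t + q) ≤ κ := by
      intro p q hq hqp hp hpq
      refine le_trans ?_ (hEE (p - q) ⟨by linarith, hpq⟩)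
      have := setIntegral_comp_add_le (D.integrable_E_add (p - q)) (fun t => D.E_nonneg _ _)
        (s := I) (s' := Ioo c (T - (p - q))) measurableSet_Ioo measurableSet_Ioo q
        (fun t ht => ⟨by linarith [ht.1], by linarith [ht.2]⟩)
      refine le_trans (le_of_eq ?_) this
      congr 1; ext t; congr 1; ring
    have b1 := b h σ hσ.1.le hσ.2 (by linarith) (by linarith [hσ.1])
    have b2 := b (2 * h) (h + σ) (by linarith [hσ.1]) (by linarith [hσ.2]) le_rfl
      (by linarith [hσ.1])
    have b3 := b (h + σ) 0 le_rfl (by linarith [hσ.1]) (by linarith [hσ.2]) (by linarith [hσ.2])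
    simp only [hΨ]
    rw [integral_add ((i1.const_mul 2).fun_add i2) i3, integral_add (i1.const_mul 2) i2,
      integral_const_mul]
    linarith
  have k2 : ∫ t in I, ∫ σ in (0)..h, sqInt D.g h (t + σ) ≤ h * (h * M ^ 2) := by
    refine setIntegral_intervalIntegral_le hh hQprod fun σ _ => ?_
    have h1 := setIntegral_sqInt_le D.integrable_g_sq hh univ
    rw [setIntegral_univ] at h1
    calc ∫ t in I, sqInt D.g h (t + σ) ≤ ∫ t, sqInt D.g h (t + σ) :=
          setIntegral_le_integral (hqi.comp_add_right σ)
            (ae_of_all _ fun t => sqInt_nonneg _ hh.le _)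
      _ = ∫ t, sqInt D.g h t := integral_add_right_eq_self (sqInt D.g h) σ
      _ ≤ _ := h1.trans (mul_le_mul_of_nonneg_left D.g_le hh.le)
  have k3 := mul_le_mul_of_nonneg_left k2 (sq_nonneg h)
  nlinarith

/-- One step of the iteration for `EE`. -/
theorem EE_le_of_X_le (k : ℕ) {L : ℝ} (hk : k ≤ 2)
    (hX : ∀ g c, 0 < g → g < T → 0 < c → c < T → D.X g c ≤ L * (g / c) ^ k) (g c : ℝ)
    (hg : 0 < g) (hgT : g < T) (hc : 0 < c) (hcT : c < T) :
    D.EE g c ≤ 2 ^ (k + 1) * (L + T ^ 4 * M ^ 2 / 2) * (g / c) ^ k * c⁻¹ := by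
  have hT := D.T_pos
  have h1 := D.EE_le hg (half_pos hc)
  rw [mul_div_cancel₀ _ (two_ne_zero' ℝ)] at h1
  have h2 := hX g (c / 2) hg hgT (half_pos hc) (by linarith)
  -- In terms of the ratio `x = g / c` the factor `2 ^ (k + 1)` is the cost of replacing `c` by `c /
  -- 2`. The inhomogeneous term has a higher power of the step, which `g, c < T` converts into `x ^
  -- k`.
  obtain ⟨x, hx, rfl⟩ : ∃ x : ℝ, 0 < x ∧ g = x * c := ⟨g / c, by positivity, by field_simp⟩
  have e1 : x * c / (c / 2) = 2 * x := by field_simp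
  have e2 : x * c / c = x := by field_simp
  have e3 : (c / 2)⁻¹ = 2 * c⁻¹ := by field_simp
  rw [e1] at h2
  rw [e3] at h1
  rw [e2]
  have h3 : 2 * c⁻¹ * D.X (x * c) (c / 2) ≤ 2 * c⁻¹ * (L * (2 * x) ^ k) := by gcongr
  have h4 : c / 2 / 2 * (x * c) ^ 2 * M ^ 2 ≤ 2 ^ (k + 1) * (T ^ 4 * M ^ 2 / 2) * x ^ k * c⁻¹ := by
    have h5 : c ^ 2 / 4 * (x * c) ^ 2 ≤ 2 ^ k * T ^ 4 * x ^ k := by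
      have hcT2 : c ^ 2 ≤ T ^ 2 := by gcongr
      have hgT2 : (x * c) ^ 2 ≤ T ^ 2 := by gcongr
      have h0 : c ^ 2 * (x * c) ^ 2 ≤ T ^ 2 * T ^ 2 := by gcongr
      have h1 : c ^ 3 * (x * c) ≤ T ^ 3 * T := by gcongr
      have h2 : c ^ 4 ≤ T ^ 4 := by gcongr
      have hx1 : c ^ 3 * (x * c) * x ≤ T ^ 3 * T * x := by gcongr
      have hx2 : c ^ 4 * x ^ 2 ≤ T ^ 4 * x ^ 2 := by gcongr
      have p1 : 0 ≤ T ^ 4 * x := by positivity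
      have p2 : 0 ≤ T ^ 4 * x ^ 2 := by positivity
      interval_cases k
      · rw [pow_zero, pow_zero, one_mul, mul_one]
        linarith [pow_pos hT 4]
      · rw [pow_one, pow_one]
        linarith
      · linarith
    have h6 : c / 2 / 2 * (x * c) ^ 2 * M ^ 2 = c⁻¹ * M ^ 2 * (c ^ 2 / 4 * (x * c) ^ 2) := by
      field_simp; ring
    rw [h6]
    refine (mul_le_mul_of_nonneg_left h5 (by positivity)).trans_eq ?_
    ring
  have h7 : 2 * c⁻¹ * (L * (2 * x) ^ k) + 2 ^ (k + 1) * (T ^ 4 * M ^ 2 / 2) * x ^ k * c⁻¹ =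
      2 ^ (k + 1) * (L + T ^ 4 * M ^ 2 / 2) * x ^ k * c⁻¹ := by ring
  linarith

/-- One step of the iteration for `X`. -/
theorem X_le_of_EE_le_pow (k : ℕ) {L : ℝ} (hL : 0 ≤ L) (hk : k ≤ 1)
    (hE : ∀ g c, 0 < g → g < T → 0 < c → c < T → D.EE g c ≤ L * (g / c) ^ k * c⁻¹) (h c : ℝ)
    (hh : 0 < h) (hhT : h < T) (hc : 0 < c) (hcT : c < T) :
    D.X h c ≤ 2 ^ (k + 1) * (2 * T * (M ^ 2 + energyConst T M / 2) + 2 * L + T ^ 2 * M ^ 2) *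
      (h / c) ^ (k + 1) := by
  have hT := D.T_pos
  have hA : 0 ≤ M ^ 2 + energyConst T M / 2 :=
    (integral_nonneg D.a_self_nonneg).trans D.integral_a_diag_le
  -- The assumed bound grows with the step, so its value at `h` serves for all smaller steps.
  have h1 := D.X_le_of_EE_le (κ := L * (h / (c / 2)) ^ k * (c / 2)⁻¹) hh (half_pos hc)
    (by positivity) (fun g hg => (hE g (c / 2) hg.1 (hg.2.trans hhT) (half_pos hc)
      (by linarith)).trans (by
        have := hg.1
        have := hg.2.le
        gcongr))
  rw [mul_div_cancel₀ _ (two_ne_zero' ℝ)] at h1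
  obtain ⟨A, hAdef⟩ : ∃ A, A = M ^ 2 + energyConst T M / 2 := ⟨_, rfl⟩
  rw [← hAdef] at h1 hA ⊢
  obtain ⟨x, hx, rfl⟩ : ∃ x : ℝ, 0 < x ∧ h = x * c := ⟨h / c, by positivity, by field_simp⟩
  have e1 : x * c / (c / 2) = 2 * x := by field_simp
  have e2 : x * c / c = x := by field_simp
  have e3 : (c / 2)⁻¹ = 2 * c⁻¹ := by field_simp
  rw [e1, e3] at h1
  rw [e2]
  have t1 : 2 * (x * c) ^ 2 * (2 * c⁻¹) * A ≤ 2 ^ (k + 1) * (2 * T * A) * x ^ (k + 1) := by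
    have h5 : 2 * (x * c) ^ 2 * (2 * c⁻¹) * A = 4 * A * (x * (x * c)) := by field_simp; ring
    have p0 : 4 * A * (x * (x * c)) ≤ 4 * A * (x * T) := by gcongr
    have p1 : 4 * A * (x * (x * c)) ≤ 4 * A * (x * (x * T)) := by gcongr
    have p2 : 0 ≤ A * (x * (x * T)) := by positivity
    rw [h5]
    interval_cases k
    · rw [zero_add, pow_one, pow_one]
      linarith
    · rw [one_add_one_eq_two]
      linarith
  have t2 : 2 * (x * c) * (L * (2 * x) ^ k * (2 * c⁻¹)) =
      2 ^ (k + 1) * (2 * L) * x ^ (k + 1) := by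
    field_simp; ring
  have t3 : (x * c) ^ 2 * M ^ 2 ≤ 2 ^ (k + 1) * (T ^ 2 * M ^ 2) * x ^ (k + 1) := by
    have p0 : x * ((x * c) * c) * M ^ 2 ≤ x * (T * T) * M ^ 2 := by gcongr
    have p1 : x ^ 2 * (c * c) * M ^ 2 ≤ x ^ 2 * (T * T) * M ^ 2 := by gcongr
    have p2 : 0 ≤ x ^ 2 * (T * T) * M ^ 2 := by positivity
    have p3 : 0 ≤ x * (T * T) * M ^ 2 := by positivity
    interval_cases k
    · rw [zero_add, pow_one, pow_one]
      linarith
    · rw [one_add_one_eq_two]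
      linarith
  have t4 : 2 ^ (k + 1) * (2 * T * A + 2 * L + T ^ 2 * M ^ 2) * x ^ (k + 1) =
      2 ^ (k + 1) * (2 * T * A) * x ^ (k + 1) + 2 ^ (k + 1) * (2 * L) * x ^ (k + 1) +
        2 ^ (k + 1) * (T ^ 2 * M ^ 2) * x ^ (k + 1) := by ring
  linarith

end EvolutionData

/-! #### The iteration -/

/-- Uniform bounds for the first and second differences of solutions. -/
theorem exists_const_evolution (T M : ℝ) (hT : 0 < T) :
    ∃ K : ℝ, 0 ≤ K ∧ ∀ (H : Type) [NormedAddCommGroup H] [InnerProductSpace ℝ H]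
      (D : EvolutionData H T M) (h c : ℝ), 0 < h → 0 < c →
      (∫ t in Ioo c (T - h), ‖D.W h t‖ ^ 2 ≤ K * (h / c) ^ 2) ∧
      ∫ t in Ioo c (T - 2 * h), ‖D.W2 h t‖ ^ 2 ≤ K * (h / c) ^ 3 := by
  have hY : 0 ≤ energyConst T M := by rw [energyConst]; positivity
  set Y := energyConst T M with hYdef
  set A := M ^ 2 + Y / 2 with hA
  have hA0 : 0 ≤ A := by positivity
  set B := T ^ 4 * M ^ 2 / 2 with hB
  have hB0 : 0 ≤ B := by positivity
  set K₁ := 2 * (4 * Y + B) with hK₁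
  set K₂ := 2 * (2 * T * A + 2 * K₁ + T ^ 2 * M ^ 2) with hK₂
  set K₃ := 4 * (K₂ + B) with hK₃
  set K₄ := 4 * (2 * T * A + 2 * K₃ + T ^ 2 * M ^ 2) with hK₄
  set K₅ := 8 * (K₄ + B) with hK₅
  set K₆ := 32 * K₅ + T ^ 4 * M ^ 2 with hK₆
  have hK₁0 : 0 ≤ K₁ := by positivity
  have hK₂0 : 0 ≤ K₂ := by positivity
  have hK₃0 : 0 ≤ K₃ := by positivity
  have hK₄0 : 0 ≤ K₄ := by positivity
  have hK₅0 : 0 ≤ K₅ := by positivity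
  have hK₆0 : 0 ≤ K₆ := by positivity
  refine ⟨K₄ + K₆, by positivity, fun H _ _ D h c hh hc => ?_⟩
  -- The iteration starts from the plain `L²` bound. Each round gains one factor `h / c`; after two
  -- rounds the first differences have the optimal order, and `E3` is reserved for second
  -- differences.
  have X0 : ∀ g c, 0 < g → g < T → 0 < c → c < T → D.X g c ≤ 4 * Y * (g / c) ^ 0 :=
    fun g c _ _ _ _ => by simpa using D.X_le g c
  have E1 := D.EE_le_of_X_le 0 (L := 4 * Y) (by norm_num) X0
  have X1 := D.X_le_of_EE_le_pow 0 (L := K₁) hK₁0 (by norm_num) (by simpa [hK₁] using E1)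
  have E2 := D.EE_le_of_X_le 1 (L := K₂) (by norm_num) (by simpa [hK₂] using X1)
  have X2 := D.X_le_of_EE_le_pow 1 (L := K₃) hK₃0 (by norm_num)
    (fun g c h1 h2 h3 h4 => (E2 g c h1 h2 h3 h4).trans_eq (by rw [hK₃]; ring))
  have X2' : ∀ g c, 0 < g → g < T → 0 < c → c < T → D.X g c ≤ K₄ * (g / c) ^ 2 :=
    fun g c h1 h2 h3 h4 => (X2 g c h1 h2 h3 h4).trans_eq (by rw [hK₄]; ring)
  have E3 := D.EE_le_of_X_le 2 (L := K₄) le_rfl X2'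
  constructor
  · change D.X h c ≤ _
    rcases lt_or_ge c (T - h) with hcT | hcT
    · refine (X2' h c hh (by linarith) hc (by linarith)).trans ?_
      gcongr
      linarith
    · rw [D.X_eq_zero hcT]; positivity
  · rcases lt_or_ge c (T - 2 * h) with hcT | hcT
    -- Distances up to `2h` occur, so `κ` is the bound for `EE` evaluated at `2h`; the extra factor
    -- `h` completes the cube.
    · have h1 := D.integral_W2_sq_le (κ := K₅ * (2 * h / c) ^ 2 * c⁻¹) hh hc (fun g hg =>
        (E3 g c hg.1 (by linarith [hg.2]) hc (by linarith)).trans (by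
          have := hg.1
          have := hg.2.le
          rw [show (2 : ℝ) ^ (2 + 1) * (K₄ + B) = K₅ by rw [hK₅]; norm_num]
          gcongr))
      refine h1.trans ?_
      obtain ⟨x, hx, rfl⟩ : ∃ x : ℝ, 0 < x ∧ h = x * c := ⟨h / c, by positivity, by field_simp⟩
      have e1 : 2 * (x * c) / c = 2 * x := by field_simp
      have e2 : x * c / c = x := by field_simp
      rw [e1, e2]
      have t1 : 8 * (x * c) * (K₅ * (2 * x) ^ 2 * c⁻¹) = 32 * K₅ * x ^ 3 := by field_simp; ring
      have t2 : x ^ 3 * ((x * c) * c ^ 3) * M ^ 2 ≤ x ^ 3 * (T * T ^ 3) * M ^ 2 := by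
        have : x * c ≤ T := by linarith
        have : c ≤ T := by linarith
        gcongr
      have t3 : 0 ≤ K₄ * x ^ 3 := by positivity
      rw [t1, hK₆]
      linarith
    · rw [Ioo_eq_empty hcT.not_gt]
      simp only [Measure.restrict_empty, integral_zero_measure]
      positivity

/-! ### Square integrable functions -/

section Geometric

variable {X : Type*} [MeasurableSpace X] {E : Type*} [NormedAddCommGroup E]

/-- Insert the `k`-th term into the triangle inequality and let `k` tend to infinity. -/
theorem eLpNorm_sub_le_of_tendsto {ν : Measure X} {f : ℕ → X → E} {v : X → E}
    (hf : ∀ k, AEStronglyMeasurable (f k) ν) (hv : AEStronglyMeasurable v ν) {B : ℕ → ℝ≥0∞}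
    (hB : ∀ N k, N ≤ k → eLpNorm (f N - f k) 2 ν ≤ B N)
    (h : Tendsto (fun k => eLpNorm (f k - v) 2 ν) atTop (𝓝 0)) (N : ℕ) :
    eLpNorm (f N - v) 2 ν ≤ B N := by
  have h2 : Tendsto (fun k => B N + eLpNorm (f k - v) 2 ν) atTop (𝓝 (B N)) := by
    simpa using h.const_add (B N)
  refine ge_of_tendsto h2 ?_
  filter_upwards [eventually_ge_atTop N] with k hk
  have h3 : f N - v = (f N - f k) + (f k - v) := by abel
  rw [h3]
  exact (eLpNorm_add_le ((hf N).sub (hf k)) ((hf k).sub hv) (by norm_num)).trans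
    (add_le_add (hB N k hk) le_rfl)

/-- A sequence whose increments are dominated by a geometric sequence. -/
theorem eLpNorm_sub_le_of_geometric {ν : Measure X} {f : ℕ → X → E}
    (hf : ∀ k, AEStronglyMeasurable (f k) ν) {β : ℝ} (hβ : 0 ≤ β)
    (hstep : ∀ k, eLpNorm (f k - f (k + 1)) 2 ν ≤ ENNReal.ofReal (β * (3 / 4) ^ k)) {N k : ℕ}
    (hNk : N ≤ k) : eLpNorm (f N - f k) 2 ν ≤ ENNReal.ofReal (4 * β * (3 / 4) ^ N) := by
  have key : ∀ j, eLpNorm (f N - f (N + j)) 2 ν ≤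
      ENNReal.ofReal (4 * β * ((3 / 4) ^ N - (3 / 4) ^ (N + j))) := by
    intro j
    induction j with
    | zero => simp
    | succ j ih =>
      have h3 : f N - f (N + (j + 1)) = (f N - f (N + j)) + (f (N + j) - f (N + j + 1)) := by
        rw [← add_assoc]; abel
      rw [h3]
      refine (eLpNorm_add_le ((hf _).sub (hf _)) ((hf _).sub (hf _)) (by norm_num)).trans
        ((add_le_add ih (hstep _)).trans ?_)
      rw [← ENNReal.ofReal_add]
      · refine ENNReal.ofReal_le_ofReal (le_of_eq ?_)
        ring
      · have : (3 / 4 : ℝ) ^ (N + j) ≤ (3 / 4) ^ N :=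
          pow_le_pow_of_le_one (by norm_num) (by norm_num) (by omega)
        nlinarith
      · positivity
  obtain ⟨j, rfl⟩ := Nat.exists_eq_add_of_le hNk
  refine (key j).trans (ENNReal.ofReal_le_ofReal ?_)
  have : (0 : ℝ) ≤ (3 / 4) ^ (N + j) := by positivity
  nlinarith

/-- Summable increments give convergence almost everywhere as well as in `L²`. The limit is the
pointwise one, so a single function serves for all measures to which the bound applies. -/
theorem tendsto_of_geometric [CompleteSpace E] {ν : Measure X} {f : ℕ → X → E}
    (hf : ∀ k, StronglyMeasurable (f k)) {β : ℝ} (hβ : 0 ≤ β)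
    (hstep : ∀ k, eLpNorm (f k - f (k + 1)) 2 ν ≤ ENNReal.ofReal (β * (3 / 4) ^ k)) :
    Tendsto (fun k => eLpNorm (f k - fun x => limUnder atTop fun k => f k x) 2 ν) atTop (𝓝 0) := by
  have hf' := fun k => (hf k).aestronglyMeasurable (μ := ν)
  -- The additional `1` makes the Cauchy bound strict also when `β = 0`.
  set B : ℕ → ℝ≥0∞ := fun N => ENNReal.ofReal ((4 * β + 1) * (3 / 4) ^ N) with hB
  have hBs : ∑' N, B N ≠ ⊤ := by
    have hs : Summable fun N : ℕ => (4 * β + 1) * (3 / 4 : ℝ) ^ N :=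
      (summable_geometric_of_lt_one (by norm_num) (by norm_num)).mul_left _
    exact hs.tsum_ofReal_ne_top
  have hc : ∀ N n m, N ≤ n → N ≤ m → eLpNorm (f n - f m) 2 ν < B N := by
    have aux : ∀ N n m, N ≤ n → n ≤ m → eLpNorm (f n - f m) 2 ν < B N := by
      intro N n m h1 h2
      refine (eLpNorm_sub_le_of_geometric hf' hβ hstep h2).trans_lt ?_
      rw [hB, ENNReal.ofReal_lt_ofReal_iff (by positivity)]
      have : (3 / 4 : ℝ) ^ n ≤ (3 / 4) ^ N :=
        pow_le_pow_of_le_one (by norm_num) (by norm_num) h1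
      have h0 : (0 : ℝ) < (3 / 4) ^ N := by positivity
      nlinarith
    intro N n m h1 h2
    rcases le_total n m with h | h
    · exact aux N n m h1 h
    · rw [eLpNorm_sub_comm]
      exact aux N m n h2 h
  refine Lp.cauchy_tendsto_of_tendsto hf' _ hBs hc ?_
  filter_upwards [Lp.ae_tendsto_of_cauchy_eLpNorm hf' (by norm_num) hBs hc] with x hx
  exact tendsto_nhds_limUnder hx

end Geometric

section SquareIntegrable

variable {X : Type*} [MeasurableSpace X] {E : Type*} [NormedAddCommGroup E] [InnerProductSpace ℝ E]

theorem eLpNorm_inner_le {ν : Measure X} {v w : X → E} (hv : AEStronglyMeasurable v ν)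
    (hw : AEStronglyMeasurable w ν) :
    eLpNorm (fun x => inner ℝ (v x) (w x)) 1 ν ≤ eLpNorm v 2 ν * eLpNorm w 2 ν := by
  have := eLpNorm_le_eLpNorm_mul_eLpNorm'_of_norm (p := 2) (q := 2) (r := 1) hv hw
    (fun a b => inner ℝ a b) 1 (ae_of_all _ fun x => by
      simpa using norm_inner_le_norm (𝕜 := ℝ) (v x) (w x))
  simpa using this

theorem integrable_inner_of_memLp {ν : Measure X} {v w : X → E} (hv : MemLp v 2 ν)
    (hw : MemLp w 2 ν) : Integrable (fun x => inner ℝ (v x) (w x)) ν := by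
  rw [← memLp_one_iff_integrable]
  exact ⟨hv.1.inner hw.1, (eLpNorm_inner_le hv.1 hw.1).trans_lt (ENNReal.mul_lt_top hv.2 hw.2)⟩

theorem tendsto_integral_inner {ν : Measure X} {ι : Type*} {l : Filter ι} {w : ι → X → E}
    {v ζ : X → E} (hw : ∀ i, MemLp (w i) 2 ν) (hv : AEStronglyMeasurable v ν) (hζ : MemLp ζ 2 ν)
    (h : Tendsto (fun i => eLpNorm (w i - v) 2 ν) l (𝓝 0)) :
    Tendsto (fun i => ∫ x, inner ℝ (w i x) (ζ x) ∂ν) l (𝓝 (∫ x, inner ℝ (v x) (ζ x) ∂ν)) := by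
  refine tendsto_integral_of_L1' _ (hv.inner hζ.1)
    (Eventually.of_forall fun i => integrable_inner_of_memLp (hw i) hζ) ?_
  have h2 : Tendsto (fun i => eLpNorm (w i - v) 2 ν * eLpNorm ζ 2 ν) l (𝓝 0) := by
    simpa using ENNReal.Tendsto.mul_const h (Or.inr hζ.2.ne)
  refine tendsto_of_tendsto_of_tendsto_of_le_of_le tendsto_const_nhds h2 (fun _ => zero_le)
    fun i => ?_
  refine le_trans (le_of_eq ?_) (eLpNorm_inner_le ((hw i).1.sub hv) hζ.1)
  congr 1
  ext x
  simp [inner_sub_left]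

end SquareIntegrable

/-! ### Uniqueness of weak limits -/

section Uniqueness

variable {X : Type*} [NormedAddCommGroup X] [NormedSpace ℝ X] [FiniteDimensional ℝ X]
  [MeasurableSpace X] [BorelSpace X] {E : Type*} [NormedAddCommGroup E] [InnerProductSpace ℝ E]
  [CompleteSpace E]

/-- Testing with a scalar function times a fixed vector `e`, for every `e`, reduces the claim to the
fundamental lemma for scalar test functions. -/
theorem ae_eq_of_integral_inner_eq {ν : Measure X} [IsLocallyFiniteMeasure ν]
    {O : Set X} (hO : IsOpen O) {v w : X → E}
    (hv : MemLp v 2 (ν.restrict O)) (hw : MemLp w 2 (ν.restrict O))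
    (h : ∀ ζ : X → E, ContDiff ℝ ∞ ζ → HasCompactSupport ζ → tsupport ζ ⊆ O →
      ∫ x in O, inner ℝ (v x) (ζ x) ∂ν = ∫ x in O, inner ℝ (w x) (ζ x) ∂ν) :
    v =ᵐ[ν.restrict O] w := by
  have hvw := hv.sub hw
  have hI : MemLp (O.indicator (v - w)) 2 ν :=
    (memLp_indicator_iff_restrict hO.measurableSet).2 hvw
  have hz : ∀ᵐ x ∂ν, x ∈ O → O.indicator (v - w) x = 0 := by
    refine hO.ae_eq_zero_of_integral_contDiff_smul_eq_zero
      ((hI.locallyIntegrable (by norm_num)).locallyIntegrableOn _) fun g hg hgc hgO => ?_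
    have hg2 : MemLp g 2 ν := hg.continuous.memLp_of_hasCompactSupport hgc
    have hgi : Integrable (fun x => g x • O.indicator (v - w) x) ν :=
      memLp_one_iff_integrable.1 (hI.smul (r := 1) hg2)
    have hkey : ∀ e : E, inner ℝ e (∫ x, g x • O.indicator (v - w) x ∂ν) = 0 := by
      intro e
      rw [← integral_inner hgi]
      have hζ2 : MemLp (fun x => g x • e) 2 (ν.restrict O) :=
        ((hg.continuous.smul continuous_const).memLp_of_hasCompactSupport
          hgc.smul_right).restrict O
      have h1 := h (fun x => g x • e) (hg.smul contDiff_const) hgc.smul_right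
        ((tsupport_smul_subset_left g fun _ => e).trans hgO)
      rw [← sub_eq_zero, ← integral_sub (integrable_inner_of_memLp hv hζ2)
        (integrable_inner_of_memLp hw hζ2), ← integral_indicator hO.measurableSet] at h1
      rw [← h1]
      congr 1
      ext x
      by_cases hx : x ∈ O
      · simp [hx, inner_smul_right, inner_sub_right, real_inner_comm]
        ring
      · simp [hx]
    exact ext_inner_left ℝ fun e => by rw [hkey e, inner_zero_right]
  rw [EventuallyEq, ae_restrict_iff' hO.measurableSet]
  filter_upwards [hz] with x hx hxO
  have := hx hxO
  rw [indicator_of_mem hxO] at this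
  exact sub_eq_zero.1 this

end Uniqueness

/-! ### Difference quotients in time -/

section DifferenceQuotients

variable {n N : ℕ}

/-- Lebesgue measure on `(c, d) × Ω`. -/
abbrev slab (Ω : Set (Vec n)) (c d : ℝ) : Measure (ℝ × Vec n) := volume.restrict (Ioo c d ×ˢ Ω)

/-- The increment in time. -/
def timeDiff (u : ℝ × Vec n → Vec N) (h : ℝ) (z : ℝ × Vec n) : Vec N := u (z.1 + h, z.2) - u z

/-- The difference quotient in time. -/
def diffQuot (u : ℝ × Vec n → Vec N) (h : ℝ) (z : ℝ × Vec n) : Vec N := h⁻¹ • timeDiff u h z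

/-- The limit of the difference quotients along `h / 2 ^ k`. -/
def dyadicDeriv (u : ℝ × Vec n → Vec N) (h : ℝ) (z : ℝ × Vec n) : Vec N :=
  limUnder atTop fun k : ℕ => diffQuot u (h / 2 ^ k) z

variable {u : ℝ × Vec n → Vec N} {Ω : Set (Vec n)}

theorem stronglyMeasurable_timeDiff (hu : StronglyMeasurable u) (h : ℝ) :
    StronglyMeasurable (timeDiff u h) :=
  (hu.comp_measurable (by fun_prop)).sub hu

theorem stronglyMeasurable_diffQuot (hu : StronglyMeasurable u) (h : ℝ) :
    StronglyMeasurable (diffQuot u h) :=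
  (stronglyMeasurable_timeDiff hu h).const_smul h⁻¹

theorem stronglyMeasurable_dyadicDeriv (hu : StronglyMeasurable u) (h : ℝ) :
    StronglyMeasurable (dyadicDeriv u h) :=
  StronglyMeasurable.limUnder fun _ => stronglyMeasurable_diffQuot hu _

/-- The tail of a sequence has the same limit. Hence the error estimate for step `h` also applies to
the steps `h / 2 ^ j` with the same limit function. -/
theorem dyadicDeriv_div (u : ℝ × Vec n → Vec N) (h : ℝ) (j : ℕ) :
    dyadicDeriv u (h / 2 ^ j) = dyadicDeriv u h := by
  ext1 z
  unfold dyadicDeriv limUnder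
  congr 1
  conv_rhs => rw [← Filter.map_add_atTop_eq_nat j, Filter.map_map]
  congr 1
  ext1 k
  simp only [Function.comp, pow_add, div_div, mul_comm]

theorem measurePreserving_timeShift (h : ℝ) :
    MeasurePreserving (fun z : ℝ × Vec n => (z.1 + h, z.2)) volume volume :=
  (measurePreserving_add_right volume h).prod (MeasurePreserving.id volume)

theorem memLp_timeShift (hu : MemLp u 2 volume) (h : ℝ) :
    MemLp (fun z : ℝ × Vec n => u (z.1 + h, z.2)) 2 volume :=
  hu.comp_measurePreserving (measurePreserving_timeShift h)

theorem memLp_diffQuot (hu : MemLp u 2 volume) (h : ℝ) : MemLp (diffQuot u h) 2 volume :=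
  ((memLp_timeShift hu h).sub hu).const_smul h⁻¹

theorem eLpNorm_timeShift_le (hΩ : MeasurableSet Ω) {g : ℝ × Vec n → Vec N}
    (hg : StronglyMeasurable g)
    (h c d : ℝ) : eLpNorm (fun z => g (z.1 + h, z.2)) 2 (slab Ω c d) =
      eLpNorm g 2 (slab Ω (c + h) (d + h)) := by
  have h1 := (measurePreserving_timeShift (n := n) h).restrict_preimage
    (measurableSet_Ioo (a := c + h) (b := d + h) |>.prod hΩ)
  have h2 : (fun z : ℝ × Vec n => (z.1 + h, z.2)) ⁻¹' (Ioo (c + h) (d + h) ×ˢ Ω) = Ioo c d ×ˢ Ω := by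
    ext z
    simp
  rw [h2] at h1
  exact eLpNorm_comp_measurePreserving hg.aestronglyMeasurable h1

theorem eLpNorm_slab_mono (g : ℝ × Vec n → Vec N) {c d c' d' : ℝ} (hc : c' ≤ c) (hd : d ≤ d') :
    eLpNorm g 2 (slab Ω c d) ≤ eLpNorm g 2 (slab Ω c' d') :=
  eLpNorm_mono_measure _ (Measure.restrict_mono
    (prod_mono (Ioo_subset_Ioo hc hd) le_rfl) le_rfl)

/-- This identity converts bounds for second differences into convergence of the dyadic difference
quotients. -/
theorem diffQuot_sub_diffQuot_half (u : ℝ × Vec n → Vec N) {h : ℝ} (hh : h ≠ 0) :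
    diffQuot u (2 * h) - diffQuot u h = (2 * h)⁻¹ • timeDiff (timeDiff u h) h := by
  ext1 z
  have e : z.1 + 2 * h = z.1 + h + h := by ring
  simp only [diffQuot, timeDiff, Pi.sub_apply, Pi.smul_apply, e]
  have : h⁻¹ = (2 * h)⁻¹ * 2 := by field_simp
  rw [this]
  module

theorem diffQuot_timeShift_sub (u : ℝ × Vec n → Vec N) (h : ℝ) (z : ℝ × Vec n) :
    diffQuot u h (z.1 + h, z.2) - diffQuot u h z = h⁻¹ • timeDiff (timeDiff u h) h z := by
  simp only [diffQuot, timeDiff]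
  module

/-- Bounds for the first and second differences of `u` in time. -/
structure DifferenceBounds (Ω : Set (Vec n)) (T K : ℝ) (u : ℝ × Vec n → Vec N) : Prop where
  nonneg : 0 ≤ K
  open_set : IsOpen Ω
  meas : StronglyMeasurable u
  memLp : MemLp u 2 volume
  first : ∀ h c : ℝ, 0 < h → 0 < c →
    eLpNorm (timeDiff u h) 2 (slab Ω c (T - h)) ≤ ENNReal.ofReal √(K * (h / c) ^ 2)
  second : ∀ h c : ℝ, 0 < h → 0 < c →
    eLpNorm (timeDiff (timeDiff u h) h) 2 (slab Ω c (T - 2 * h)) ≤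
      ENNReal.ofReal √(K * (h / c) ^ 3)

/-! ### Convergence of the dyadic difference quotients. -/

namespace DifferenceBounds

variable {T K : ℝ}

/-- A second difference with step `g` is `O(g^{3/2})` and is divided by `2g`, so halving the step
gains `2^{-1/2}`; the rational ratio `3/4` is used instead. -/
theorem eLpNorm_step (B : DifferenceBounds Ω T K u) {h c : ℝ} (hh : 0 < h) (hc : 0 < c) (k : ℕ) :
    eLpNorm (diffQuot u (h / 2 ^ k) - diffQuot u (h / 2 ^ (k + 1))) 2 (slab Ω c (T - h)) ≤
      ENNReal.ofReal (√(K * h / c ^ 3) * (3 / 4) ^ k) := by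
  have hK := B.nonneg
  set g := h / 2 ^ (k + 1) with hg
  have hg0 : 0 < g := by positivity
  have h2 : h / 2 ^ k = 2 * g := by rw [hg, pow_succ]; field_simp
  have hgh : 2 * g ≤ h := by
    rw [← h2]; exact div_le_self hh.le (one_le_pow₀ (by norm_num))
  rw [h2, diffQuot_sub_diffQuot_half u hg0.ne', eLpNorm_const_smul,
    Real.enorm_of_nonneg (by positivity)]
  refine (mul_le_mul_right ((eLpNorm_slab_mono _ le_rfl (by linarith)).trans
    (B.second g c hg0 hc)) _).trans ?_
  rw [← ENNReal.ofReal_mul (by positivity)]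
  refine ENNReal.ofReal_le_ofReal ?_
  rw [inv_mul_le_iff₀ (by positivity)]
  refine Real.sqrt_le_iff.2 ⟨by positivity, ?_⟩
  rw [mul_pow (2 * g), mul_pow √_, Real.sq_sqrt (by positivity), ← pow_mul, ← h2]
  -- After squaring and removing `4 ^ (-k)` the true ratio `1/2` is weakened to `9/16`, that is `1/8
  -- ≤ 9/64`.
  have e1 : (1 / 8 : ℝ) ^ (k + 1) ≤ (9 / 64) ^ k := by
    rw [pow_succ]
    have : (1 / 8 : ℝ) ^ k ≤ (9 / 64) ^ k := pow_le_pow_left₀ (by norm_num) (by norm_num) k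
    have h0 : (0 : ℝ) ≤ (1 / 8) ^ k := by positivity
    linarith
  have e2 : K * (g / c) ^ 3 = K * h ^ 3 / c ^ 3 * (1 / 8) ^ (k + 1) := by
    have : (8 : ℝ) = 2 ^ 3 := by norm_num
    rw [hg, this, one_div, inv_pow, ← pow_mul, mul_comm 3 (k + 1), pow_mul]
    field_simp
  have e3 : (h / 2 ^ k) ^ 2 * (K * h / c ^ 3 * (3 / 4) ^ (k * 2)) =
      K * h ^ 3 / c ^ 3 * (9 / 64) ^ k := by
    have e4 : (9 / 64 : ℝ) ^ k = (3 / 4) ^ (k * 2) / (2 ^ k) ^ 2 := by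
      rw [← pow_mul, mul_comm k 2, pow_mul, pow_mul, ← div_pow]; norm_num
    rw [e4]
    field_simp
  rw [e2, e3]
  gcongr

/-- Summing the geometric series from its first term; the factor `4` is `1 / (1 - 3/4)`. -/
theorem eLpNorm_diffQuot_sub_le (B : DifferenceBounds Ω T K u) {h c : ℝ} (hh : 0 < h) (hc : 0 < c) :
    eLpNorm (diffQuot u h - dyadicDeriv u h) 2 (slab Ω c (T - h)) ≤
      ENNReal.ofReal (4 * √(K * h / c ^ 3)) := by
  have h0 := Real.sqrt_nonneg (K * h / c ^ 3)
  have hf := fun k : ℕ => stronglyMeasurable_diffQuot B.meas (h / 2 ^ k)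
  have h1 := eLpNorm_sub_le_of_tendsto (f := fun k : ℕ => diffQuot u (h / 2 ^ k))
    (v := dyadicDeriv u h) (ν := slab Ω c (T - h))
    (fun k => (hf k).aestronglyMeasurable)
    (stronglyMeasurable_dyadicDeriv B.meas h).aestronglyMeasurable
    (B := fun N => ENNReal.ofReal (4 * √(K * h / c ^ 3) * (3 / 4) ^ N))
    (fun N k hNk => eLpNorm_sub_le_of_geometric (f := fun k : ℕ => diffQuot u (h / 2 ^ k))
      (fun k => (hf k).aestronglyMeasurable) h0
      (B.eLpNorm_step hh hc) hNk)
    (tendsto_of_geometric hf h0 (B.eLpNorm_step hh hc)) 0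
  simpa using h1

/-- The step bound covers times up to `T - h`. Applying it with step `h / 2 ^ k` reaches every `d <
T` once `k` is large. -/
theorem tendsto_diffQuot (B : DifferenceBounds Ω T K u)
    {h c d : ℝ} (hh : 0 < h) (hc : 0 < c) (hd : d < T) :
    Tendsto (fun k : ℕ => eLpNorm (diffQuot u (h / 2 ^ k) - dyadicDeriv u h) 2 (slab Ω c d))
      atTop (𝓝 0) := by
  have hlim : Tendsto (fun k : ℕ => h / 2 ^ k) atTop (𝓝 0) :=
    tendsto_const_nhds.div_atTop (tendsto_pow_atTop_atTop_of_one_lt (by norm_num))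
  have h2 : Tendsto (fun k : ℕ => ENNReal.ofReal (4 * √(K * (h / 2 ^ k) / c ^ 3))) atTop (𝓝 0) := by
    have h3 : Continuous fun x : ℝ => ENNReal.ofReal (4 * √(K * x / c ^ 3)) :=
      ENNReal.continuous_ofReal.comp (by fun_prop)
    have := (h3.tendsto 0).comp hlim
    rw [show ENNReal.ofReal (4 * √(K * 0 / c ^ 3)) = 0 by simp] at this
    exact this
  refine tendsto_of_tendsto_of_tendsto_of_le_of_le' tendsto_const_nhds h2
    (Eventually.of_forall fun _ => zero_le) ?_
  filter_upwards [hlim.eventually (gt_mem_nhds (sub_pos.2 hd))] with k hk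
  rw [← dyadicDeriv_div u h k]
  exact (eLpNorm_slab_mono _ le_rfl (by linarith)).trans
    (B.eLpNorm_diffQuot_sub_le (by positivity) hc)

theorem memLp_dyadicDeriv (B : DifferenceBounds Ω T K u)
    {h c d : ℝ} (hh : 0 < h) (hc : 0 < c) (hd : d < T) :
    MemLp (dyadicDeriv u h) 2 (slab Ω c d) := by
  have h1 := B.tendsto_diffQuot hh hc hd
  obtain ⟨k, hk⟩ := (h1.eventually (gt_mem_nhds zero_lt_one)).exists
  have h2 : MemLp (diffQuot u (h / 2 ^ k) - dyadicDeriv u h) 2 (slab Ω c d) :=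
    ⟨((stronglyMeasurable_diffQuot B.meas _).sub
      (stronglyMeasurable_dyadicDeriv B.meas h)).aestronglyMeasurable, hk.trans ENNReal.one_lt_top⟩
  have := ((memLp_diffQuot B.memLp (h / 2 ^ k)).restrict (Ioo c d ×ˢ Ω)).sub h2
  simpa using this

end DifferenceBounds

/-- Discrete integration by parts: a translation moves the difference quotient to the other factor
with the opposite step. -/
theorem integral_inner_diffQuot (hu : MemLp u 2 volume) {ζ : ℝ × Vec n → Vec N}
    (hζ : MemLp ζ 2 volume) (h : ℝ) :
    ∫ z, inner ℝ (diffQuot u h z) (ζ z) = -∫ z, inner ℝ (u z) (diffQuot ζ (-h) z) := by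
  have h1 : ∫ z : ℝ × Vec n, inner ℝ (u (z.1 + h, z.2)) (ζ z) =
      ∫ z : ℝ × Vec n, inner ℝ (u z) (ζ (z.1 + -h, z.2)) := by
    have e : MeasurableEmbedding fun z : ℝ × Vec n => (z.1 + h, z.2) :=
      ((MeasurableEquiv.addRight h).prodCongr (MeasurableEquiv.refl (Vec n))).measurableEmbedding
    have := (measurePreserving_timeShift (n := n) h).integral_comp e
      (fun z => inner ℝ (u z) (ζ (z.1 + -h, z.2)))
    rw [← this]
    simp
  have i1 := integrable_inner_of_memLp (memLp_timeShift hu h) hζ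
  have i2 := integrable_inner_of_memLp hu (memLp_timeShift hζ (-h))
  have i3 := integrable_inner_of_memLp hu hζ
  simp only [diffQuot, timeDiff, inner_smul_left, inner_smul_right, inner_sub_left,
    inner_sub_right, integral_const_mul, integral_sub i1 i3, integral_sub i2 i3, h1]
  simp [inv_neg]

/-- The quotient is moved onto the smooth function, where it converges pointwise and is dominated
through the Lipschitz constant. -/
theorem tendsto_integral_diffQuot (hu : MemLp u 2 volume) {ζ : ℝ × Vec n → Vec N}
    (hζ : ContDiff ℝ ∞ ζ) (hζc : HasCompactSupport ζ) {ε : ℕ → ℝ} (hε : ∀ k, ε k ≠ 0)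
    (hε0 : Tendsto ε atTop (𝓝 0)) :
    Tendsto (fun k => ∫ z, inner ℝ (diffQuot u (ε k) z) (ζ z)) atTop
      (𝓝 (-∫ z, inner ℝ (u z) (timeDeriv ζ z))) := by
  simp_rw [integral_inner_diffQuot hu (hζ.continuous.memLp_of_hasCompactSupport hζc)]
  refine Tendsto.neg ?_
  obtain ⟨C, hC⟩ := ContDiff.lipschitzWith_of_hasCompactSupport hζc hζ (by simp)
  -- For steps of size at most one the difference quotients of `ζ` vanish outside this compact set,
  -- on which `u` is integrable.
  set Z := Metric.cthickening 1 (tsupport ζ) with hZ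
  have hZc : IsCompact Z := hζc.isCompact.cthickening
  have hui : Integrable (fun z => C * Z.indicator (fun z => ‖u z‖) z) volume := by
    refine Integrable.const_mul ?_ _
    rw [integrable_indicator_iff hZc.measurableSet]
    have : IsFiniteMeasure (volume.restrict Z) := ⟨by simpa using hZc.measure_lt_top⟩
    exact ((hu.restrict Z).integrable (by norm_num)).norm
  refine tendsto_integral_filter_of_dominated_convergence _ ?_ ?_ hui ?_
  · refine Eventually.of_forall fun k => hu.1.inner ?_
    exact (stronglyMeasurable_diffQuot hζ.continuous.stronglyMeasurable _).aestronglyMeasurable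
  · filter_upwards [hε0.eventually (Metric.closedBall_mem_nhds 0 one_pos)] with k hk
    refine ae_of_all _ fun z => (norm_inner_le_norm _ _).trans ?_
    have hk1 : |ε k| ≤ 1 := by simpa using hk
    by_cases hz : z ∈ Z
    · rw [indicator_of_mem hz, mul_comm (C : ℝ)]
      refine mul_le_mul_of_nonneg_left ?_ (norm_nonneg _)
      have h1 := hC.dist_le_mul (z.1 + -ε k, z.2) z
      rw [dist_eq_norm, dist_eq_norm] at h1
      have h2 : ‖((z.1 + -ε k, z.2) : ℝ × Vec n) - z‖ = |ε k| := by
        simp [Prod.norm_def]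
      rw [h2] at h1
      rw [diffQuot, timeDiff, norm_smul, norm_inv, norm_neg, Real.norm_eq_abs,
        inv_mul_le_iff₀ (abs_pos.2 (hε k))]
      linarith
    · have h1 : ζ z = 0 := by
        by_contra h
        exact hz (Metric.self_subset_cthickening _ (subset_tsupport _ h))
      have h2 : ζ (z.1 + -ε k, z.2) = 0 := by
        by_contra h
        refine hz (Metric.mem_cthickening_of_dist_le z _ 1 _ (subset_tsupport _ h) ?_)
        simpa [Prod.dist_eq, Real.dist_eq] using hk1
      simp [diffQuot, timeDiff, h1, h2, hz]
  · refine ae_of_all _ fun z => Tendsto.inner tendsto_const_nhds ?_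
    have hd : HasDerivAt (fun s => ζ (s, z.2)) (timeDeriv ζ z) z.1 := by
      refine DifferentiableAt.hasDerivAt ?_
      exact ((hζ.differentiable (by simp)).comp (by fun_prop)).differentiableAt
    have h1 := hasDerivAt_iff_tendsto_slope_zero.1 hd
    have h2 : Tendsto (fun k => -ε k) atTop (𝓝[≠] 0) := by
      refine tendsto_nhdsWithin_iff.2 ⟨by simpa using hε0.neg, Eventually.of_forall fun k => ?_⟩
      simpa using hε k
    exact h1.comp h2

theorem setIntegral_inner_eq_integral {O : Set (ℝ × Vec n)} {v ζ : ℝ × Vec n → Vec N}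
    (hζ : tsupport ζ ⊆ O) : ∫ z in O, inner ℝ (v z) (ζ z) = ∫ z, inner ℝ (v z) (ζ z) := by
  refine setIntegral_eq_integral_of_forall_compl_eq_zero fun z hz => ?_
  rw [image_eq_zero_of_notMem_tsupport fun h => hz (hζ h), inner_zero_right]

/-! ### The limit as weak time derivative and its Nikolskij norm. -/

namespace DifferenceBounds

variable {T K : ℝ}

/-- The pairings converge once by `L²` convergence of the quotients and once by discrete integration
by parts; the two limits agree. -/
theorem integral_inner_dyadicDeriv (B : DifferenceBounds Ω T K u)
    {h c d : ℝ} (hh : 0 < h) (hc : 0 < c) (hd : d < T)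
    {ζ : ℝ × Vec n → Vec N} (hζ : ContDiff ℝ ∞ ζ) (hζc : HasCompactSupport ζ)
    (hζs : tsupport ζ ⊆ Ioo c d ×ˢ Ω) :
    ∫ z in Ioo c d ×ˢ Ω, inner ℝ (dyadicDeriv u h z) (ζ z) =
      -∫ z, inner ℝ (u z) (timeDeriv ζ z) := by
  have hζ2 : MemLp ζ 2 (slab Ω c d) := (hζ.continuous.memLp_of_hasCompactSupport hζc).restrict _
  have h1 := tendsto_integral_inner (fun k : ℕ => (memLp_diffQuot B.memLp (h / 2 ^ k)).restrict _)
    (stronglyMeasurable_dyadicDeriv B.meas h).aestronglyMeasurable hζ2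
    (B.tendsto_diffQuot hh hc hd)
  simp_rw [setIntegral_inner_eq_integral hζs] at h1 ⊢
  exact tendsto_nhds_unique h1 (tendsto_integral_diffQuot B.memLp hζ hζc (fun k => by positivity)
    (tendsto_const_nhds.div_atTop (tendsto_pow_atTop_atTop_of_one_lt (by norm_num))))

/-- Different initial steps give dyadic sequences without common terms in general; uniqueness of
weak derivatives identifies their limits. -/
theorem dyadicDeriv_ae_eq (B : DifferenceBounds Ω T K u)
    {h h' c d : ℝ} (hh : 0 < h) (hh' : 0 < h') (hc : 0 < c) (hd : d < T) :
    dyadicDeriv u h =ᵐ[slab Ω c d] dyadicDeriv u h' := by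
  refine ae_eq_of_integral_inner_eq (isOpen_Ioo.prod B.open_set) (B.memLp_dyadicDeriv hh hc hd)
    (B.memLp_dyadicDeriv hh' hc hd) fun ζ h1 h2 h3 => ?_
  rw [B.integral_inner_dyadicDeriv hh hc hd h1 h2 h3,
    B.integral_inner_dyadicDeriv hh' hc hd h1 h2 h3]

theorem isWeakTimeDeriv (B : DifferenceBounds Ω T K u)
    {h : ℝ} (hh : 0 < h) : IsWeakTimeDeriv T Ω u (dyadicDeriv u h) := by
  intro ζ hζ
  -- The estimates degenerate at the ends of `(0, T)`, but the support of a test function is compact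
  -- and stays away from them.
  obtain ⟨c, d, hc, hd, hcd⟩ : ∃ c d : ℝ, 0 < c ∧ d < T ∧ tsupport ζ ⊆ Ioo c d ×ˢ Ω := by
    have hK : IsCompact (Prod.fst '' tsupport ζ) := hζ.compact.isCompact.image continuous_fst
    have hs : ∀ z ∈ tsupport ζ, z.1 ∈ Ioo 0 T ∧ z.2 ∈ Ω := fun z hz => hζ.support hz
    rcases (Prod.fst '' tsupport ζ).eq_empty_or_nonempty with he | hne
    · rw [image_eq_empty] at he
      exact ⟨1, T - 1, one_pos, by linarith, by simp [he]⟩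
    · obtain ⟨c, ⟨zc, hzc, rfl⟩, hc'⟩ := hK.exists_isLeast hne
      obtain ⟨d, ⟨zd, hzd, rfl⟩, hd'⟩ := hK.exists_isGreatest hne
      refine ⟨zc.1 / 2, (zd.1 + T) / 2, by linarith [(hs _ hzc).1.1],
        by linarith [(hs _ hzd).1.2], fun z hz => ⟨⟨?_, ?_⟩, (hs z hz).2⟩⟩
      · have := hc' ⟨z, hz, rfl⟩
        linarith [(hs _ hzc).1.1]
      · have := hd' ⟨z, hz, rfl⟩
        linarith [(hs _ hzd).1.2]
  have h1 := B.integral_inner_dyadicDeriv hh hc hd hζ.smooth hζ.compact hcd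
  have h2 : tsupport (timeDeriv ζ) ⊆ cylinder T Ω := by
    refine (closure_minimal (fun z hz => ?_) (isClosed_tsupport ζ)).trans hζ.support
    by_contra hz'
    refine hz ?_
    have h0 : (fun s => ζ (s, z.2)) =ᶠ[𝓝 z.1] fun _ => 0 := by
      have : ∀ᶠ w in 𝓝 z, w ∉ tsupport ζ := (isClosed_tsupport ζ).isOpen_compl.mem_nhds hz'
      have hc : Tendsto (fun s : ℝ => (s, z.2)) (𝓝 z.1) (𝓝 z) :=
        (Continuous.tendsto (by fun_prop) z.1 : Tendsto (fun s : ℝ => (s, z.2)) _ (𝓝 (z.1, z.2)))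
      filter_upwards [hc.eventually this] with s hs
      exact image_eq_zero_of_notMem_tsupport hs
    rw [timeDeriv, h0.deriv_eq, deriv_const]
  rw [setIntegral_inner_eq_integral hcd] at h1
  rw [setIntegral_inner_eq_integral h2, setIntegral_inner_eq_integral (O := cylinder T Ω) hζ.support, h1,
    neg_neg]

/-- Compare with the difference quotient of step `a`: the quotient contributes `1` and the error `4`
to the constant. -/
theorem eLpNorm_dyadicDeriv_le (B : DifferenceBounds Ω T K u) {a : ℝ} (ha : 0 < a) :
    eLpNorm (dyadicDeriv u 1) 2 (slab Ω a (T - a)) ≤ ENNReal.ofReal (5 * √K / a) := by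
  have hK := B.nonneg
  rw [eLpNorm_congr_ae (B.dyadicDeriv_ae_eq one_pos ha ha (by linarith))]
  have h1 : dyadicDeriv u a = diffQuot u a - (diffQuot u a - dyadicDeriv u a) := by abel
  have m1 := (stronglyMeasurable_diffQuot B.meas a).aestronglyMeasurable (μ := slab Ω a (T - a))
  have m2 := (stronglyMeasurable_dyadicDeriv B.meas a).aestronglyMeasurable (μ := slab Ω a (T - a))
  rw [h1]
  refine (eLpNorm_sub_le m1 (m1.sub m2) (by norm_num)).trans ?_
  have h2 : eLpNorm (diffQuot u a) 2 (slab Ω a (T - a)) ≤ ENNReal.ofReal (√K / a) := by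
    have : diffQuot u a = a⁻¹ • timeDiff u a := rfl
    rw [this, eLpNorm_const_smul, Real.enorm_of_nonneg (by positivity)]
    refine (mul_le_mul_right (B.first a a ha ha) _).trans ?_
    rw [← ENNReal.ofReal_mul (by positivity), div_self ha.ne', one_pow, mul_one, inv_mul_eq_div]
  refine (add_le_add h2 (B.eLpNorm_diffQuot_sub_le ha ha)).trans ?_
  rw [← ENNReal.ofReal_add (by positivity) (by positivity)]
  refine ENNReal.ofReal_le_ofReal (le_of_eq ?_)
  have : K * a / a ^ 3 = K / a ^ 2 := by field_simp
  rw [this, Real.sqrt_div' _ (by positivity), Real.sqrt_sq ha.le]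
  ring

/-- For `h ≤ a` the increment of the derivative is a second difference over `h` plus the
approximation errors at the two times, with constants `1 + 4 + 4 ≤ 10`. For `h > a` the triangle
inequality suffices, since then `a⁻¹ ≤ (h / a³)^{1/2}`. The number `100` is `10²`. -/
theorem eLpNorm_timeDiff_dyadicDeriv_le (B : DifferenceBounds Ω T K u)
    {a h : ℝ} (ha : 0 < a) (hh : 0 < h) :
    eLpNorm (timeDiff (dyadicDeriv u 1) h) 2 (slab Ω a (T - a - h)) ≤
      ENNReal.ofReal (√(100 * K / a ^ 3) * √h) := by
  have hK := B.nonneg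
  have mv := stronglyMeasurable_dyadicDeriv B.meas 1
  rcases le_or_gt h a with hha | hha
  · have mq := stronglyMeasurable_diffQuot B.meas h
    set w := diffQuot u h - dyadicDeriv u 1 with hw
    have mw : StronglyMeasurable w := mq.sub mv
    have hwb : eLpNorm w 2 (slab Ω a (T - a)) ≤ ENNReal.ofReal (4 * √(K * h / a ^ 3)) := by
      have : w =ᵐ[slab Ω a (T - a)] diffQuot u h - dyadicDeriv u h := by
        filter_upwards [B.dyadicDeriv_ae_eq one_pos hh ha (show T - a < T by linarith)] with z hz
        simp [hw, hz]
      rw [eLpNorm_congr_ae this]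
      exact (eLpNorm_slab_mono _ le_rfl (by linarith)).trans (B.eLpNorm_diffQuot_sub_le hh ha)
    have h1 : timeDiff (dyadicDeriv u 1) h =
        h⁻¹ • timeDiff (timeDiff u h) h + (w - fun z => w (z.1 + h, z.2)) := by
      ext1 z
      rw [Pi.add_apply, Pi.smul_apply, ← diffQuot_timeShift_sub u h z]
      simp only [Pi.sub_apply, hw, timeDiff]
      abel
    have ms : StronglyMeasurable fun z : ℝ × Vec n => w (z.1 + h, z.2) :=
      mw.comp_measurable (by fun_prop)
    rw [h1]
    refine (eLpNorm_add_le ((stronglyMeasurable_timeDiff (stronglyMeasurable_timeDiff B.meas h)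
      h).const_smul _).aestronglyMeasurable (mw.sub ms).aestronglyMeasurable (by norm_num)).trans ?_
    refine (add_le_add le_rfl (eLpNorm_sub_le mw.aestronglyMeasurable ms.aestronglyMeasurable
      (by norm_num))).trans ?_
    rw [eLpNorm_timeShift_le B.open_set.measurableSet mw, eLpNorm_const_smul,
      Real.enorm_of_nonneg (by positivity)]
    refine (add_le_add (mul_le_mul_right ((eLpNorm_slab_mono _ le_rfl (by linarith)).trans
      (B.second h a hh ha)) _) (add_le_add
      ((eLpNorm_slab_mono w (c' := a) (d' := T - a) le_rfl (by linarith)).trans hwb)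
      ((eLpNorm_slab_mono w (c' := a) (d' := T - a) (by linarith) (by linarith)).trans hwb))).trans ?_
    rw [← ENNReal.ofReal_mul (by positivity), ← ENNReal.ofReal_add (by positivity) (by positivity),
      ← ENNReal.ofReal_add (by positivity) (by positivity)]
    refine ENNReal.ofReal_le_ofReal ?_
    have e1 : K * (h / a) ^ 3 = K * h / a ^ 3 * h ^ 2 := by field_simp
    have e2 : √(100 * K / a ^ 3) * √h = 10 * √(K * h / a ^ 3) := by
      rw [← Real.sqrt_mul (by positivity), show 100 * K / a ^ 3 * h = 10 ^ 2 * (K * h / a ^ 3) by ring,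
        Real.sqrt_mul (by norm_num), Real.sqrt_sq (by norm_num)]
    rw [e1, e2, Real.sqrt_mul (by positivity), Real.sqrt_sq hh.le]
    have e3 : h⁻¹ * (√(K * h / a ^ 3) * h) = √(K * h / a ^ 3) := by field_simp
    rw [e3]
    linarith [Real.sqrt_nonneg (K * h / a ^ 3)]
  · have ms : StronglyMeasurable fun z : ℝ × Vec n => dyadicDeriv u 1 (z.1 + h, z.2) :=
      mv.comp_measurable (by fun_prop)
    have h1 : timeDiff (dyadicDeriv u 1) h =
      (fun z : ℝ × Vec n => dyadicDeriv u 1 (z.1 + h, z.2)) - dyadicDeriv u 1 := rfl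
    rw [h1]
    refine (eLpNorm_sub_le ms.aestronglyMeasurable mv.aestronglyMeasurable (by norm_num)).trans ?_
    rw [eLpNorm_timeShift_le B.open_set.measurableSet mv]
    refine (add_le_add ((eLpNorm_slab_mono _ (c' := a) (d' := T - a) (by linarith)
      (by linarith)).trans (B.eLpNorm_dyadicDeriv_le ha)) ((eLpNorm_slab_mono _ (c' := a)
      (d' := T - a) le_rfl (by linarith)).trans (B.eLpNorm_dyadicDeriv_le ha))).trans ?_
    rw [← ENNReal.ofReal_add (by positivity) (by positivity)]
    refine ENNReal.ofReal_le_ofReal ?_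
    rw [← Real.sqrt_mul (by positivity)]
    refine Real.le_sqrt_of_sq_le ?_
    have e1 : (5 * √K / a + 5 * √K / a) ^ 2 = 100 * K / a ^ 3 * a := by
      have : (5 * √K / a + 5 * √K / a) ^ 2 = 100 * √K ^ 2 / a ^ 2 := by ring
      rw [this, Real.sq_sqrt hK]
      field_simp
    rw [e1]
    gcongr

end DifferenceBounds

/-- Tonelli's theorem for the squared norm; it connects norms on space-time slabs with the norms of
time sections. -/
theorem lintegral_eLpNorm_sections (Ω : Set (Vec n)) {g : ℝ × Vec n → Vec N}
    (hg : StronglyMeasurable g) (a b : ℝ) :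
    ∫⁻ t in Ioo a b, eLpNorm (fun x => g (t, x)) 2 (volume.restrict Ω) ^ (2 : ℝ) =
      eLpNorm g 2 (slab Ω a b) ^ (2 : ℝ) := by
  have key : ∀ {X : Type} [MeasurableSpace X] (ν : Measure X) (v : X → Vec N),
      eLpNorm v 2 ν ^ (2 : ℝ) = ∫⁻ x, ‖v x‖ₑ ^ (2 : ℝ) ∂ν := by
    intro X _ ν v
    rw [eLpNorm_eq_lintegral_rpow_enorm_toReal (by norm_num) (by norm_num), ← ENNReal.rpow_mul]
    norm_num
  rw [key, slab, Measure.volume_eq_prod, ← Measure.prod_restrict,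
    lintegral_prod _ (by fun_prop (disch := exact hg.measurable))]
  simp_rw [key]

/-- Bounds for first and second differences yield the time derivative in the Nikolskij space. -/
theorem DifferenceBounds.nikolskijNorm_le {T K : ℝ} (B : DifferenceBounds Ω T K u) (hT : 0 < T)
    {a : ℝ} (ha : 0 < a) : nikolskijNorm (1 / 2) 2 a (T - a) Ω (dyadicDeriv u 1) ≤
      ENNReal.ofReal (√(K * (100 * T + 25 * T ^ 2)) / a ^ 2) := by
  have hK := B.nonneg
  have mv := stronglyMeasurable_dyadicDeriv B.meas 1
  -- If `T ≤ 2a` the time interval is empty. Otherwise `a ≤ T`, which is needed to trade powers of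
  -- `a`.
  rcases le_or_gt T (2 * a) with hTa | hTa
  · have h1 : ∀ h : ℝ, 0 < h → Ioo a (T - a - h) = ∅ := fun h hh => Ioo_eq_empty (by linarith)
    have h2 : Ioo a (T - a) = ∅ := Ioo_eq_empty (by linarith)
    have : nikolskijNorm (1 / 2) 2 a (T - a) Ω (dyadicDeriv u 1) = 0 := by
      rw [nikolskijNorm, h2]
      simp +contextual [h1]
    rw [this]
    exact zero_le
  have e1 : ∀ h : ℝ, 0 < h → ∫⁻ t in Ioo a (T - a - h),
      (eLpNorm (fun x => dyadicDeriv u 1 (t + h, x) - dyadicDeriv u 1 (t, x)) 2 (volume.restrict Ω)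
        / ENNReal.ofReal (h ^ (1 / 2 : ℝ))) ^ (2 : ℝ) ≤ ENNReal.ofReal (100 * K / a ^ 3) := by
    intro h hh
    simp_rw [ENNReal.div_rpow_of_nonneg _ _ (show (0 : ℝ) ≤ 2 by norm_num),
      ENNReal.div_eq_inv_mul]
    have hhs : ENNReal.ofReal (h ^ (1 / 2 : ℝ)) ^ (2 : ℝ) = ENNReal.ofReal h := by
      rw [ENNReal.ofReal_rpow_of_nonneg (by positivity) (by norm_num), ← Real.rpow_mul hh.le]
      norm_num
    have hfin : (ENNReal.ofReal (h ^ (1 / 2 : ℝ)) ^ (2 : ℝ))⁻¹ ≠ ⊤ := by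
      rw [hhs]
      simpa using hh
    rw [lintegral_const_mul' _ _ hfin, hhs]
    have h1 := lintegral_eLpNorm_sections Ω (stronglyMeasurable_timeDiff mv h) a (T - a - h)
    simp only [timeDiff] at h1
    rw [h1, ← ENNReal.div_eq_inv_mul]
    refine ENNReal.div_le_of_le_mul ?_
    refine (ENNReal.rpow_le_rpow (B.eLpNorm_timeDiff_dyadicDeriv_le ha hh) (by norm_num)).trans ?_
    rw [ENNReal.ofReal_rpow_of_nonneg (by positivity) (by norm_num),
      ← ENNReal.ofReal_mul (by positivity)]
    refine ENNReal.ofReal_le_ofReal (le_of_eq ?_)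
    rw [Real.rpow_two, mul_pow, Real.sq_sqrt (by positivity), Real.sq_sqrt hh.le]
  have e2 : ∫⁻ t in Ioo a (T - a),
      eLpNorm (fun x => dyadicDeriv u 1 (t, x)) 2 (volume.restrict Ω) ^ (2 : ℝ) ≤
        ENNReal.ofReal (25 * K / a ^ 2) := by
    rw [lintegral_eLpNorm_sections Ω mv]
    refine (ENNReal.rpow_le_rpow (B.eLpNorm_dyadicDeriv_le ha) (by norm_num)).trans ?_
    rw [ENNReal.ofReal_rpow_of_nonneg (by positivity) (by norm_num)]
    refine ENNReal.ofReal_le_ofReal (le_of_eq ?_)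
    rw [Real.rpow_two, div_pow, mul_pow, Real.sq_sqrt hK]
    norm_num
  -- The natural powers `a⁻³` and `a⁻²` are enlarged to `a⁻⁴` at the cost of `T` and `T²`, giving
  -- `a⁻²` after the square root.
  have e3 : 100 * K / a ^ 3 + 25 * K / a ^ 2 ≤ (√(K * (100 * T + 25 * T ^ 2)) / a ^ 2) ^ 2 := by
    rw [div_pow, Real.sq_sqrt (by positivity)]
    rw [show 100 * K / a ^ 3 + 25 * K / a ^ 2 = K * (100 * a + 25 * a ^ 2) / (a ^ 2) ^ 2 by
      field_simp]
    gcongr <;> linarith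
  rw [nikolskijNorm]
  refine (ENNReal.rpow_le_rpow ((add_le_add (iSup₂_le e1) e2).trans
    (le_of_eq (ENNReal.ofReal_add (by positivity) (by positivity)).symm)) (by norm_num)).trans ?_
  refine (ENNReal.rpow_le_rpow (ENNReal.ofReal_le_ofReal e3) (by norm_num)).trans (le_of_eq ?_)
  rw [ENNReal.ofReal_rpow_of_nonneg (by positivity) (by norm_num), ← Real.sqrt_eq_rpow,
    Real.sqrt_sq (by positivity)]

end DifferenceQuotients

/-! ### Weak derivatives on an interval -/

section Interval

variable {T : ℝ}

/-- The primitive of an integrable function is absolutely continuous with derivative `r` almost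
everywhere, so integration by parts against a smooth function is allowed. -/
theorem integral_deriv_mul_primitive {r : ℝ → ℝ} (hr : Integrable r) {χ : ℝ → ℝ}
    (hχ : ContDiff ℝ ∞ χ) (a b : ℝ) :
    ∫ t in a..b, deriv χ t * ∫ τ in (0)..t, r τ =
      χ b * (∫ τ in (0)..b, r τ) - χ a * (∫ τ in (0)..a, r τ) - ∫ t in a..b, χ t * r t := by
  have hR : AbsolutelyContinuousOnInterval (fun t => ∫ τ in (0)..t, r τ) a b := by
    have h0 : (fun t => ∫ τ in (0)..t, r τ) = fun t => (∫ τ in (0)..a, r τ) + ∫ τ in a..t, r τ := by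
      ext t
      rw [intervalIntegral.integral_add_adjacent_intervals hr.intervalIntegrable
        hr.intervalIntegrable]
    rw [h0]
    have h1 := (hr.intervalIntegrable (a := a) (b := b)).absolutelyContinuousOnInterval_intervalIntegral
      (c := a) left_mem_uIcc
    have h2 : AbsolutelyContinuousOnInterval (fun _ : ℝ => ∫ τ in (0)..a, r τ) a b :=
      (LipschitzWith.const _).lipschitzOnWith.absolutelyContinuousOnInterval (K := 0)
    exact h2.add h1
  have hχ' : AbsolutelyContinuousOnInterval χ a b := by
    obtain ⟨K, hK⟩ := (hχ.of_le (m := 1) (by simp)).contDiffOn.exists_lipschitzOnWith (s := uIcc a b)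
      (by simp) (convex_uIcc a b) isCompact_uIcc
    exact hK.absolutelyContinuousOnInterval
  have h := hχ'.integral_deriv_mul_eq_sub hR
  have hd : ∀ᵐ t : ℝ, deriv (fun t => ∫ τ in (0)..t, r τ) t = r t := by
    filter_upwards [_root_.LocallyIntegrable.ae_hasDerivAt_integral hr.locallyIntegrable] with t ht
    exact (ht 0).deriv
  have h1 : ∫ t in a..b, χ t * r t = ∫ t in a..b, χ t * deriv (fun t => ∫ τ in (0)..t, r τ) t := by
    refine intervalIntegral.integral_congr_ae ?_
    filter_upwards [hd] with t ht _
    rw [ht]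
  rw [h1, ← h, ← intervalIntegral.integral_sub]
  · simp
  · exact (hχ'.intervalIntegrable_deriv.mul_continuousOn hR.continuousOn).add
      (hR.intervalIntegrable_deriv.continuousOn_mul hχ'.continuousOn)
  · exact hR.intervalIntegrable_deriv.continuousOn_mul hχ'.continuousOn

/-- The primitive vanishes to the left of the support, and the zero mean makes it vanish to the
right. -/
theorem exists_primitive_of_integral_eq_zero {η : ℝ → ℝ} (hη : ContDiff ℝ ∞ η)
    (hc : HasCompactSupport η) (hs : tsupport η ⊆ Ioo 0 T) (h0 : ∫ t, η t = 0) :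
    ∃ χ : ℝ → ℝ, ContDiff ℝ ∞ χ ∧ HasCompactSupport χ ∧ tsupport χ ⊆ Ioo 0 T ∧ deriv χ = η := by
  have hcont := hη.continuous
  have hd : ∀ t, HasDerivAt (fun t => ∫ τ in (0)..t, η τ) (η t) t := fun t =>
    intervalIntegral.integral_hasDerivAt_right (hcont.intervalIntegrable _ _)
      (hcont.stronglyMeasurableAtFilter _ _) hcont.continuousAt
  have hd' : deriv (fun t => ∫ τ in (0)..t, η τ) = η := funext fun t => (hd t).deriv
  obtain ⟨α, β, hα, hβ, hαβ⟩ : ∃ α β : ℝ, 0 < α ∧ β < T ∧ tsupport η ⊆ Icc α β := by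
    rcases (tsupport η).eq_empty_or_nonempty with he | hne
    · exact ⟨1, T - 1, one_pos, by linarith, by simp [he]⟩
    · obtain ⟨α, hα, hα'⟩ := hc.isCompact.exists_isLeast hne
      obtain ⟨β, hβ, hβ'⟩ := hc.isCompact.exists_isGreatest hne
      exact ⟨α, β, (hs hα).1, (hs hβ).2, fun t ht => ⟨hα' ht, hβ' ht⟩⟩
  have hz : ∀ t, t ∉ Icc α β → η t = 0 := fun t ht =>
    image_eq_zero_of_notMem_tsupport fun h => ht (hαβ h)
  have hsupp : tsupport (fun t => ∫ τ in (0)..t, η τ) ⊆ Icc α β := by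
    refine closure_minimal (fun t ht => ?_) isClosed_Icc
    by_contra hn
    refine ht ?_
    rw [mem_Icc, not_and_or, not_le, not_le] at hn
    rcases hn with hn | hn
    · have : ∫ τ in (0)..t, η τ = ∫ τ in (0)..t, (0 : ℝ) := by
        refine intervalIntegral.integral_congr fun τ hτ => hz τ fun h => ?_
        have : τ ≤ max 0 t := hτ.2
        linarith [h.1, max_lt hα hn]
      simpa using this
    · change ∫ τ in (0)..t, η τ = 0
      rw [intervalIntegral.integral_eq_integral_of_support_subset, h0]
      intro τ hτ
      have := hαβ (subset_tsupport _ hτ)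
      exact ⟨by linarith [this.1], by linarith [this.2]⟩
  exact ⟨_, contDiff_infty_iff_deriv.2 ⟨fun t => (hd t).differentiableAt, by rwa [hd']⟩,
    isCompact_Icc.of_isClosed_subset (isClosed_tsupport _) hsupp,
    hsupp.trans fun t ht => ⟨by linarith [ht.1], by linarith [ht.2]⟩,
    hd'⟩

/-- A function on an interval with vanishing weak derivative is constant. -/
theorem exists_ae_eq_const_of_integral_deriv_mul_eq_zero (hT : 0 < T) {w : ℝ → ℝ}
    (hw : IntegrableOn w (Ioo 0 T))
    (h : ∀ χ : ℝ → ℝ, ContDiff ℝ ∞ χ → HasCompactSupport χ → tsupport χ ⊆ Ioo 0 T →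
      ∫ t in Ioo 0 T, deriv χ t * w t = 0) :
    ∃ c : ℝ, ∀ᵐ t : ℝ, t ∈ Ioo 0 T → w t = c := by
  let φ : ContDiffBump (T / 2) := ⟨T / 8, T / 4, by positivity, by linarith⟩
  set η₀ := φ.normed volume with hη₀
  have h1 : ContDiff ℝ ∞ η₀ := φ.contDiff_normed
  have h2 : HasCompactSupport η₀ := φ.hasCompactSupport_normed
  have h3 : tsupport η₀ ⊆ Ioo 0 T := by
    rw [hη₀, φ.tsupport_normed_eq]
    intro t ht
    rw [Metric.mem_closedBall, Real.dist_eq, abs_le] at ht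
    change -(T / 4) ≤ t - T / 2 ∧ t - T / 2 ≤ T / 4 at ht
    exact ⟨by linarith [ht.1], by linarith [ht.2]⟩
  have h4 : ∫ t, η₀ t = 1 := φ.integral_normed
  have hi : ∀ η : ℝ → ℝ, Continuous η → HasCompactSupport η →
      IntegrableOn (fun t => η t * w t) (Ioo 0 T) := fun η hη hηc => by
    obtain ⟨C, hC⟩ := hηc.exists_bound_of_continuous hη
    exact hw.bdd_mul hη.aestronglyMeasurable (ae_of_all _ hC)
  refine ⟨∫ t in Ioo 0 T, η₀ t * w t, ?_⟩
  set c := ∫ t in Ioo 0 T, η₀ t * w t with hc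
  have hwc : IntegrableOn (fun t => w t - c) (Ioo 0 T) := by
    refine Integrable.sub hw (integrable_const c)
  have := isOpen_Ioo.ae_eq_zero_of_integral_contDiff_smul_eq_zero (μ := volume)
    (f := (Ioo 0 T).indicator fun t => w t - c) (U := Ioo 0 T)
    ((hwc.integrable_indicator measurableSet_Ioo).locallyIntegrable.locallyIntegrableOn _) ?_
  · filter_upwards [this] with t ht hts
    have := ht hts
    rw [indicator_of_mem hts] at this
    exact sub_eq_zero.1 this
  intro η hη hηc hηs
  have hη1 : Integrable η := hη.continuous.integrable_of_hasCompactSupport hηc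
  have hη₀1 : Integrable η₀ := h1.continuous.integrable_of_hasCompactSupport h2
  -- Subtracting its mean times a bump of integral one gives an arbitrary test function zero mean,
  -- so it becomes the derivative of a test function.
  obtain ⟨χ, k1, k2, k3, k4⟩ := exists_primitive_of_integral_eq_zero (T := T)
    (η := fun t => η t - (∫ t, η t) * η₀ t) (hη.sub (contDiff_const.mul h1))
    (hηc.sub h2.mul_left)
    ((tsupport_sub _ _).trans (union_subset hηs ((tsupport_mul_subset_right).trans h3)))
    (by rw [integral_sub hη1 (hη₀1.const_mul _), integral_const_mul, h4]; ring)
  have h5 := h χ k1 k2 k3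
  have h6 : ∀ t, deriv χ t * w t = η t * w t - (∫ t, η t) * (η₀ t * w t) := fun t => by
    rw [k4]; ring
  simp_rw [h6] at h5
  rw [integral_sub (hi η hη.continuous hηc) ((hi η₀ h1.continuous h2).const_mul _),
    integral_const_mul, ← hc] at h5
  have h7 : ∀ t, η t • (Ioo 0 T).indicator (fun t => w t - c) t =
      (Ioo 0 T).indicator (fun t => η t * w t - c * η t) t := fun t => by
    by_cases ht : t ∈ Ioo 0 T
    · simp only [indicator_of_mem ht, smul_eq_mul]; ring
    · simp [indicator_of_notMem ht]
  simp_rw [h7]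
  rw [integral_indicator measurableSet_Ioo, integral_sub (hi η hη.continuous hηc)
    (hη1.const_mul c).integrableOn, integral_const_mul,
    setIntegral_eq_integral_of_forall_compl_eq_zero (f := η) fun t ht =>
      image_eq_zero_of_notMem_tsupport fun h => ht (hηs h)]
  linarith

/-- After subtracting the primitive of `r` the weak derivative vanishes and the difference is
constant. -/
theorem exists_ae_eq_add_primitive (hT : 0 < T) {v r : ℝ → ℝ} (hv : Integrable v)
    (hr : Integrable r)
    (h : ∀ χ : ℝ → ℝ, ContDiff ℝ ∞ χ → HasCompactSupport χ → tsupport χ ⊆ Ioo 0 T →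
      ∫ t in Ioo 0 T, deriv χ t * v t = -∫ t in Ioo 0 T, χ t * r t) :
    ∃ c : ℝ, ∀ᵐ t : ℝ, t ∈ Ioo 0 T → v t = c + ∫ τ in (0)..t, r τ := by
  have hRc : Continuous fun t => ∫ τ in (0)..t, r τ :=
    intervalIntegral.continuous_primitive (fun a b => hr.intervalIntegrable) 0
  have hRi : IntegrableOn (fun t => ∫ τ in (0)..t, r τ) (Ioo 0 T) :=
    (hRc.integrableOn_Icc (a := 0) (b := T)).mono_set Ioo_subset_Icc_self
  obtain ⟨c, hc⟩ := exists_ae_eq_const_of_integral_deriv_mul_eq_zero hT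
    (w := fun t => v t - ∫ τ in (0)..t, r τ) (hv.integrableOn.sub hRi) fun χ h1 h2 h3 => by
      have h4 := integral_deriv_mul_primitive hr h1 0 T
      have z : ∀ t, t ∉ Ioo 0 T → χ t = 0 := fun t ht =>
        image_eq_zero_of_notMem_tsupport fun h => ht (h3 h)
      simp only [z 0 (by simp), z T (by simp), intervalIntegral.integral_of_le hT.le,
        integral_Ioc_eq_integral_Ioo] at h4
      obtain ⟨C, hC⟩ := h2.deriv.exists_bound_of_continuous (h1.continuous_deriv (by simp))
      have hd := (h1.continuous_deriv (by simp)).aestronglyMeasurable (μ := volume.restrict (Ioo 0 T))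
      simp_rw [mul_sub]
      rw [integral_sub (hv.integrableOn.bdd_mul hd (ae_of_all _ hC))
        (hRi.bdd_mul hd (ae_of_all _ hC)), h χ h1 h2 h3, h4]
      ring
  refine ⟨c, ?_⟩
  filter_upwards [hc] with t ht hts
  linarith [ht hts]

/-- Test functions need not vanish at time zero here. One that equals `1` there identifies the
integration constant with the initial value. -/
theorem ae_eq_add_primitive (hT : 0 < T) {v r : ℝ → ℝ} {v₀ : ℝ} (hv : Integrable v)
    (hr : Integrable r)
    (h : ∀ χ : ℝ → ℝ, ContDiff ℝ ∞ χ → HasCompactSupport χ → tsupport χ ⊆ Iio T →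
      ∫ t in Ioo 0 T, deriv χ t * v t = -(χ 0 * v₀) - ∫ t in Ioo 0 T, χ t * r t) :
    ∀ᵐ t : ℝ, t ∈ Ioo 0 T → v t = v₀ + ∫ τ in (0)..t, r τ := by
  obtain ⟨c, hc⟩ := exists_ae_eq_add_primitive hT hv hr fun χ h1 h2 h3 => by
    rw [h χ h1 h2 (h3.trans fun t ht => ht.2),
      image_eq_zero_of_notMem_tsupport (f := χ) (x := 0) fun h => lt_irrefl _ (h3 h).1]
    ring
  let φ : ContDiffBump (0 : ℝ) := ⟨T / 4, T / 2, by positivity, by linarith⟩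
  have k1 : ContDiff ℝ ∞ φ := φ.contDiff
  have k2 : HasCompactSupport φ := φ.hasCompactSupport
  have k3 : tsupport φ ⊆ Iio T := by
    rw [φ.tsupport_eq]
    intro t ht
    rw [Metric.mem_closedBall, Real.dist_eq, abs_le] at ht
    change -(T / 2) ≤ t - 0 ∧ t - 0 ≤ T / 2 at ht
    exact show t < T by linarith [ht.2]
  have k0 : φ 0 = 1 := φ.one_of_mem_closedBall (by simp [φ.rIn_pos.le])
  have kT : φ T = 0 := image_eq_zero_of_notMem_tsupport fun h => lt_irrefl T (k3 h)
  have h4 := integral_deriv_mul_primitive hr k1 0 T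
  have h5 := h φ k1 k2 k3
  have h6 : ∫ t in Ioo 0 T, deriv φ t * v t =
      ∫ t in (0)..T, (c * deriv φ t + deriv φ t * ∫ τ in (0)..t, r τ) := by
    rw [intervalIntegral.integral_of_le hT.le, integral_Ioc_eq_integral_Ioo]
    refine setIntegral_congr_ae measurableSet_Ioo ?_
    filter_upwards [hc] with t ht hts
    rw [ht hts]
    ring
  have hdc : Continuous (deriv φ) := k1.continuous_deriv (by simp)
  have hRc : Continuous fun t => ∫ τ in (0)..t, r τ :=
    intervalIntegral.continuous_primitive (fun a b => hr.intervalIntegrable) 0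
  have i1 : IntervalIntegrable (fun t => deriv φ t * ∫ τ in (0)..t, r τ) volume 0 T :=
    (hdc.mul hRc).intervalIntegrable _ _
  have i2 : IntervalIntegrable (fun t => c * deriv φ t) volume 0 T :=
    (continuous_const.mul hdc).intervalIntegrable _ _
  rw [intervalIntegral.integral_add i2 i1,
    intervalIntegral.integral_const_mul, intervalIntegral.integral_deriv_eq_sub
      (fun t _ => (k1.differentiable (by simp)).differentiableAt) (hdc.intervalIntegrable _ _), h4,
    k0, kT, intervalIntegral.integral_same,
    intervalIntegral.integral_of_le (f := fun t => φ t * r t) hT.le,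
    integral_Ioc_eq_integral_Ioo] at h6
  rw [k0] at h5
  have : c = v₀ := by linarith
  rwa [this] at hc

end Interval

/-! ### Modulars of functions of time and space -/

/-- Treating the square as a modular lets the same translation argument serve the functions in `L²`
and the gradients in energy. -/
theorem modular_sq : Modular fun s => s ^ 2 where
  continuousOn := by fun_prop
  zero := by simp
  nonneg := fun s _ => sq_nonneg s
  mono := fun s t hs hst => pow_le_pow_left₀ hs hst 2
  scale := fun l _ => ⟨l ^ 2, sq_nonneg l, fun s _ => by rw [mul_pow]⟩

/-- Indices with integrals below `2^{-k}` make the series of functions integrable, hence finite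
almost everywhere, and its terms tend to zero. -/
theorem exists_subseq_tendsto_zero_of_lintegral {X : Type*} [MeasurableSpace X] {μ : Measure X}
    {h : ℕ → X → ℝ≥0∞} (hm : ∀ j, AEMeasurable (h j) μ)
    (h0 : Tendsto (fun j => ∫⁻ t, h j t ∂μ) atTop (𝓝 0)) :
    ∃ σ : ℕ → ℕ, ∀ᵐ t ∂μ, Tendsto (fun k => h (σ k) t) atTop (𝓝 0) := by
  have h1 : ∀ k : ℕ, ∃ j, ∫⁻ t, h j t ∂μ < (1 / 2 : ℝ≥0∞) ^ k := fun k =>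
    (h0.eventually (gt_mem_nhds (by simp [ENNReal.pow_pos]))).exists
  choose σ hσ using h1
  refine ⟨σ, ?_⟩
  have h2 : ∫⁻ t, ∑' k, h (σ k) t ∂μ ≠ ⊤ := by
    rw [lintegral_tsum fun k => hm _]
    refine ((ENNReal.tsum_le_tsum fun k => (hσ k).le).trans_lt ?_).ne
    rw [ENNReal.tsum_geometric]
    simp
  filter_upwards [ae_lt_top' (AEMeasurable.tsum fun k => hm _) h2] with t ht
  exact ENNReal.tendsto_atTop_zero_of_tsum_ne_top ht.ne

section ModularIntegrals

variable {X : Type*} [MeasurableSpace X] {E : Type*} [NormedAddCommGroup E] {m : ℝ → ℝ}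

theorem Modular.norm_le (hm : Modular m) (v : E) : ‖m ‖v‖‖ = m ‖v‖ :=
  Real.norm_of_nonneg (hm.nonneg _ (norm_nonneg v))

theorem Modular.aestronglyMeasurable (hm : Modular m) {ν : Measure X} {v : X → E}
    (hv : AEStronglyMeasurable v ν) : AEStronglyMeasurable (fun x => m ‖v x‖) ν :=
  (hm.continuous_norm E).comp_aestronglyMeasurable hv

theorem Modular.stronglyMeasurable (hm : Modular m) {v : X → E}
    (hv : StronglyMeasurable v) : StronglyMeasurable (fun x => m ‖v x‖) :=
  (hm.continuous_norm E).comp_stronglyMeasurable hv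

theorem Modular.exists_norm_sub_le (hm : Modular m) (E : Type*) [NormedAddCommGroup E] :
    ∃ C : ℝ, 0 ≤ C ∧ ∀ v w : E, m ‖v - w‖ ≤ C * (m ‖v‖ + m ‖w‖) := by
  obtain ⟨C, hC, h⟩ := hm.exists_norm_add_le E
  exact ⟨C, hC, fun v w => by simpa [sub_eq_add_neg] using h v (-w)⟩

theorem Modular.integrable_sub (hm : Modular m) {ν : Measure X} {v w : X → E}
    (hv : AEStronglyMeasurable v ν) (hw : AEStronglyMeasurable w ν)
    (hvi : Integrable (fun x => m ‖v x‖) ν) (hwi : Integrable (fun x => m ‖w x‖) ν) :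
    Integrable (fun x => m ‖v x - w x‖) ν := by
  obtain ⟨C, hC, h⟩ := hm.exists_norm_sub_le E
  exact ((hvi.add hwi).const_mul C).mono' (hm.aestronglyMeasurable (hv.sub hw))
    (ae_of_all _ fun x => by rw [hm.norm_le]; exact h _ _)

theorem Modular.integrable_of_continuous (hm : Modular m) [TopologicalSpace X]
    [OpensMeasurableSpace X] {ν : Measure X}
    [IsFiniteMeasureOnCompacts ν] {θ : X → E} (hθ : Continuous θ) (hc : HasCompactSupport θ) :
    Integrable (fun x => m ‖θ x‖) ν :=
  ((hm.continuous_norm E).comp hθ).integrable_of_hasCompactSupport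
    (hc.comp_left (g := fun v => m ‖v‖) (by simp [hm.zero]))

end ModularIntegrals

section Sections

variable {n : ℕ} {E : Type*} [NormedAddCommGroup E] {m : ℝ → ℝ} {ν : Measure (Vec n)}

theorem hasCompactSupport_section {θ : ℝ × Vec n → E} (hc : HasCompactSupport θ) (t : ℝ) :
    HasCompactSupport fun x => θ (t, x) := by
  refine HasCompactSupport.intro (hc.isCompact.image continuous_snd) fun x hx => ?_
  exact image_eq_zero_of_notMem_tsupport fun h => hx ⟨_, h, rfl⟩

/-- The sections of a compactly supported function depend uniformly continuously on time. -/
theorem Modular.exists_integral_section_sub_le (hm : Modular m) [IsFiniteMeasureOnCompacts ν]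
    {θ : ℝ × Vec n → E} (hθ : Continuous θ) (hc : HasCompactSupport θ) {ε : ℝ} (hε : 0 < ε) :
    ∃ δ : ℝ, 0 < δ ∧ ∀ s t : ℝ, |s - t| < δ → ∫ x, m ‖θ (s, x) - θ (t, x)‖ ∂ν ≤ ε := by
  set Z : Set (Vec n) := Prod.snd '' tsupport θ with hZ
  have hZc : IsCompact Z := hc.isCompact.image continuous_snd
  obtain ⟨η, hη0, hη⟩ : ∃ η : ℝ, 0 < η ∧ m η * (ν.real Z + 1) ≤ ε := by
    have h1 : Tendsto (fun s => m s * (ν.real Z + 1)) (𝓝[>] 0) (𝓝 0) := by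
      have h2 : Tendsto m (𝓝[Ici 0] 0) (𝓝 (m 0)) := hm.continuousOn 0 self_mem_Ici
      rw [hm.zero] at h2
      simpa using (h2.mono_left (nhdsWithin_mono 0 Ioi_subset_Ici_self)).mul_const (ν.real Z + 1)
    obtain ⟨η, h2, h3⟩ := ((h1.eventually (gt_mem_nhds hε)).and self_mem_nhdsWithin).exists
    exact ⟨η, h3, h2.le⟩
  obtain ⟨δ, hδ, hu⟩ := Metric.uniformContinuous_iff.1
    (hc.uniformContinuous_of_continuous hθ) η hη0
  refine ⟨δ, hδ, fun s t hst => ?_⟩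
  rw [← setIntegral_eq_integral_of_forall_compl_eq_zero (s := Z)]
  · have h4 := norm_setIntegral_le_of_norm_le_const (μ := ν) (s := Z) hZc.measure_lt_top
      (f := fun x => m ‖θ (s, x) - θ (t, x)‖) (C := m η) fun x _ => by
        rw [hm.norm_le]
        refine hm.mono _ _ (norm_nonneg _) ?_
        rw [← dist_eq_norm]
        refine (hu ?_).le
        simpa [Prod.dist_eq, Real.dist_eq] using hst
    refine (le_abs_self _).trans (h4.trans (le_trans ?_ hη))
    have := hm.nonneg η hη0.le
    nlinarith
  · intro x hx
    have : ∀ t, θ (t, x) = 0 := fun t =>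
      image_eq_zero_of_notMem_tsupport fun h => hx ⟨_, h, rfl⟩
    simp [this, hm.zero]

/-- Continuity in the mean of the time translations. -/
theorem Modular.tendsto_lintegral_shift (hm : Modular m) [IsFiniteMeasureOnCompacts ν] [SFinite ν]
    {T : ℝ} {v : ℝ × Vec n → E} (hv : StronglyMeasurable v)
    {θ : ℕ → ℝ × Vec n → E} (hθ : ∀ j, Continuous (θ j)) (hc : ∀ j, HasCompactSupport (θ j))
    (h0 : Tendsto (fun j => ∫⁻ t in Ioo 0 T, ∫⁻ x, ENNReal.ofReal (m ‖θ j (t, x) - v (t, x)‖) ∂ν)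
      atTop (𝓝 0)) :
    Tendsto (fun ε => ∫⁻ t in Ioo 0 (T - ε), ∫⁻ x, ENNReal.ofReal (m ‖v (t, x) - v (t + ε, x)‖) ∂ν)
      (𝓝[>] 0) (𝓝 0) := by
  obtain ⟨C, hC, hadd⟩ := hm.exists_norm_sub_le E
  -- Used with `a = v(t)`, `b = v(t + ε)` and `c`, `d` the approximation at these two times.
  have hpt : ∀ a b c d : E, m ‖a - b‖ ≤ (C + C * C) * (m ‖c - a‖ + m ‖c - d‖ + m ‖d - b‖) := by
    intro a b c d
    have h1 := hadd (d - b) (d - a)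
    have h2 := hadd (c - a) (c - d)
    have n1 := hm.nonneg _ (norm_nonneg (c - a))
    have n2 := hm.nonneg _ (norm_nonneg (c - d))
    have n3 := hm.nonneg _ (norm_nonneg (d - b))
    rw [show d - b - (d - a) = a - b by abel] at h1
    rw [show c - a - (c - d) = d - a by abel] at h2
    nlinarith [mul_nonneg hC hC, mul_le_mul_of_nonneg_left h2 hC, mul_nonneg (mul_nonneg hC hC) n3,
      mul_nonneg hC n1, mul_nonneg hC n2]
  set C' := C + C * C with hC'
  have hC'0 : 0 ≤ C' := by positivity
  -- Two approximation errors contribute `e` each, and the uniform continuity in time of the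
  -- approximation contributes `e` on an interval of length at most `T`.
  set L : ℝ≥0∞ := ENNReal.ofReal C' * (2 + ENNReal.ofReal T) with hL
  have hLt : L ≠ ⊤ := ENNReal.mul_ne_top ENNReal.ofReal_ne_top (by simp)
  have hmain : ∀ e : ℝ, 0 < e → ∀ᶠ ε in 𝓝[>] (0 : ℝ), ∫⁻ t in Ioo 0 (T - ε),
      ∫⁻ x, ENNReal.ofReal (m ‖v (t, x) - v (t + ε, x)‖) ∂ν ≤ L * ENNReal.ofReal e := by
    intro e he
    obtain ⟨j, hj⟩ := (h0.eventually (gt_mem_nhds (ENNReal.ofReal_pos.2 he))).exists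
    obtain ⟨δ, hδ, hs⟩ := hm.exists_integral_section_sub_le (ν := ν) (hθ j) (hc j) he
    filter_upwards [Ioo_mem_nhdsGT hδ] with ε hε
    have sm : ∀ a : ℝ, StronglyMeasurable fun z : ℝ × Vec n => v (z.1 + a, z.2) := fun a =>
      hv.comp_measurable (by fun_prop)
    have st : ∀ a : ℝ, StronglyMeasurable fun z : ℝ × Vec n => θ j (z.1 + a, z.2) := fun a =>
      (hθ j).stronglyMeasurable.comp_measurable (by fun_prop)
    have hmeas : ∀ {p q : ℝ × Vec n → E}, StronglyMeasurable p → StronglyMeasurable q →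
        Measurable fun z => ENNReal.ofReal (m ‖p z - q z‖) := fun hp hq =>
      ENNReal.measurable_ofReal.comp (hm.stronglyMeasurable (hp.sub hq)).measurable
    have m1 : Measurable fun z : ℝ × Vec n => ENNReal.ofReal (m ‖θ j z - v z‖) :=
      hmeas (hθ j).stronglyMeasurable hv
    have m2 : Measurable fun z : ℝ × Vec n =>
        ENNReal.ofReal (m ‖θ j z - θ j (z.1 + ε, z.2)‖) := hmeas (hθ j).stronglyMeasurable (st ε)
    have m3 : Measurable fun z : ℝ × Vec n =>
        ENNReal.ofReal (m ‖θ j (z.1 + ε, z.2) - v (z.1 + ε, z.2)‖) := hmeas (st ε) (sm ε)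
    have hx : ∀ t : ℝ, ∫⁻ x, ENNReal.ofReal (m ‖v (t, x) - v (t + ε, x)‖) ∂ν ≤
        ENNReal.ofReal C' * ((∫⁻ x, ENNReal.ofReal (m ‖θ j (t, x) - v (t, x)‖) ∂ν) +
          ENNReal.ofReal e + ∫⁻ x, ENNReal.ofReal (m ‖θ j (t + ε, x) - v (t + ε, x)‖) ∂ν) := by
      intro t
      have c1 : Measurable fun x => ENNReal.ofReal (m ‖θ j (t, x) - v (t, x)‖) :=
        m1.comp measurable_prodMk_left
      have c2 : Measurable fun x => ENNReal.ofReal (m ‖θ j (t, x) - θ j (t + ε, x)‖) :=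
        m2.comp measurable_prodMk_left
      have c3 : Measurable fun x => ENNReal.ofReal (m ‖θ j (t + ε, x) - v (t + ε, x)‖) :=
        m3.comp measurable_prodMk_left
      have h5 : ∫⁻ x, ENNReal.ofReal (m ‖θ j (t, x) - θ j (t + ε, x)‖) ∂ν ≤ ENNReal.ofReal e := by
        have hi : Integrable (fun x => m ‖θ j (t, x) - θ j (t + ε, x)‖) ν :=
          hm.integrable_of_continuous (θ := fun x => θ j (t, x) - θ j (t + ε, x))
            (((hθ j).comp (by fun_prop)).sub ((hθ j).comp (by fun_prop)))
            ((hasCompactSupport_section (hc j) t).sub (hasCompactSupport_section (hc j) _))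
        rw [← ofReal_integral_eq_lintegral_ofReal hi
          (ae_of_all _ fun x => hm.nonneg _ (norm_nonneg _))]
        refine ENNReal.ofReal_le_ofReal (hs t (t + ε) ?_)
        rw [sub_add_cancel_left, abs_neg, abs_of_pos hε.1]
        exact hε.2
      refine le_trans ?_ (mul_le_mul_right (add_le_add (add_le_add le_rfl h5) le_rfl) _)
      rw [← lintegral_add_left c1, ← lintegral_add_left (c1.fun_add c2),
        ← lintegral_const_mul _ ((c1.fun_add c2).fun_add c3)]
      refine lintegral_mono fun x => ?_
      rw [← ENNReal.ofReal_add (hm.nonneg _ (norm_nonneg _)) (hm.nonneg _ (norm_nonneg _)),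
        ← ENNReal.ofReal_add (add_nonneg (hm.nonneg _ (norm_nonneg _))
          (hm.nonneg _ (norm_nonneg _))) (hm.nonneg _ (norm_nonneg _)),
        ← ENNReal.ofReal_mul hC'0]
      exact ENNReal.ofReal_le_ofReal (hpt _ _ _ _)
    set I : ℝ → ℝ≥0∞ := fun t => ∫⁻ x, ENNReal.ofReal (m ‖θ j (t, x) - v (t, x)‖) ∂ν with hI
    have hIm : Measurable I := m1.lintegral_prod_right'
    have h6 : ∫⁻ t in Ioo 0 (T - ε), I t ≤ ENNReal.ofReal e :=
      (lintegral_mono_set (Ioo_subset_Ioo le_rfl (by linarith [hε.1]))).trans hj.le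
    have h7 : ∫⁻ t in Ioo 0 (T - ε), I (t + ε) ≤ ENNReal.ofReal e := by
      refine le_trans ?_ hj.le
      rw [← lintegral_indicator measurableSet_Ioo, ← lintegral_indicator measurableSet_Ioo,
        ← lintegral_add_right_eq_self ((Ioo 0 T).indicator I) ε]
      refine lintegral_mono fun t => ?_
      by_cases ht : t ∈ Ioo 0 (T - ε)
      · rw [indicator_of_mem ht, indicator_of_mem]
        exact ⟨by linarith [ht.1, hε.1], by linarith [ht.2]⟩
      · rw [indicator_of_notMem ht]
        exact zero_le
    refine (lintegral_mono fun t => hx t).trans ?_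
    rw [lintegral_const_mul _ (by fun_prop), lintegral_add_left (by fun_prop),
      lintegral_add_left hIm, hL, mul_assoc]
    refine mul_le_mul_right ?_ _
    rw [add_mul, two_mul]
    have h8 : ∫⁻ _ in Ioo 0 (T - ε), ENNReal.ofReal e ≤ ENNReal.ofReal T * ENNReal.ofReal e := by
      rw [setLIntegral_const, Real.volume_Ioo, mul_comm]
      refine mul_le_mul_left (ENNReal.ofReal_le_ofReal (by linarith [hε.1])) _
    calc _ ≤ ENNReal.ofReal e + ENNReal.ofReal T * ENNReal.ofReal e + ENNReal.ofReal e :=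
        add_le_add (add_le_add h6 h8) h7
      _ = _ := by ring
  rw [ENNReal.tendsto_nhds_zero]
  intro e he
  obtain ⟨r, hr0, hr⟩ : ∃ r : ℝ, 0 < r ∧ L * ENNReal.ofReal r ≤ e := by
    have h1 : Tendsto (fun r : ℝ => L * ENNReal.ofReal r) (𝓝[>] 0) (𝓝 0) := by
      have h2 : Tendsto (fun r : ℝ => ENNReal.ofReal r) (𝓝[>] 0) (𝓝 0) := by
        simpa using (ENNReal.continuous_ofReal.tendsto 0).mono_left nhdsWithin_le_nhds
      simpa using ENNReal.Tendsto.const_mul h2 (Or.inr hLt)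
    obtain ⟨r, h2, h3⟩ := ((h1.eventually (gt_mem_nhds he)).and self_mem_nhdsWithin).exists
    exact ⟨r, h3, h2.le⟩
  filter_upwards [hmain r hr0] with ε h
  exact h.trans hr

end Sections

/-! ### Square integrable sections -/

section LpSections

variable {n N : ℕ} {ν : Measure (Vec n)} {v w : ℝ × Vec n → Vec N}

theorem inner_toLp {X : Type*} [MeasurableSpace X] {ν : Measure X} {v w : X → Vec N}
    (hv : MemLp v 2 ν) (hw : MemLp w 2 ν) :
    inner ℝ (hv.toLp v) (hw.toLp w) = ∫ x, inner ℝ (v x) (w x) ∂ν := by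
  rw [L2.inner_def]
  refine integral_congr_ae ?_
  filter_upwards [hv.coeFn_toLp, hw.coeFn_toLp] with x h1 h2
  rw [h1, h2]

theorem norm_toLp_sq {X : Type*} [MeasurableSpace X] {ν : Measure X} {v : X → Vec N}
    (hv : MemLp v 2 ν) :
    ‖hv.toLp v‖ ^ 2 = ∫ x, ‖v x‖ ^ 2 ∂ν := by
  rw [← real_inner_self_eq_norm_sq, inner_toLp]
  simp_rw [real_inner_self_eq_norm_sq]

open Classical in
/-- The section `v(t, ·)` as an element of `L²`, cut off to `S`. -/
def lpSection (ν : Measure (Vec n)) (S : Set ℝ) (v : ℝ × Vec n → Vec N) (t : ℝ) : Lp (Vec N) 2 ν :=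
  if h : t ∈ S ∧ MemLp (fun x => v (t, x)) 2 ν then h.2.toLp _ else 0

theorem lpSection_of_mem {S : Set ℝ} {t : ℝ} (ht : t ∈ S) (h : MemLp (fun x => v (t, x)) 2 ν) :
    lpSection ν S v t = h.toLp _ := dif_pos ⟨ht, h⟩

theorem lpSection_of_notMem {S : Set ℝ} {t : ℝ} (ht : t ∉ S) : lpSection ν S v t = 0 :=
  dif_neg fun h => ht h.1

/-- By second countability every open set is a countable union of balls, and preimages of balls are
sublevel sets of distances. -/
theorem measurable_of_edist {X H : Type*} [MeasurableSpace X] [PseudoEMetricSpace H]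
    [SecondCountableTopology H] [MeasurableSpace H] [BorelSpace H] {U : X → H}
    (h : ∀ y, Measurable fun t => edist (U t) y) : Measurable U := by
  refine measurable_of_isOpen fun O hO => ?_
  let ι := {p : H × ℝ≥0∞ // Metric.eball p.1 p.2 ⊆ O}
  obtain ⟨J, hJ, hJO⟩ := TopologicalSpace.isOpen_iUnion_countable
    (fun p : ι => Metric.eball p.1.1 p.1.2) fun _ => Metric.isOpen_eball
  have h2 : ⋃ p : ι, Metric.eball p.1.1 p.1.2 = O := by
    refine Subset.antisymm (iUnion_subset fun p => p.2) fun y hy => ?_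
    obtain ⟨ε, hε, hεO⟩ := EMetric.isOpen_iff.1 hO y hy
    exact mem_iUnion.2 ⟨⟨(y, ε), hεO⟩, Metric.mem_eball_self hε⟩
  rw [← h2, ← hJO, preimage_iUnion₂]
  exact MeasurableSet.biUnion hJ fun p _ => measurableSet_lt (h p.1.1) measurable_const

/-- The distance of a section to a fixed element of `L²` is an integral over space depending on time
as a parameter, hence measurable; separability of `L²` does the rest. -/
theorem stronglyMeasurable_lpSection [SFinite ν] {S : Set ℝ} (hS : MeasurableSet S)
    (hv : StronglyMeasurable v) (hmem : ∀ t ∈ S, MemLp (fun x => v (t, x)) 2 ν) :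
    StronglyMeasurable (lpSection ν S v) := by
  have : Fact ((2 : ℝ≥0∞) ≠ ⊤) := ⟨by norm_num⟩
  classical
  let : MeasurableSpace (Lp (Vec N) 2 ν) := borel _
  have : BorelSpace (Lp (Vec N) 2 ν) := ⟨rfl⟩
  rw [stronglyMeasurable_iff_measurable]
  refine measurable_of_edist fun y => ?_
  have hy := Lp.stronglyMeasurable y
  have h1 : (fun t => edist (lpSection ν S v t) y) = S.piecewise
      (fun t => (∫⁻ x, ‖v (t, x) - y x‖ₑ ^ (2 : ℝ) ∂ν) ^ (1 / 2 : ℝ)) (fun _ => edist 0 y) := by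
    ext1 t
    by_cases ht : t ∈ S
    · rw [piecewise_eq_of_mem _ _ _ ht, lpSection_of_mem ht (hmem t ht)]
      conv_lhs => rw [← Lp.toLp_coeFn y (Lp.memLp y)]
      rw [Lp.edist_toLp_toLp, eLpNorm_eq_lintegral_rpow_enorm_toReal (by norm_num) (by norm_num)]
      simp
    · rw [piecewise_eq_of_notMem _ _ _ ht, lpSection_of_notMem ht]
  rw [h1]
  refine Measurable.piecewise hS ?_ measurable_const
  refine Measurable.pow_const ?_ _
  have h2 : Measurable fun z : ℝ × Vec n => ‖v z - y z.2‖ₑ ^ (2 : ℝ) :=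
    (hv.sub (hy.comp_measurable measurable_snd)).enorm.pow_const _
  exact h2.lintegral_prod_right'

end LpSections

/-! ### Measurability of the stress -/

/-- Away from `Q = 0` the components of the gradient are limits of difference quotients of the
jointly measurable `F`; at the origin the value is known to be zero. Outside `Ω` nothing is known of
`F` beyond measurability, so agreement is asserted in `Ω` only. -/
theorem ConvexStress.exists_measurable {n N : ℕ} {Ω : Set (Vec n)} {F : Vec n → Mat n N → ℝ}
    {m : ℝ → ℝ} (h : ConvexStress Ω F m) :
    ∃ A : Vec n → Mat n N → Mat n N, Measurable (fun z : Vec n × Mat n N => A z.1 z.2) ∧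
      ∀ x ∈ Ω, ∀ Q, A x Q = stress F x Q := by
  classical
  refine ⟨fun x Q => if Q = 0 then 0 else WithLp.toLp 2 fun i => limUnder atTop fun k : ℕ =>
    ((k : ℝ) + 1) * (F x (Q + ((k : ℝ) + 1)⁻¹ • EuclideanSpace.single i 1) - F x Q), ?_, ?_⟩
  · refine Measurable.ite (measurable_snd (measurableSet_singleton 0)) measurable_const ?_
    refine (WithLp.measurable_toLp 2 _).comp (measurable_pi_lambda _ fun i => ?_)
    refine (StronglyMeasurable.limUnder fun k => Measurable.stronglyMeasurable ?_).measurable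
    refine Measurable.const_mul (Measurable.sub ?_ h.measurable) _
    exact h.measurable.comp (measurable_fst.prodMk (measurable_snd.add measurable_const))
  · intro x hx Q
    by_cases hQ : Q = 0
    · simp [hQ, h.stress_zero x hx]
    · simp only [if_neg hQ]
      ext i
      refine Tendsto.limUnder_eq ?_
      have h1 := (h.hasGradientAt x hx Q hQ).hasFDerivAt
      have h2 : HasDerivAt (fun t : ℝ => F x (Q + t • EuclideanSpace.single i 1))
          ((stress F x Q) i) 0 := by
        have h3 : HasDerivAt (fun t : ℝ => Q + t • (EuclideanSpace.single i 1 : Mat n N))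
            (EuclideanSpace.single i 1) 0 := by
          simpa using ((hasDerivAt_id (0 : ℝ)).smul_const
            (EuclideanSpace.single i 1 : Mat n N)).const_add Q
        have h4 : HasFDerivAt (F x) (InnerProductSpace.toDual ℝ _ (stress F x Q))
            (Q + (0 : ℝ) • EuclideanSpace.single i 1) := by simpa using h1
        refine (h4.comp_hasDerivAt 0 h3).congr_deriv ?_
        simp [EuclideanSpace.inner_single_right]
      have h5 := hasDerivAt_iff_tendsto_slope_zero.1 h2
      have h6 : Tendsto (fun k : ℕ => ((k : ℝ) + 1)⁻¹) atTop (𝓝[≠] 0) := by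
        refine tendsto_nhdsWithin_iff.2 ⟨?_, Eventually.of_forall fun k => ?_⟩
        · simpa using tendsto_one_div_add_atTop_nhds_zero_nat (𝕜 := ℝ)
        · exact inv_ne_zero (by positivity)
      refine (h5.comp h6).congr fun k => ?_
      simp

/-! ### Weak solutions in terms of time-dependent pairings -/

/-- A weak solution given by strongly measurable functions which vanish outside of the time
interval, tested with products of functions of time and the sections of the approximations `w j`. -/
structure SpaceTimeData {n N : ℕ} (Ω : Set (Vec n)) (F : Vec n → Mat n N → ℝ) (m : ℝ → ℝ)
    (T M : ℝ) where
  (u f g : ℝ × Vec n → Vec N)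
  (q : ℝ × Vec n → Mat n N)
  (A : Vec n → Mat n N → Mat n N)
  (u₀ : Vec n → Vec N)
  (w : ℕ → ℝ × Vec n → Vec N)
  (Dw : ℕ → ℝ × Vec n → Mat n N)
  T_pos : 0 < T
  M_nonneg : 0 ≤ M
  open_set : IsOpen Ω
  modular : Modular m
  convex : ConvexStress Ω F m
  A_meas : Measurable fun z : Vec n × Mat n N => A z.1 z.2
  A_eq : ∀ x ∈ Ω, ∀ Q, A x Q = stress F x Q
  u_meas : StronglyMeasurable u
  f_meas : StronglyMeasurable f
  g_meas : StronglyMeasurable g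
  q_meas : StronglyMeasurable q
  u_off : ∀ z, z.1 ∉ Ioo 0 T → u z = 0
  f_off : ∀ z, z.1 ∉ Ioo 0 T → f z = 0
  g_off : ∀ z, z.1 ∉ Ioo 0 T → g z = 0
  q_off : ∀ z, z.1 ∉ Ioo 0 T → q z = 0
  u_memLp : MemLp u 2 (volume.prod (volume.restrict Ω))
  f_memLp : MemLp f 2 (volume.prod (volume.restrict Ω))
  g_memLp : MemLp g 2 (volume.prod (volume.restrict Ω))
  q_int : Integrable (fun z => m ‖q z‖) (volume.prod (volume.restrict Ω))
  u₀_memLp : MemLp u₀ 2 (volume.restrict Ω)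
  u₀_le : eLpNorm u₀ 2 (volume.restrict Ω) ≤ ENNReal.ofReal M
  f_le : eLpNorm f 2 (volume.prod (volume.restrict Ω)) ≤ ENNReal.ofReal M
  g_le : eLpNorm g 2 (volume.prod (volume.restrict Ω)) ≤ ENNReal.ofReal M
  w_cont : ∀ j, Continuous (w j)
  w_supp : ∀ j, HasCompactSupport (w j)
  Dw_cont : ∀ j, Continuous (Dw j)
  Dw_supp : ∀ j, HasCompactSupport (Dw j)
  w_tendsto : Tendsto (fun j => ∫⁻ t in Ioo 0 T, ∫⁻ x in Ω,
    ENNReal.ofReal (‖w j (t, x) - u (t, x)‖ ^ 2)) atTop (𝓝 0)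
  Dw_tendsto : Tendsto (fun j => ∫⁻ t in Ioo 0 T, ∫⁻ x in Ω,
    ENNReal.ofReal (m ‖Dw j (t, x) - q (t, x)‖)) atTop (𝓝 0)
  weak : ∀ (j : ℕ) (r : ℝ) (χ : ℝ → ℝ), ContDiff ℝ ∞ χ → HasCompactSupport χ → tsupport χ ⊆ Iio T →
    ∫ t in Ioo 0 T, deriv χ t * ∫ x in Ω, inner ℝ (u (t, x)) (w j (r, x)) =
      -(χ 0 * ∫ x in Ω, inner ℝ (u₀ x) (w j (r, x))) -
      ∫ t in Ioo 0 T, χ t * (-(∫ x in Ω, inner ℝ (A x (q (t, x))) (Dw j (r, x))) +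
        ∫ x in Ω, inner ℝ (f (t, x)) (w j (r, x)))
  weak_f : ∀ (j : ℕ) (r : ℝ) (χ : ℝ → ℝ), ContDiff ℝ ∞ χ → HasCompactSupport χ →
    tsupport χ ⊆ Ioo 0 T →
    ∫ t in Ioo 0 T, deriv χ t * ∫ x in Ω, inner ℝ (f (t, x)) (w j (r, x)) =
      -∫ t in Ioo 0 T, χ t * ∫ x in Ω, inner ℝ (g (t, x)) (w j (r, x))

theorem exists_measurableSet_of_ae {T : ℝ} {P : ℝ → Prop} (h : ∀ᵐ t : ℝ, t ∈ Ioo 0 T → P t) :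
    ∃ S, MeasurableSet S ∧ S ⊆ Ioo 0 T ∧ (∀ᵐ t : ℝ, t ∈ Ioo 0 T → t ∈ S) ∧ ∀ t ∈ S, P t := by
  obtain ⟨Z, hZ, hZm, hZ0⟩ := exists_measurable_superset_of_null (ae_iff.1 h)
  refine ⟨Ioo 0 T \ Z, measurableSet_Ioo.diff hZm, sdiff_subset, ?_, fun t ht => ?_⟩
  · have : ∀ᵐ t : ℝ, t ∉ Z := measure_eq_zero_iff_ae_notMem.1 hZ0
    filter_upwards [this] with t h1 h2
    exact ⟨h2, h1⟩
  · by_contra hn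
    exact ht.2 (hZ (show ¬(t ∈ Ioo 0 T → P t) from fun h => hn (h ht.1)))

/-- Integrability of a pairing on a bounded time interval. -/
theorem integrable_pairing {n : ℕ} {ν : Measure (Vec n)} [SFinite ν] {T : ℝ}
    {G γ : ℝ × Vec n → ℝ} {κ : Vec n → ℝ} (hG : AEStronglyMeasurable G (volume.prod ν))
    (hγ : Integrable γ (volume.prod ν)) (hκ : Integrable κ ν)
    (h : ∀ᵐ z ∂(volume : Measure ℝ).prod ν,
      |G z| ≤ γ z + (Ioo 0 T).indicator (fun _ => (1 : ℝ)) z.1 * κ z.2) :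
    Integrable G (volume.prod ν) := by
  have h1 : Integrable ((Ioo 0 T).indicator fun _ => (1 : ℝ)) volume :=
    (integrable_indicator_iff measurableSet_Ioo).2 (integrable_const 1)
  exact (hγ.add (h1.mul_prod hκ)).mono' hG h

/-- The second factor does not depend on time; integrability holds because the first vanishes off a
bounded time interval. -/
theorem integrable_inner_snd {n N : ℕ} {ν : Measure (Vec n)} [SFinite ν] {T : ℝ}
    {v : ℝ × Vec n → Vec N} (hv : MemLp v 2 (volume.prod ν))
    (hv0 : ∀ z, z.1 ∉ Ioo 0 T → v z = 0) {ψ : Vec n → Vec N} (hψ : MemLp ψ 2 ν) :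
    Integrable (fun z : ℝ × Vec n => inner ℝ (v z) (ψ z.2)) (volume.prod ν) := by
  refine integrable_pairing (T := T) (hv.1.inner hψ.1.comp_snd) (hv.integrable_norm_pow (by simp))
    (hψ.integrable_norm_pow (by simp)) (ae_of_all _ fun z => ?_)
  by_cases ht : z.1 ∈ Ioo 0 T
  · have := abs_real_inner_le_norm (v z) (ψ z.2)
    simp only [indicator_of_mem ht, one_mul]
    nlinarith [sq_nonneg (‖v z‖ - ‖ψ z.2‖), sq_nonneg (‖v z‖ + ‖ψ z.2‖)]
  · simp [hv0 z ht, ht]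

/-- Young's inequality bounds the pairing inside the time interval; outside, `q = 0` and the stress
vanishes with it. -/
theorem ConvexStress.integrable_pairing {n N : ℕ} {Ω : Set (Vec n)} {F : Vec n → Mat n N → ℝ}
    {m : ℝ → ℝ} {T : ℝ} (h : ConvexStress Ω F m) (hm : Modular m) (hΩ : IsOpen Ω)
    {A : Vec n → Mat n N → Mat n N} (hA : Measurable fun z : Vec n × Mat n N => A z.1 z.2)
    (hA' : ∀ x ∈ Ω, ∀ Q, A x Q = stress F x Q) {q : ℝ × Vec n → Mat n N}
    (hq : StronglyMeasurable q) (hq0 : ∀ z, z.1 ∉ Ioo 0 T → q z = 0)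
    (hqi : Integrable (fun z => m ‖q z‖) (volume.prod (volume.restrict Ω)))
    {Ψ : Vec n → Mat n N} (hΨ : AEStronglyMeasurable Ψ (volume.restrict Ω))
    (hΨi : Integrable (fun x => m ‖Ψ x‖) (volume.restrict Ω)) :
    Integrable (fun z : ℝ × Vec n => inner ℝ (A z.2 (q z)) (Ψ z.2))
      (volume.prod (volume.restrict Ω)) := by
  obtain ⟨C, hC, hy⟩ := h.exists_young hm one_pos
  have hs : StronglyMeasurable fun z : ℝ × Vec n => A z.2 (q z) :=
    (hA.comp (measurable_snd.prodMk hq.measurable)).stronglyMeasurable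
  refine DegParabolic.integrable_pairing (T := T) (hs.aestronglyMeasurable.inner hΨ.comp_snd) hqi
    (hΨi.const_mul C) ?_
  filter_upwards [Measure.quasiMeasurePreserving_snd.ae (ae_restrict_mem hΩ.measurableSet)]
    with z hz
  rw [hA' _ hz]
  by_cases ht : z.1 ∈ Ioo 0 T
  · simpa [ht] using hy z.2 hz (q z) (Ψ z.2)
  · rw [hq0 z ht, h.stress_zero _ hz]
    simp [ht, hm.zero]

/-! ### Pairings with the approximations and good times. -/

namespace SpaceTimeData

variable {n N : ℕ} {Ω : Set (Vec n)} {F : Vec n → Mat n N → ℝ} {m : ℝ → ℝ} {T M : ℝ}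
  (D : SpaceTimeData Ω F m T M)

/-- The pairing of the stress at time `t` with `Ψ`. -/
def pair (t : ℝ) (Ψ : Vec n → Mat n N) : ℝ := ∫ x in Ω, inner ℝ (D.A x (D.q (t, x))) (Ψ x)

theorem stress_meas : StronglyMeasurable fun z : ℝ × Vec n => D.A z.2 (D.q z) :=
  (D.A_meas.comp (measurable_snd.prodMk D.q_meas.measurable)).stronglyMeasurable

theorem section_meas {E : Type*} [TopologicalSpace E] {v : ℝ × Vec n → E}
    (hv : StronglyMeasurable v) (t : ℝ) : StronglyMeasurable fun x => v (t, x) :=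
  hv.comp_measurable measurable_prodMk_left

theorem exists_young {δ : ℝ} (hδ : 0 < δ) : ∃ C : ℝ, 0 ≤ C ∧ ∀ x ∈ Ω, ∀ Q w : Mat n N,
    |inner ℝ (D.A x Q) w| ≤ δ * m ‖Q‖ + C * m ‖w‖ := by
  obtain ⟨C, hC, h⟩ := D.convex.exists_young D.modular hδ
  exact ⟨C, hC, fun x hx Q w => by rw [D.A_eq x hx]; exact h x hx Q w⟩

theorem ae_mem (D : SpaceTimeData Ω F m T M) : ∀ᵐ x ∂(volume : Measure (Vec n)).restrict Ω, x ∈ Ω :=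
  ae_restrict_mem D.open_set.measurableSet

theorem integrable_stress_pairing {Ψ : Vec n → Mat n N}
    (hΨ : AEStronglyMeasurable Ψ (volume.restrict Ω))
    (hΨi : Integrable (fun x => m ‖Ψ x‖) (volume.restrict Ω)) :
    Integrable (fun z : ℝ × Vec n => inner ℝ (D.A z.2 (D.q z)) (Ψ z.2))
      (volume.prod (volume.restrict Ω)) :=
  D.convex.integrable_pairing D.modular D.open_set D.A_meas D.A_eq D.q_meas D.q_off D.q_int hΨ hΨi

theorem integrable_pair {Ψ : Vec n → Mat n N} (hΨ : AEStronglyMeasurable Ψ (volume.restrict Ω))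
    (hΨi : Integrable (fun x => m ‖Ψ x‖) (volume.restrict Ω)) :
    Integrable fun t => D.pair t Ψ :=
  (D.integrable_stress_pairing hΨ hΨi).integral_prod_left

theorem integrable_l2_pairing {v : ℝ × Vec n → Vec N} (hv : MemLp v 2 (volume.prod (volume.restrict Ω)))
    (hv0 : ∀ z, z.1 ∉ Ioo 0 T → v z = 0) {ψ : Vec n → Vec N} (hψ : MemLp ψ 2 (volume.restrict Ω)) :
    Integrable (fun t => ∫ x in Ω, inner ℝ (v (t, x)) (ψ x)) :=
  (integrable_inner_snd hv hv0 hψ).integral_prod_left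

theorem memLp_w (j : ℕ) (t : ℝ) : MemLp (fun x => D.w j (t, x)) 2 (volume.restrict Ω) :=
  (((D.w_cont j).comp (by fun_prop)).memLp_of_hasCompactSupport
    (hasCompactSupport_section (D.w_supp j) t)).restrict Ω

theorem meas_Dw (j : ℕ) (t : ℝ) :
    AEStronglyMeasurable (fun x => D.Dw j (t, x)) (volume.restrict Ω) :=
  ((D.Dw_cont j).comp (by fun_prop)).aestronglyMeasurable

theorem integrable_Dw (j : ℕ) (t : ℝ) :
    Integrable (fun x => m ‖D.Dw j (t, x)‖) (volume.restrict Ω) :=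
  (D.modular.integrable_of_continuous (ν := volume) ((D.Dw_cont j).comp (by fun_prop))
    (hasCompactSupport_section (D.Dw_supp j) t)).restrict

/-- The times at which all sections have the expected properties. -/
structure Good (σ : ℕ → ℕ) (c : ℕ → ℚ → ℝ) (t : ℝ) : Prop where
  u_memLp : MemLp (fun x => D.u (t, x)) 2 (volume.restrict Ω)
  f_memLp : MemLp (fun x => D.f (t, x)) 2 (volume.restrict Ω)
  g_memLp : MemLp (fun x => D.g (t, x)) 2 (volume.restrict Ω)
  q_int : Integrable (fun x => m ‖D.q (t, x)‖) (volume.restrict Ω)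
  weak : ∀ (j : ℕ) (r : ℚ), ∫ x in Ω, inner ℝ (D.u (t, x)) (D.w j (r, x)) =
    (∫ x in Ω, inner ℝ (D.u₀ x) (D.w j (r, x))) +
      ∫ τ in (0)..t, (-D.pair τ (fun x => D.Dw j (r, x)) +
        ∫ x in Ω, inner ℝ (D.f (τ, x)) (D.w j (r, x)))
  weak_f : ∀ (j : ℕ) (r : ℚ), ∫ x in Ω, inner ℝ (D.f (t, x)) (D.w j (r, x)) =
    c j r + ∫ τ in (0)..t, ∫ x in Ω, inner ℝ (D.g (τ, x)) (D.w j (r, x))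
  w_tendsto : Tendsto (fun k => ∫⁻ x in Ω,
    ENNReal.ofReal (‖D.w (σ k) (t, x) - D.u (t, x)‖ ^ 2)) atTop (𝓝 0)
  Dw_tendsto : Tendsto (fun k => ∫⁻ x in Ω,
    ENNReal.ofReal (m ‖D.Dw (σ k) (t, x) - D.q (t, x)‖)) atTop (𝓝 0)

theorem ae_memLp_section {v : ℝ × Vec n → Vec N}
    (hv : MemLp v 2 (volume.prod (volume.restrict Ω))) (hm : StronglyMeasurable v) :
    ∀ᵐ t : ℝ, MemLp (fun x => v (t, x)) 2 (volume.restrict Ω) := by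
  have h1 : Integrable (fun z => ‖v z‖ ^ 2) (volume.prod (volume.restrict Ω)) :=
    (memLp_two_iff_integrable_sq_norm hv.1).1 hv
  filter_upwards [h1.prod_right_ae] with t ht
  exact (memLp_two_iff_integrable_sq_norm (section_meas hm t).aestronglyMeasurable).2 ht

/-- For a fixed test section the weak formulation is an ordinary differential equation in time,
which holds in integrated form for almost all `t`. Only countably many sections, at rational times,
are used, so one null set suffices. -/
theorem exists_good : ∃ (σ : ℕ → ℕ) (c : ℕ → ℚ → ℝ), ∀ᵐ t : ℝ, t ∈ Ioo 0 T → D.Good σ c t := by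
  have hw : ∀ (j : ℕ) (r : ℝ), ∀ᵐ t : ℝ, t ∈ Ioo 0 T →
      ∫ x in Ω, inner ℝ (D.u (t, x)) (D.w j (r, x)) =
      (∫ x in Ω, inner ℝ (D.u₀ x) (D.w j (r, x))) +
      ∫ τ in (0)..t, (-D.pair τ (fun x => D.Dw j (r, x)) +
        ∫ x in Ω, inner ℝ (D.f (τ, x)) (D.w j (r, x))) := fun j r =>
    ae_eq_add_primitive D.T_pos (integrable_l2_pairing D.u_memLp D.u_off (D.memLp_w j r))
      ((D.integrable_pair (D.meas_Dw j r) (D.integrable_Dw j r)).neg.add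
        (integrable_l2_pairing D.f_memLp D.f_off (D.memLp_w j r))) (D.weak j r)
  have hf : ∀ (j : ℕ) (r : ℚ), ∃ c : ℝ, ∀ᵐ t : ℝ, t ∈ Ioo 0 T →
      ∫ x in Ω, inner ℝ (D.f (t, x)) (D.w j (r, x)) =
      c + ∫ τ in (0)..t, ∫ x in Ω, inner ℝ (D.g (τ, x)) (D.w j (r, x)) := fun j r =>
    exists_ae_eq_add_primitive D.T_pos (integrable_l2_pairing D.f_memLp D.f_off (D.memLp_w j r))
      (integrable_l2_pairing D.g_memLp D.g_off (D.memLp_w j r)) (D.weak_f j r)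
  choose c hc using hf
  have m1 : ∀ j, Measurable fun t => ∫⁻ x in Ω, ENNReal.ofReal (‖D.w j (t, x) - D.u (t, x)‖ ^ 2) :=
    fun j => Measurable.lintegral_prod_right'
      (f := fun z : ℝ × Vec n => ENNReal.ofReal (‖D.w j z - D.u z‖ ^ 2))
      (ENNReal.measurable_ofReal.comp (modular_sq.stronglyMeasurable
        ((D.w_cont j).stronglyMeasurable.sub D.u_meas)).measurable)
  have m2 : ∀ j, Measurable fun t => ∫⁻ x in Ω, ENNReal.ofReal (m ‖D.Dw j (t, x) - D.q (t, x)‖) :=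
    fun j => Measurable.lintegral_prod_right'
      (f := fun z : ℝ × Vec n => ENNReal.ofReal (m ‖D.Dw j z - D.q z‖))
      (ENNReal.measurable_ofReal.comp (D.modular.stronglyMeasurable
        ((D.Dw_cont j).stronglyMeasurable.sub D.q_meas)).measurable)
  obtain ⟨σ, hσ⟩ := exists_subseq_tendsto_zero_of_lintegral (μ := volume.restrict (Ioo 0 T))
    (h := fun j t => (∫⁻ x in Ω, ENNReal.ofReal (‖D.w j (t, x) - D.u (t, x)‖ ^ 2)) +
      ∫⁻ x in Ω, ENNReal.ofReal (m ‖D.Dw j (t, x) - D.q (t, x)‖))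
    (fun j => ((m1 j).add (m2 j)).aemeasurable) (by
      simp_rw [fun j => lintegral_add_left (μ := volume.restrict (Ioo 0 T)) (m1 j)
        fun t => ∫⁻ x in Ω, ENNReal.ofReal (m ‖D.Dw j (t, x) - D.q (t, x)‖)]
      simpa using D.w_tendsto.add D.Dw_tendsto)
  rw [ae_restrict_iff' measurableSet_Ioo] at hσ
  refine ⟨σ, c, ?_⟩
  -- The quantifiers over `j` and rational `r` are countable and may be moved inside "almost
  -- everywhere".
  have hw' : ∀ᵐ t : ℝ, ∀ (j : ℕ) (r : ℚ), t ∈ Ioo 0 T →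
      ∫ x in Ω, inner ℝ (D.u (t, x)) (D.w j (r, x)) =
      (∫ x in Ω, inner ℝ (D.u₀ x) (D.w j (r, x))) +
      ∫ τ in (0)..t, (-D.pair τ (fun x => D.Dw j (r, x)) +
        ∫ x in Ω, inner ℝ (D.f (τ, x)) (D.w j (r, x))) := by
    simp_rw [ae_all_iff]
    exact fun j r => hw j r
  have hc' : ∀ᵐ t : ℝ, ∀ (j : ℕ) (r : ℚ), t ∈ Ioo 0 T →
      ∫ x in Ω, inner ℝ (D.f (t, x)) (D.w j (r, x)) =
      c j r + ∫ τ in (0)..t, ∫ x in Ω, inner ℝ (D.g (τ, x)) (D.w j (r, x)) := by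
    simp_rw [ae_all_iff]
    exact hc
  filter_upwards [hw', hc', hσ, ae_memLp_section D.u_memLp D.u_meas,
    ae_memLp_section D.f_memLp D.f_meas, ae_memLp_section D.g_memLp D.g_meas,
    D.q_int.prod_right_ae] with t h1 h2 h3 h4 h5 h6 h7 ht
  have h8 := h3 ht
  exact ⟨h4, h5, h6, h7, fun j r => h1 j r ht, fun j r => h2 j r ht,
    tendsto_of_tendsto_of_tendsto_of_le_of_le tendsto_const_nhds h8 (fun _ => zero_le)
      fun _ => le_self_add,
    tendsto_of_tendsto_of_tendsto_of_le_of_le tendsto_const_nhds h8 (fun _ => zero_le)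
      fun _ => le_add_self⟩

end SpaceTimeData

/-! ### Sections as elements of `L²` -/

section LpSections

variable {n N : ℕ} {Ω : Set (Vec n)} {v : ℝ × Vec n → Vec N} {S : Set ℝ}

theorem norm_lpSection_sq_le (t : ℝ) :
    ‖lpSection (volume.restrict Ω) S v t‖ ^ 2 ≤ ∫ x in Ω, ‖v (t, x)‖ ^ 2 := by
  by_cases h : t ∈ S ∧ MemLp (fun x => v (t, x)) 2 (volume.restrict Ω)
  · rw [lpSection_of_mem h.1 h.2, norm_toLp_sq]
  · rw [lpSection, dif_neg h]
    simp only [norm_zero, ne_eq, OfNat.ofNat_ne_zero, not_false_eq_true, zero_pow]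
    positivity

theorem integrable_norm_lpSection_sq (hS : StronglyMeasurable (lpSection (volume.restrict Ω) S v))
    (hv : MemLp v 2 (volume.prod (volume.restrict Ω))) :
    Integrable fun t => ‖lpSection (volume.restrict Ω) S v t‖ ^ 2 := by
  have h1 : Integrable (fun z => ‖v z‖ ^ 2) (volume.prod (volume.restrict Ω)) :=
    (memLp_two_iff_integrable_sq_norm hv.1).1 hv
  refine h1.integral_prod_left.mono' (hS.norm.pow 2).aestronglyMeasurable (ae_of_all _ fun t => ?_)
  rw [Real.norm_of_nonneg (by positivity)]
  exact norm_lpSection_sq_le t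

theorem integral_norm_lpSection_sq_le
    (hS : StronglyMeasurable (lpSection (volume.restrict Ω) S v))
    (hv : MemLp v 2 (volume.prod (volume.restrict Ω))) {M : ℝ} (hM : 0 ≤ M)
    (h : eLpNorm v 2 (volume.prod (volume.restrict Ω)) ≤ ENNReal.ofReal M) :
    ∫ t, ‖lpSection (volume.restrict Ω) S v t‖ ^ 2 ≤ M ^ 2 := by
  have h1 : Integrable (fun z => ‖v z‖ ^ 2) (volume.prod (volume.restrict Ω)) :=
    (memLp_two_iff_integrable_sq_norm hv.1).1 hv
  refine (integral_mono (integrable_norm_lpSection_sq hS hv) h1.integral_prod_left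
    fun t => norm_lpSection_sq_le t).trans ?_
  rw [← integral_prod _ h1, ← norm_toLp_sq hv]
  refine pow_le_pow_left₀ (norm_nonneg _) ?_ 2
  rw [Lp.norm_toLp]
  exact ENNReal.toReal_le_of_le_ofReal hM h

theorem intervalIntegrable_lpSection (hS : StronglyMeasurable (lpSection (volume.restrict Ω) S v))
    (hv : MemLp v 2 (volume.prod (volume.restrict Ω))) (a b : ℝ) :
    IntervalIntegrable (lpSection (volume.restrict Ω) S v) volume a b := by
  have h1 : IntervalIntegrable (fun t => 1 + ‖lpSection (volume.restrict Ω) S v t‖ ^ 2) volume a b :=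
    intervalIntegrable_const.add (integrable_norm_lpSection_sq hS hv).intervalIntegrable
  refine h1.mono_fun' hS.aestronglyMeasurable (ae_of_all _ fun t => ?_)
  nlinarith [sq_nonneg (‖lpSection (volume.restrict Ω) S v t‖ - 1)]

theorem integral_inner_lpSection (hS : StronglyMeasurable (lpSection (volume.restrict Ω) S v))
    (hv : MemLp v 2 (volume.prod (volume.restrict Ω))) (a b : ℝ)
    (ψ : Lp (Vec N) 2 ((volume : Measure (Vec n)).restrict Ω)) :
    ∫ τ in a..b, inner ℝ (lpSection (volume.restrict Ω) S v τ) ψ =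
      inner ℝ (∫ τ in a..b, lpSection (volume.restrict Ω) S v τ) ψ := by
  have h := intervalIntegrable_lpSection hS hv a b
  have := (innerSL ℝ ψ).intervalIntegral_comp_comm h
  simpa [real_inner_comm] using this

end LpSections

/-- Convergence of an integral from convergence of the lower integral. -/
theorem tendsto_integral_of_tendsto_lintegral {X : Type*} [MeasurableSpace X] {ν : Measure X}
    {h : ℕ → X → ℝ} (hm : ∀ k, AEStronglyMeasurable (h k) ν) (h0 : ∀ k x, 0 ≤ h k x)
    (hl : Tendsto (fun k => ∫⁻ x, ENNReal.ofReal (h k x) ∂ν) atTop (𝓝 0)) :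
    Tendsto (fun k => ∫ x, h k x ∂ν) atTop (𝓝 0) := by
  simp_rw [fun k => integral_eq_lintegral_of_nonneg_ae (ae_of_all ν (h0 k)) (hm k)]
  simpa [Function.comp_def] using (ENNReal.tendsto_toReal ENNReal.zero_ne_top).comp hl

/-! ### Continuity of the pairings in the test element. -/

namespace SpaceTimeData

variable {n N : ℕ} {Ω : Set (Vec n)} {F : Vec n → Mat n N → ℝ} {m : ℝ → ℝ} {T M : ℝ}
  (D : SpaceTimeData Ω F m T M)

/-- The energy at time `t`. -/
def energy (t : ℝ) : ℝ := ∫ x in Ω, m ‖D.q (t, x)‖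

theorem energy_nonneg (t : ℝ) : 0 ≤ D.energy t :=
  integral_nonneg fun _ => D.modular.nonneg _ (norm_nonneg _)

theorem integrable_energy : Integrable D.energy := D.q_int.integral_prod_left

theorem meas_q (t : ℝ) : AEStronglyMeasurable (fun x => D.q (t, x)) (volume.restrict Ω) :=
  (section_meas D.q_meas t).aestronglyMeasurable

theorem integrable_pair_section {t : ℝ}
    (ht : Integrable (fun x => m ‖D.q (t, x)‖) (volume.restrict Ω)) {Ψ : Vec n → Mat n N}
    (hΨ : AEStronglyMeasurable Ψ (volume.restrict Ω))
    (hΨi : Integrable (fun x => m ‖Ψ x‖) (volume.restrict Ω)) :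
    Integrable (fun x => inner ℝ (D.A x (D.q (t, x))) (Ψ x)) (volume.restrict Ω) := by
  obtain ⟨C, hC, hy⟩ := D.exists_young one_pos
  refine ((ht.const_mul 1).add (hΨi.const_mul C)).mono'
    ((section_meas D.stress_meas t).aestronglyMeasurable.inner hΨ) ?_
  filter_upwards [D.ae_mem] with x hx
  exact hy x hx _ _

theorem abs_pair_sub_le {δ C : ℝ}
    (hy : ∀ x ∈ Ω, ∀ Q w : Mat n N, |inner ℝ (D.A x Q) w| ≤ δ * m ‖Q‖ + C * m ‖w‖) {t : ℝ}
    (ht : Integrable (fun x => m ‖D.q (t, x)‖) (volume.restrict Ω)) {Ψ Ψ' : Vec n → Mat n N}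
    (hΨ : AEStronglyMeasurable Ψ (volume.restrict Ω))
    (hΨi : Integrable (fun x => m ‖Ψ x‖) (volume.restrict Ω))
    (hΨ' : AEStronglyMeasurable Ψ' (volume.restrict Ω))
    (hΨi' : Integrable (fun x => m ‖Ψ' x‖) (volume.restrict Ω)) :
    |D.pair t Ψ - D.pair t Ψ'| ≤ δ * D.energy t + C * ∫ x in Ω, m ‖Ψ x - Ψ' x‖ := by
  have hd := D.modular.integrable_sub hΨ hΨ' hΨi hΨi'
  rw [pair, pair, ← integral_sub (D.integrable_pair_section ht hΨ hΨi)
    (D.integrable_pair_section ht hΨ' hΨi'), energy, ← integral_const_mul, ← integral_const_mul,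
    ← integral_add (ht.const_mul δ) (hd.const_mul C), ← Real.norm_eq_abs]
  refine norm_integral_le_of_norm_le ((ht.const_mul δ).add (hd.const_mul C)) ?_
  filter_upwards [D.ae_mem] with x hx
  rw [← inner_sub_right]
  exact hy x hx _ _

theorem abs_pair_le {C : ℝ}
    (hy : ∀ x ∈ Ω, ∀ Q w : Mat n N, |inner ℝ (D.A x Q) w| ≤ 1 * m ‖Q‖ + C * m ‖w‖) {t : ℝ}
    (ht : Integrable (fun x => m ‖D.q (t, x)‖) (volume.restrict Ω)) {Ψ : Vec n → Mat n N}
    (hΨ : AEStronglyMeasurable Ψ (volume.restrict Ω))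
    (hΨi : Integrable (fun x => m ‖Ψ x‖) (volume.restrict Ω)) :
    |D.pair t Ψ| ≤ D.energy t + C * ∫ x in Ω, m ‖Ψ x‖ := by
  have h := D.abs_pair_sub_le hy ht hΨ hΨi (Ψ' := fun _ => 0) aestronglyMeasurable_const
    (by simp [D.modular.zero])
  simpa [pair] using h

/-- Continuity of the pairing with respect to modular convergence. -/
theorem tendsto_integral_pair {ι : Type*} {l : Filter ι} {Ψ : ι → Vec n → Mat n N}
    {Ψ₀ : Vec n → Mat n N} (hΨ : ∀ i, AEStronglyMeasurable (Ψ i) (volume.restrict Ω))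
    (hΨi : ∀ i, Integrable (fun x => m ‖Ψ i x‖) (volume.restrict Ω))
    (hΨ₀ : AEStronglyMeasurable Ψ₀ (volume.restrict Ω))
    (hΨi₀ : Integrable (fun x => m ‖Ψ₀ x‖) (volume.restrict Ω))
    (hlim : Tendsto (fun i => ∫ x in Ω, m ‖Ψ i x - Ψ₀ x‖) l (𝓝 0)) {t : ℝ} (ht : 0 ≤ t) :
    Tendsto (fun i => ∫ τ in (0)..t, D.pair τ (Ψ i)) l (𝓝 (∫ τ in (0)..t, D.pair τ Ψ₀)) := by
  rw [Metric.tendsto_nhds]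
  intro ε hε
  set Γ := ∫ τ in (0)..t, D.energy τ with hΓ
  have hΓ0 : 0 ≤ Γ := intervalIntegral.integral_nonneg ht fun τ _ => D.energy_nonneg τ
  set δ := ε / (2 * (Γ + 1)) with hδ
  have hδ0 : 0 < δ := by positivity
  have hδΓ : δ * Γ ≤ ε / 2 := by
    have : δ * Γ = ε / 2 * (Γ / (Γ + 1)) := by rw [hδ]; field_simp
    rw [this]
    exact mul_le_of_le_one_right (by positivity) ((div_le_one (by positivity)).2 (by linarith))
  obtain ⟨C, hC, hy⟩ := D.exists_young hδ0
  have hlim' : Tendsto (fun i => t * (C * ∫ x in Ω, m ‖Ψ i x - Ψ₀ x‖)) l (𝓝 0) := by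
    simpa using (hlim.const_mul C).const_mul t
  filter_upwards [hlim'.eventually (gt_mem_nhds (half_pos hε))] with i hi
  have h1 := D.integrable_pair (hΨ i) (hΨi i)
  have h2 := D.integrable_pair hΨ₀ hΨi₀
  rw [Real.dist_eq, ← intervalIntegral.integral_sub h1.intervalIntegrable h2.intervalIntegrable,
    ← Real.norm_eq_abs]
  have h3 := intervalIntegral.norm_integral_le_of_norm_le ht (μ := volume)
    (f := fun τ => D.pair τ (Ψ i) - D.pair τ Ψ₀)
    (g := fun τ => δ * D.energy τ + C * ∫ x in Ω, m ‖Ψ i x - Ψ₀ x‖) (by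
      filter_upwards [D.q_int.prod_right_ae] with τ hτ _
      exact D.abs_pair_sub_le hy hτ (hΨ i) (hΨi i) hΨ₀ hΨi₀)
    ((D.integrable_energy.const_mul δ).intervalIntegrable.add intervalIntegrable_const)
  rw [intervalIntegral.integral_add (D.integrable_energy.const_mul δ).intervalIntegrable
    intervalIntegrable_const, intervalIntegral.integral_const_mul,
    intervalIntegral.integral_const, sub_zero, smul_eq_mul] at h3
  linarith

/-- The sections of the approximations in `L²`. -/
def wLp (j : ℕ) (t : ℝ) : Lp (Vec N) 2 ((volume : Measure (Vec n)).restrict Ω) :=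
  (D.memLp_w j t).toLp _

theorem norm_toLp_sub_sq {v w : Vec n → Vec N} (hv : MemLp v 2 (volume.restrict Ω))
    (hw : MemLp w 2 (volume.restrict Ω)) :
    ‖hv.toLp v - hw.toLp w‖ ^ 2 = ∫ x in Ω, ‖v x - w x‖ ^ 2 := by
  rw [← MemLp.toLp_sub, norm_toLp_sq]
  rfl

theorem continuous_wLp (j : ℕ) : Continuous (D.wLp j) := by
  rw [Metric.continuous_iff]
  intro s ε hε
  obtain ⟨δ, hδ, h⟩ := modular_sq.exists_integral_section_sub_le (ν := volume.restrict Ω)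
    (D.w_cont j) (D.w_supp j) (show 0 < (ε / 2) ^ 2 by positivity)
  refine ⟨δ, hδ, fun t ht => ?_⟩
  have h1 := h t s (by rwa [Real.dist_eq] at ht)
  rw [dist_eq_norm]
  rw [← norm_toLp_sub_sq (D.memLp_w j t) (D.memLp_w j s)] at h1
  exact (abs_le_of_sq_le_sq' h1 (by positivity)).2.trans_lt (half_lt_self hε)

theorem tendsto_Dw (j : ℕ) (s : ℝ) :
    Tendsto (fun t => ∫ x in Ω, m ‖D.Dw j (t, x) - D.Dw j (s, x)‖) (𝓝 s) (𝓝 0) := by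
  rw [Metric.tendsto_nhds]
  intro ε hε
  obtain ⟨δ, hδ, h⟩ := D.modular.exists_integral_section_sub_le (ν := volume.restrict Ω)
    (D.Dw_cont j) (D.Dw_supp j) (half_pos hε)
  filter_upwards [Metric.ball_mem_nhds s hδ] with t ht
  have h1 := h t s (by rwa [Metric.mem_ball, Real.dist_eq] at ht)
  rw [Real.dist_0_eq_abs, abs_of_nonneg (integral_nonneg fun x => D.modular.nonneg _ (norm_nonneg _))]
  exact h1.trans_lt (half_lt_self hε)

end SpaceTimeData

/-! ### The equation tested with sections of the solution. -/

namespace SpaceTimeData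

variable {n N : ℕ} {Ω : Set (Vec n)} {F : Vec n → Mat n N → ℝ} {m : ℝ → ℝ} {T M : ℝ}
  (D : SpaceTimeData Ω F m T M)

/-- A measurable set of full measure consisting of good times. -/
structure GoodSet (σ : ℕ → ℕ) (c : ℕ → ℚ → ℝ) (S : Set ℝ) : Prop where
  measurable : MeasurableSet S
  subset : S ⊆ Ioo 0 T
  ae : ∀ᵐ t : ℝ, t ∈ Ioo 0 T → t ∈ S
  good : ∀ t ∈ S, D.Good σ c t

theorem exists_goodSet : ∃ σ c S, D.GoodSet σ c S := by
  obtain ⟨σ, c, h⟩ := D.exists_good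
  obtain ⟨S, h1, h2, h3, h4⟩ := exists_measurableSet_of_ae h
  exact ⟨σ, c, S, h1, h2, h3, h4⟩

variable {D} {σ : ℕ → ℕ} {c : ℕ → ℚ → ℝ} {S : Set ℝ}

namespace GoodSet

theorem meas_u (G : D.GoodSet σ c S) : StronglyMeasurable (lpSection (volume.restrict Ω) S D.u) :=
  stronglyMeasurable_lpSection G.measurable D.u_meas fun t ht => (G.good t ht).u_memLp

theorem meas_f (G : D.GoodSet σ c S) : StronglyMeasurable (lpSection (volume.restrict Ω) S D.f) :=
  stronglyMeasurable_lpSection G.measurable D.f_meas fun t ht => (G.good t ht).f_memLp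

theorem meas_g (G : D.GoodSet σ c S) : StronglyMeasurable (lpSection (volume.restrict Ω) S D.g) :=
  stronglyMeasurable_lpSection G.measurable D.g_meas fun t ht => (G.good t ht).g_memLp

theorem ae_uIoc (G : D.GoodSet σ c S)
    {a b : ℝ} (ha : a ∈ Ico 0 T) (hb : b ∈ Ico 0 T) : ∀ᵐ τ : ℝ, τ ∈ uIoc a b → τ ∈ S := by
  filter_upwards [G.ae] with τ hτ h
  refine hτ ⟨(le_min ha.1 hb.1).trans_lt h.1, h.2.trans_lt (max_lt ha.2 hb.2)⟩

theorem integral_l2_pairing (G : D.GoodSet σ c S) {v : ℝ × Vec n → Vec N}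
    (hv : ∀ t ∈ S, MemLp (fun x => v (t, x)) 2 (volume.restrict Ω)) (j : ℕ) (r : ℝ) {a b : ℝ}
    (ha : a ∈ Ico 0 T) (hb : b ∈ Ico 0 T) :
    ∫ τ in a..b, ∫ x in Ω, inner ℝ (v (τ, x)) (D.w j (r, x)) =
      ∫ τ in a..b, inner ℝ (lpSection (volume.restrict Ω) S v τ) (D.wLp j r) := by
  refine intervalIntegral.integral_congr_ae ?_
  filter_upwards [G.ae_uIoc ha hb] with τ h1 h2
  rw [lpSection_of_mem (h1 h2) (hv τ (h1 h2)), wLp, inner_toLp]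

theorem tendsto_wLp (G : D.GoodSet σ c S) {s : ℝ} (hs : s ∈ S) :
    Tendsto (fun k => D.wLp (σ k) s) atTop (𝓝 (lpSection (volume.restrict Ω) S D.u s)) := by
  have hu := (G.good s hs).u_memLp
  rw [lpSection_of_mem hs hu, tendsto_iff_norm_sub_tendsto_zero]
  have h1 := tendsto_integral_of_tendsto_lintegral (fun k => modular_sq.aestronglyMeasurable
    (((D.memLp_w (σ k) s).sub hu).1)) (fun k x => sq_nonneg _) (G.good s hs).w_tendsto
  have h2 : Tendsto (fun k => ‖D.wLp (σ k) s - hu.toLp _‖ ^ 2) atTop (𝓝 0) := by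
    refine h1.congr fun k => ?_
    rw [wLp, norm_toLp_sub_sq]
    rfl
  have h3 := h2.sqrt
  simpa [Real.sqrt_sq (norm_nonneg _)] using h3

/-- Both sides depend continuously on the time `s` of the test section and agree at rational times,
hence everywhere. -/
theorem weak_wLp (G : D.GoodSet σ c S) {t : ℝ} (ht : t ∈ S) (j : ℕ) (s : ℝ) :
    inner ℝ (lpSection (volume.restrict Ω) S D.u t - D.u₀_memLp.toLp _) (D.wLp j s) =
      inner ℝ (∫ τ in (0)..t, lpSection (volume.restrict Ω) S D.f τ) (D.wLp j s) -
        ∫ τ in (0)..t, D.pair τ fun x => D.Dw j (s, x) := by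
  have ht' := G.subset ht
  have hc := D.continuous_wLp j
  have hp : Continuous fun s => ∫ τ in (0)..t, D.pair τ fun x => D.Dw j (s, x) :=
    continuous_iff_continuousAt.2 fun s =>
      D.tendsto_integral_pair (fun r => D.meas_Dw j r) (fun r => D.integrable_Dw j r)
        (D.meas_Dw j s) (D.integrable_Dw j s) (D.tendsto_Dw j s) ht'.1.le
  refine congrFun ((Rat.denseRange_cast (𝕜 := ℝ)).equalizer
    (g := fun s => inner ℝ (lpSection (volume.restrict Ω) S D.u t - D.u₀_memLp.toLp _) (D.wLp j s))
    (h := fun s => inner ℝ (∫ τ in (0)..t, lpSection (volume.restrict Ω) S D.f τ) (D.wLp j s) -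
        ∫ τ in (0)..t, D.pair τ fun x => D.Dw j (s, x))
    (continuous_const.inner hc) ((continuous_const.inner hc).sub hp) ?_) s
  ext r
  have h1 := (G.good t ht).weak j r
  rw [intervalIntegral.integral_add
    (D.integrable_pair (D.meas_Dw j r) (D.integrable_Dw j r)).fun_neg.intervalIntegrable
    (integrable_l2_pairing D.f_memLp D.f_off (D.memLp_w j r)).intervalIntegrable,
    G.integral_l2_pairing (fun t ht => (G.good t ht).f_memLp) j r ⟨le_rfl, D.T_pos⟩
      ⟨ht'.1.le, ht'.2⟩, integral_inner_lpSection G.meas_f D.f_memLp,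
    intervalIntegral.integral_neg] at h1
  simp only [Function.comp, inner_sub_left]
  rw [lpSection_of_mem ht (G.good t ht).u_memLp]
  simp only [wLp, inner_toLp] at h1 ⊢
  linarith

/-- At a good time `s` the approximating sections converge to that of `u` in `L²` and, for `D` of
them, in energy. Passing to the limit makes the solution at time `s` an admissible test element,
without any regularity in time. -/
theorem weak_section (G : D.GoodSet σ c S) {t s : ℝ} (ht : t ∈ S) (hs : s ∈ S) :
    inner ℝ (lpSection (volume.restrict Ω) S D.u t - D.u₀_memLp.toLp _)
        (lpSection (volume.restrict Ω) S D.u s) =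
      inner ℝ (∫ τ in (0)..t, lpSection (volume.restrict Ω) S D.f τ)
          (lpSection (volume.restrict Ω) S D.u s) -
        ∫ τ in (0)..t, D.pair τ fun x => D.q (s, x) := by
  have hw := G.tendsto_wLp hs
  have hm := tendsto_integral_of_tendsto_lintegral (fun k => D.modular.aestronglyMeasurable
    ((D.meas_Dw (σ k) s).sub (D.meas_q s))) (fun k x => D.modular.nonneg _ (norm_nonneg _))
    (G.good s hs).Dw_tendsto
  refine tendsto_nhds_unique (tendsto_const_nhds.inner hw) ?_
  simp_rw [G.weak_wLp ht]
  exact (tendsto_const_nhds.inner hw).sub (D.tendsto_integral_pair (fun k => D.meas_Dw (σ k) s)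
    (fun k => D.integrable_Dw (σ k) s) (D.meas_q s) (G.good s hs).q_int hm (G.subset ht).1.le)

theorem weak_f_wLp (G : D.GoodSet σ c S) {t₁ t₂ : ℝ} (h₁ : t₁ ∈ S) (h₂ : t₂ ∈ S) (j : ℕ) (s : ℝ) :
    inner ℝ (lpSection (volume.restrict Ω) S D.f t₂ - lpSection (volume.restrict Ω) S D.f t₁)
        (D.wLp j s) =
      inner ℝ (∫ τ in t₁..t₂, lpSection (volume.restrict Ω) S D.g τ) (D.wLp j s) := by
  have h₁' := G.subset h₁
  have h₂' := G.subset h₂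
  have hc := D.continuous_wLp j
  refine congrFun ((Rat.denseRange_cast (𝕜 := ℝ)).equalizer
    (g := fun s => inner ℝ (lpSection (volume.restrict Ω) S D.f t₂ -
      lpSection (volume.restrict Ω) S D.f t₁) (D.wLp j s))
    (h := fun s => inner ℝ (∫ τ in t₁..t₂, lpSection (volume.restrict Ω) S D.g τ) (D.wLp j s))
    (continuous_const.inner hc) (continuous_const.inner hc) ?_) s
  ext r
  have k1 := (G.good t₁ h₁).weak_f j r
  have k2 := (G.good t₂ h₂).weak_f j r
  have hi := integrable_l2_pairing D.g_memLp D.g_off (D.memLp_w j r)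
  have k3 := intervalIntegral.integral_interval_sub_left (a := 0) (b := t₂) (c := t₁)
    hi.intervalIntegrable hi.intervalIntegrable
  rw [G.integral_l2_pairing (fun t ht => (G.good t ht).g_memLp) j r ⟨h₁'.1.le, h₁'.2⟩
      ⟨h₂'.1.le, h₂'.2⟩, integral_inner_lpSection G.meas_g D.g_memLp] at k3
  simp only [Function.comp, inner_sub_left]
  rw [← k3, lpSection_of_mem h₁ (G.good t₁ h₁).f_memLp, lpSection_of_mem h₂ (G.good t₂ h₂).f_memLp]
  simp only [wLp, inner_toLp]
  linarith

theorem weak_f_section (G : D.GoodSet σ c S)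
    {t₁ t₂ s : ℝ} (h₁ : t₁ ∈ S) (h₂ : t₂ ∈ S) (hs : s ∈ S) :
    inner ℝ (lpSection (volume.restrict Ω) S D.f t₂ - lpSection (volume.restrict Ω) S D.f t₁)
        (lpSection (volume.restrict Ω) S D.u s) =
      ∫ τ in t₁..t₂, inner ℝ (lpSection (volume.restrict Ω) S D.g τ)
        (lpSection (volume.restrict Ω) S D.u s) := by
  rw [integral_inner_lpSection G.meas_g D.g_memLp]
  have hw := G.tendsto_wLp hs
  refine tendsto_nhds_unique (tendsto_const_nhds.inner hw) ?_
  simp_rw [G.weak_f_wLp h₁ h₂]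
  exact tendsto_const_nhds.inner hw

end GoodSet

end SpaceTimeData

/-! ### The energy distance and the abstract evolution equation. -/

namespace SpaceTimeData

variable {n N : ℕ} {Ω : Set (Vec n)} {F : Vec n → Mat n N → ℝ} {m : ℝ → ℝ} {T M : ℝ}
  {D : SpaceTimeData Ω F m T M} {σ : ℕ → ℕ} {c : ℕ → ℚ → ℝ} {S : Set ℝ}

variable (D S) in
/-- The distance of two times in energy. -/
def dist (t s : ℝ) : ℝ :=
  (∫ x in Ω, m ‖D.q (t, x) - D.q (s, x)‖) +
    ‖lpSection (volume.restrict Ω) S D.u t - lpSection (volume.restrict Ω) S D.u s‖ ^ 2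

theorem dist_nonneg (t s : ℝ) : 0 ≤ D.dist S t s :=
  add_nonneg (integral_nonneg fun _ => D.modular.nonneg _ (norm_nonneg _)) (sq_nonneg _)

theorem dist_comm (t s : ℝ) : D.dist S t s = D.dist S s t := by
  simp only [dist, norm_sub_rev]

theorem measurable_integral_pair {Z : ℝ × Vec n → ℝ × Vec n → ℝ}
    (hZ : StronglyMeasurable fun p : (ℝ × ℝ) × Vec n => Z (p.1.1, p.2) (p.1.2, p.2)) :
    Measurable fun p : ℝ × ℝ => ∫ x in Ω, Z (p.1, x) (p.2, x) :=
  (hZ.integral_prod_right' (ν := volume.restrict Ω)).measurable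

theorem measurable_pair :
    Measurable fun p : ℝ × ℝ => D.pair p.1 fun x => D.q (p.2, x) :=
  measurable_integral_pair (Z := fun z z' => inner ℝ (D.A z.2 (D.q z)) (D.q z'))
    ((D.stress_meas.comp_measurable (by fun_prop)).inner (D.q_meas.comp_measurable (by fun_prop)))

namespace GoodSet

theorem measurable_dist (G : D.GoodSet σ c S) : Measurable fun p : ℝ × ℝ => D.dist S p.1 p.2 := by
  refine Measurable.add (measurable_integral_pair (Z := fun z z' => m ‖D.q z - D.q z'‖)
    (D.modular.stronglyMeasurable ((D.q_meas.comp_measurable (by fun_prop)).sub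
      (D.q_meas.comp_measurable (by fun_prop))))) ?_
  exact (((G.meas_u.comp_measurable measurable_fst).sub
    (G.meas_u.comp_measurable measurable_snd)).norm.pow 2).measurable

theorem dist_le (G : D.GoodSet σ c S)
    {C : ℝ} (hadd : ∀ v w : Mat n N, m ‖v - w‖ ≤ C * (m ‖v‖ + m ‖w‖))
    {t s : ℝ} (ht : t ∈ S) (hs : s ∈ S) :
    D.dist S t s ≤ C * (D.energy t + D.energy s) +
      2 * (‖lpSection (volume.restrict Ω) S D.u t‖ ^ 2 +
        ‖lpSection (volume.restrict Ω) S D.u s‖ ^ 2) := by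
  have it := (G.good t ht).q_int
  have is := (G.good s hs).q_int
  refine add_le_add ?_ ?_
  · rw [energy, energy, ← integral_add it is, ← integral_const_mul]
    exact integral_mono (D.modular.integrable_sub (D.meas_q t) (D.meas_q s) it is)
      ((it.add is).const_mul C) fun x => hadd _ _
  · have h1 := norm_sub_le (lpSection (volume.restrict Ω) S D.u t)
      (lpSection (volume.restrict Ω) S D.u s)
    have h2 := pow_le_pow_left₀ (norm_nonneg _) h1 2
    nlinarith [sq_nonneg (‖lpSection (volume.restrict Ω) S D.u t‖ -
      ‖lpSection (volume.restrict Ω) S D.u s‖)]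

theorem ofReal_dist_le (G : D.GoodSet σ c S) {t s : ℝ} (ht : t ∈ S) (hs : s ∈ S) :
    ENNReal.ofReal (D.dist S t s) ≤
      (∫⁻ x in Ω, ENNReal.ofReal (m ‖D.q (t, x) - D.q (s, x)‖)) +
        ∫⁻ x in Ω, ENNReal.ofReal (‖D.u (t, x) - D.u (s, x)‖ ^ 2) := by
  have gt := G.good t ht
  have gs := G.good s hs
  have hsq : Integrable (fun x => ‖D.u (t, x) - D.u (s, x)‖ ^ 2) (volume.restrict Ω) :=
    (memLp_two_iff_integrable_sq_norm (gt.u_memLp.sub gs.u_memLp).1).1 (gt.u_memLp.sub gs.u_memLp)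
  rw [dist, ENNReal.ofReal_add (integral_nonneg fun _ => D.modular.nonneg _ (norm_nonneg _))
    (sq_nonneg _), lpSection_of_mem ht gt.u_memLp, lpSection_of_mem hs gs.u_memLp,
    norm_toLp_sub_sq, ofReal_integral_eq_lintegral_ofReal
      (D.modular.integrable_sub (D.meas_q t) (D.meas_q s) gt.q_int gs.q_int)
      (ae_of_all _ fun x => D.modular.nonneg _ (norm_nonneg _)),
    ofReal_integral_eq_lintegral_ofReal hsq (ae_of_all _ fun x => sq_nonneg _)]

/-- Continuity in the mean of time translations, for the energy of the gradients and for the square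
of the functions. -/
theorem tendsto_dist (G : D.GoodSet σ c S) [DecidablePred (· ∈ S)] :
    Tendsto (fun ε => ∫ t in Ioo 0 (T - ε), if t ∈ S ∧ t + ε ∈ S then D.dist S t (t + ε) else 0)
      (𝓝[>] 0) (𝓝 0) := by
  have h1 := D.modular.tendsto_lintegral_shift D.q_meas D.Dw_cont D.Dw_supp D.Dw_tendsto
  have h2 := modular_sq.tendsto_lintegral_shift D.u_meas D.w_cont D.w_supp D.w_tendsto
  have h3 := h1.add h2
  rw [add_zero] at h3
  have h4 := (ENNReal.tendsto_toReal ENNReal.zero_ne_top).comp h3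
  rw [ENNReal.toReal_zero] at h4
  refine tendsto_of_tendsto_of_tendsto_of_le_of_le' tendsto_const_nhds h4 ?_ ?_
  · refine Eventually.of_forall fun ε => integral_nonneg fun t => ?_
    change (0 : ℝ) ≤ if _ then _ else _
    split_ifs
    exacts [dist_nonneg _ _, le_rfl]
  · filter_upwards [h3.eventually (gt_mem_nhds one_pos)] with ε hε
    rw [integral_eq_lintegral_of_nonneg_ae]
    · simp only [Function.comp]
      refine ENNReal.toReal_mono (hε.trans ENNReal.one_lt_top).ne ?_
      rw [← lintegral_add_left]
      · refine lintegral_mono fun t => ?_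
        by_cases h : t ∈ S ∧ t + ε ∈ S
        · rw [if_pos h]
          exact G.ofReal_dist_le h.1 h.2
        · rw [if_neg h]
          simp
      · have h5 : Measurable fun z : ℝ × Vec n =>
            ENNReal.ofReal (m ‖D.q z - D.q (z.1 + ε, z.2)‖) :=
          ENNReal.measurable_ofReal.comp (D.modular.stronglyMeasurable (D.q_meas.sub
            (D.q_meas.comp_measurable (by fun_prop)))).measurable
        exact h5.lintegral_prod_right'
    · refine ae_of_all _ fun t => ?_
      change (0 : ℝ) ≤ if _ then _ else _
      split_ifs
      exacts [dist_nonneg _ _, le_rfl]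
    · have h5 : MeasurableSet {t | t ∈ S ∧ t + ε ∈ S} :=
        G.measurable.inter (measurableSet_preimage (measurable_add_const ε) G.measurable)
      have h6 : Measurable fun t : ℝ => (t, t + ε) := by fun_prop
      have h7 : Measurable ((fun p : ℝ × ℝ => D.dist S p.1 p.2) ∘ fun t : ℝ => (t, t + ε)) :=
        G.measurable_dist.comp h6
      simp only [Function.comp_def] at h7
      exact (Measurable.ite h5 h7 measurable_const).aestronglyMeasurable

theorem integrable_F (G : D.GoodSet σ c S) {t : ℝ} (ht : t ∈ S) :
    Integrable (fun x => F x (D.q (t, x))) (volume.restrict Ω) := by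
  have gt := G.good t ht
  refine (D.integrable_pair_section gt.q_int (D.meas_q t) gt.q_int).mono' ?_ ?_
  · exact (D.convex.measurable.comp (measurable_id.prodMk
      (section_meas D.q_meas t).measurable)).aestronglyMeasurable
  · filter_upwards [D.ae_mem] with x hx
    rw [Real.norm_of_nonneg (D.convex.nonneg hx _), D.A_eq x hx]
    exact D.convex.le_inner hx _

theorem integral_F_le (G : D.GoodSet σ c S) {t : ℝ} (ht : t ∈ S) :
    ∫ x in Ω, F x (D.q (t, x)) ≤ D.pair t fun x => D.q (t, x) := by
  have gt := G.good t ht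
  refine integral_mono_ae (G.integrable_F ht)
    (D.integrable_pair_section gt.q_int (D.meas_q t) gt.q_int) ?_
  filter_upwards [D.ae_mem] with x hx
  rw [D.A_eq x hx]
  exact D.convex.le_inner hx _

/-- The pointwise subgradient inequality integrated over `Ω`; this is where convexity of the
potential passes to the curve in `L²`. -/
theorem pair_sub_pair_le (G : D.GoodSet σ c S) {t s : ℝ} (ht : t ∈ S) (hs : s ∈ S) :
    (D.pair t fun x => D.q (s, x)) - (D.pair t fun x => D.q (t, x)) ≤
      (∫ x in Ω, F x (D.q (s, x))) - ∫ x in Ω, F x (D.q (t, x)) := by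
  have gt := G.good t ht
  have gs := G.good s hs
  have i1 := D.integrable_pair_section gt.q_int (D.meas_q s) gs.q_int
  have i2 := D.integrable_pair_section gt.q_int (D.meas_q t) gt.q_int
  rw [pair, pair, ← integral_sub i1 i2, ← integral_sub (G.integrable_F hs) (G.integrable_F ht)]
  refine integral_mono_ae (i1.sub i2) ((G.integrable_F hs).sub (G.integrable_F ht)) ?_
  filter_upwards [D.ae_mem] with x hx
  have := D.convex.subgradient x hx (D.q (t, x)) (D.q (s, x))
  simp only [D.A_eq x hx, inner_sub_right] at this ⊢
  linarith

open Classical in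
/-- The solution as a curve in `L²`. -/
theorem exists_evolutionData (G : D.GoodSet σ c S) :
    ∃ E : EvolutionData (Lp (Vec N) 2 ((volume : Measure (Vec n)).restrict Ω)) T M,
      E.U = lpSection (volume.restrict Ω) S D.u ∧ E.S = S := by
  obtain ⟨C₁, hC₁, hy₁⟩ := D.exists_young one_pos
  obtain ⟨C₂, hC₂, hadd⟩ := D.modular.exists_norm_sub_le (Mat n N)
  set U := lpSection (volume.restrict Ω) S D.u with hU
  set f := lpSection (volume.restrict Ω) S D.f with hf
  set g := lpSection (volume.restrict Ω) S D.g with hg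
  have hab : ∀ t s, t ∈ S → s ∈ S →
      |D.pair t fun x => D.q (s, x)| ≤ D.energy t + C₁ * D.energy s := fun t s ht hs =>
    D.abs_pair_le hy₁ (G.good t ht).q_int (D.meas_q s) (G.good s hs).q_int
  -- A common integrable majorant: `C₁` comes from the pairing, `C₂` from the modular of
  -- differences, and the factor `2` from `‖v - w‖² ≤ 2‖v‖² + 2‖w‖²`.
  set α : ℝ → ℝ := fun t =>
    (1 + C₁ + C₂) * D.energy t + 2 * ‖U t‖ ^ 2 + ‖f t‖ ^ 2 + ‖g t‖ ^ 2 with hα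
  have he := D.energy_nonneg
  have hα0 : ∀ t, 0 ≤ α t := fun t => by have := he t; positivity
  have hαe : ∀ t, D.energy t ≤ α t := fun t => by
    simp only [hα]
    nlinarith [mul_nonneg hC₁ (he t), mul_nonneg hC₂ (he t), sq_nonneg ‖U t‖, sq_nonneg ‖f t‖,
      sq_nonneg ‖g t‖]
  refine ⟨{
    U := U, f := f, g := g, u₀ := D.u₀_memLp.toLp _
    -- Setting everything to zero off the good times makes bounds and measurability hold for all
    -- times.
    a := fun t s => if t ∈ S ∧ s ∈ S then D.pair t fun x => D.q (s, x) else 0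
    osc := fun t s => if t ∈ S ∧ s ∈ S then D.dist S t s else 0
    F := fun t => if t ∈ S then ∫ x in Ω, F x (D.q (t, x)) else 0
    α := α, S := S, T_pos := D.T_pos, S_subset := G.subset, S_ae := G.ae
    U_meas := G.meas_u, f_meas := G.meas_f, g_meas := G.meas_g
    α_nonneg := hα0
    α_int := (((D.integrable_energy.const_mul _).add
      ((integrable_norm_lpSection_sq G.meas_u D.u_memLp).const_mul 2)).add
      (integrable_norm_lpSection_sq G.meas_f D.f_memLp)).add
      (integrable_norm_lpSection_sq G.meas_g D.g_memLp)
    U_sq_le := fun t => by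
      have := he t
      have h2 : 0 ≤ (1 + C₁ + C₂) * D.energy t := by positivity
      simp only [hα]
      nlinarith [sq_nonneg ‖U t‖, sq_nonneg ‖f t‖, sq_nonneg ‖g t‖]
    f_sq_le := fun t => by
      have := he t
      have h2 : 0 ≤ (1 + C₁ + C₂) * D.energy t := by positivity
      simp only [hα]
      nlinarith [sq_nonneg ‖U t‖, sq_nonneg ‖f t‖, sq_nonneg ‖g t‖]
    g_sq_le := fun t => by
      have := he t
      have h2 : 0 ≤ (1 + C₁ + C₂) * D.energy t := by positivity
      simp only [hα]
      nlinarith [sq_nonneg ‖U t‖, sq_nonneg ‖f t‖, sq_nonneg ‖g t‖]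
    U_off := fun t ht => lpSection_of_notMem ht
    u₀_le := by
      refine pow_le_pow_left₀ (norm_nonneg _) ?_ 2
      rw [Lp.norm_toLp]
      exact ENNReal.toReal_le_of_le_ofReal D.M_nonneg D.u₀_le
    f_le := integral_norm_lpSection_sq_le G.meas_f D.f_memLp D.M_nonneg D.f_le
    g_le := integral_norm_lpSection_sq_le G.meas_g D.g_memLp D.M_nonneg D.g_le
    a_meas := Measurable.ite ((measurable_fst G.measurable).inter (measurable_snd G.measurable))
      measurable_pair measurable_const
    a_le := fun t s => ?_
    a_off_left := fun t s ht => if_neg fun h => ht h.1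
    a_off_right := fun t s hs => if_neg fun h => hs h.2
    F_meas := ?_
    F_nonneg := fun t => ?_
    F_le := fun t => ?_
    subgradient := fun t ht s hs => by
      simp only [ht, hs, and_self, if_true]
      exact G.pair_sub_pair_le ht hs
    osc_meas := Measurable.ite ((measurable_fst G.measurable).inter (measurable_snd G.measurable))
      G.measurable_dist measurable_const
    osc_nonneg := fun t s => ?_
    osc_le := fun t s => ?_
    osc_symm := fun t s => by simp only [dist_comm t s, @and_comm (t ∈ S)]
    U_sub_le := fun t ht s hs => by
      simp only [ht, hs, and_self, if_true]
      exact le_add_of_nonneg_left (integral_nonneg fun _ => D.modular.nonneg _ (norm_nonneg _))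
    young := fun δ hδ => ?_
    osc_tendsto := G.tendsto_dist
    weak := fun t ht s hs => ?_
    weak_f := fun t₁ h₁ t₂ h₂ s hs => G.weak_f_section h₁ h₂ hs }, rfl, rfl⟩
  · split_ifs with h
    · refine (hab t s h.1 h.2).trans (add_le_add (hαe t) ?_)
      simp only [hα]
      nlinarith [mul_nonneg hC₂ (he s), he s, sq_nonneg ‖U s‖, sq_nonneg ‖f s‖, sq_nonneg ‖g s‖]
    · simpa using add_nonneg (hα0 t) (hα0 s)
  · refine Measurable.ite G.measurable ?_ measurable_const
    have h1 : StronglyMeasurable fun z : ℝ × Vec n => F z.2 (D.q z) :=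
      (D.convex.measurable.comp (measurable_snd.prodMk D.q_meas.measurable)).stronglyMeasurable
    exact (h1.integral_prod_right' (ν := volume.restrict Ω)).measurable
  · split_ifs
    · refine integral_nonneg_of_ae ?_
      filter_upwards [D.ae_mem] with x hx
      exact D.convex.nonneg hx _
    · exact le_rfl
  · by_cases h : t ∈ S
    · simpa [h] using G.integral_F_le h
    · simp [h]
  · split_ifs
    exacts [dist_nonneg _ _, le_rfl]
  · split_ifs with h
    · refine (G.dist_le hadd h.1 h.2).trans ?_
      simp only [hα]
      nlinarith [mul_nonneg hC₁ (he s), he s, mul_nonneg hC₁ (he t), he t, sq_nonneg ‖f s‖,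
        sq_nonneg ‖g s‖, sq_nonneg ‖f t‖, sq_nonneg ‖g t‖]
    · exact add_nonneg (hα0 t) (hα0 s)
  · obtain ⟨C, hC, hy⟩ := D.exists_young hδ
    refine ⟨C, hC, fun τ hτ s hs s' hs' => ?_⟩
    simp only [hτ, hs, hs', and_self, if_true]
    refine (D.abs_pair_sub_le hy (G.good τ hτ).q_int (D.meas_q s) (G.good s hs).q_int
      (D.meas_q s') (G.good s' hs').q_int).trans (add_le_add ?_ ?_)
    · exact mul_le_mul_of_nonneg_left (hαe τ) hδ.le
    · exact mul_le_mul_of_nonneg_left (le_add_of_nonneg_right (sq_nonneg _)) hC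
  · have ht' := G.subset ht
    have h1 := G.weak_section ht hs
    rw [← integral_inner_lpSection G.meas_f D.f_memLp] at h1
    rw [h1, ← intervalIntegral.integral_sub]
    · refine intervalIntegral.integral_congr_ae ?_
      filter_upwards [G.ae_uIoc ⟨le_rfl, D.T_pos⟩ ⟨ht'.1.le, ht'.2⟩] with τ k1 k2
      simp only [k1 k2, hs, and_self, if_true]
      ring
    · have h2 := intervalIntegrable_lpSection G.meas_f D.f_memLp 0 t
      exact ⟨h2.1.inner_const _, h2.2.inner_const _⟩
    · exact (D.integrable_pair (D.meas_q s) (G.good s hs).q_int).intervalIntegrable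

end GoodSet

end SpaceTimeData

/-! ### Test functions -/

section TestFunctions

variable {n N : ℕ}

/-- Linearity of `Q ↦ Du` is all that distinguishes the gradient cases in the estimates, so the
three systems are treated together. -/
theorem SystemKind.exists_clm (k : SystemKind n N) :
    ∃ L : Mat n N →L[ℝ] Mat n N, ∀ Q, k.D Q = L Q := by
  have sym : ∀ n : ℕ, ∃ L : Mat n n →L[ℝ] Mat n n, ∀ Q, symPart Q = L Q := fun n => by
    let l : Mat n n →ₗ[ℝ] Mat n n :=
      { toFun := symPart
        map_add' := fun P Q => by
          ext ij
          simp [symPart, transpose]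
          ring
        map_smul' := fun a Q => by
          ext ij
          simp [symPart, transpose]
          ring }
    exact ⟨LinearMap.toContinuousLinearMap l, fun Q => rfl⟩
  cases k with
  | fullGradient => exact ⟨ContinuousLinearMap.id ℝ _, fun Q => rfl⟩
  | symGradient => exact sym _
  | stokes => exact sym _

theorem spaceGrad_eq {ξ : ℝ × Vec n → Vec N} (hξ : ContDiff ℝ ∞ ξ) (z : ℝ × Vec n) :
    spaceGrad ξ z =
      WithLp.toLp 2 fun ij => (fderiv ℝ ξ z (0, EuclideanSpace.single ij.2 1)) ij.1 := by
  have h1 : HasFDerivAt (fun y => ξ (z.1, y))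
      ((fderiv ℝ ξ z).comp (ContinuousLinearMap.inr ℝ ℝ (Vec n))) z.2 :=
    HasFDerivAt.comp (g := ξ) (f := fun y => (z.1, y)) z.2
      ((hξ.differentiable (by simp)) (z.1, z.2)).hasFDerivAt (hasFDerivAt_prodMk_right z.1 z.2)
  unfold spaceGrad
  rw [h1.fderiv]
  simp

theorem continuous_spaceGrad {ξ : ℝ × Vec n → Vec N} (hξ : ContDiff ℝ ∞ ξ) :
    Continuous (spaceGrad ξ) := by
  rw [funext (spaceGrad_eq hξ)]
  have h := hξ.continuous_fderiv (by simp)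
  refine (PiLp.continuous_toLp 2 _).comp (continuous_pi fun ij => ?_)
  have h2 : Continuous fun z => fderiv ℝ ξ z (0, EuclideanSpace.single ij.2 1) :=
    h.clm_apply continuous_const
  exact (EuclideanSpace.proj ij.1).continuous.comp h2

theorem hasCompactSupport_spaceGrad {ξ : ℝ × Vec n → Vec N} (hξ : ContDiff ℝ ∞ ξ)
    (hc : HasCompactSupport ξ) : HasCompactSupport (spaceGrad ξ) := by
  refine (hc.fderiv (𝕜 := ℝ)).mono fun z hz => ?_
  contrapose! hz
  rw [Function.notMem_support] at hz ⊢
  rw [spaceGrad_eq hξ, hz]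
  ext ij
  simp

variable {Ω : Set (Vec n)} {I : Set ℝ}

/-- The product of a function of time and a section of a test function. -/
def timeProd (χ : ℝ → ℝ) (ψ : ℝ × Vec n → Vec N) (r : ℝ) (z : ℝ × Vec n) : Vec N :=
  χ z.1 • ψ (r, z.2)

/-- The section of `ψ` is frozen at time `r`, so the support in time is governed by `χ` alone. -/
theorem isTest_timeProd {χ : ℝ → ℝ} {ψ : ℝ × Vec n → Vec N} (hχ : ContDiff ℝ ∞ χ)
    (hχc : HasCompactSupport χ) (hχs : tsupport χ ⊆ I) (hψ : IsTest univ Ω ψ) (r : ℝ) :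
    IsTest I Ω (timeProd χ ψ r) := by
  set Z : Set (Vec n) := (fun x => (r, x)) ⁻¹' tsupport ψ with hZ
  have hZc : IsCompact Z := by
    have h1 : IsClosed Z := (isClosed_tsupport ψ).preimage (by fun_prop)
    refine (hψ.compact.isCompact.image continuous_snd).of_isClosed_subset h1 fun x hx => ?_
    exact ⟨(r, x), hx, rfl⟩
  have hsub : tsupport (timeProd χ ψ r) ⊆ tsupport χ ×ˢ Z := by
    refine closure_minimal (fun z hz => ?_) ((isClosed_tsupport χ).prod hZc.isClosed)
    have h1 : χ z.1 ≠ 0 ∧ ψ (r, z.2) ≠ 0 := by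
      rw [Function.mem_support, timeProd, smul_ne_zero_iff] at hz
      exact hz
    exact ⟨subset_tsupport _ h1.1, subset_tsupport ψ h1.2⟩
  refine ⟨?_, (hχc.isCompact.prod hZc).of_isClosed_subset (isClosed_tsupport _) hsub, ?_⟩
  · exact (hχ.comp contDiff_fst).smul (hψ.smooth.comp (contDiff_const.prodMk contDiff_snd))
  · exact hsub.trans (prod_mono hχs fun x hx => (hψ.support hx).2)

theorem spaceGrad_timeProd (χ : ℝ → ℝ) {ψ : ℝ × Vec n → Vec N} (hψ : ContDiff ℝ ∞ ψ) (r : ℝ)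
    (z : ℝ × Vec n) : spaceGrad (timeProd χ ψ r) z = χ z.1 • spaceGrad ψ (r, z.2) := by
  have hd : DifferentiableAt ℝ (fun y => ψ (r, y)) z.2 :=
    ((hψ.comp (contDiff_const.prodMk contDiff_id)).differentiable (by simp)).differentiableAt
  ext ij
  simp only [spaceGrad, timeProd, PiLp.smul_apply]
  rw [fderiv_fun_const_smul hd]
  rfl

theorem timeDeriv_timeProd {χ : ℝ → ℝ} (hχ : ContDiff ℝ ∞ χ) (ψ : ℝ × Vec n → Vec N) (r : ℝ)
    (z : ℝ × Vec n) : timeDeriv (timeProd χ ψ r) z = deriv χ z.1 • ψ (r, z.2) := by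
  simp only [timeDeriv, timeProd]
  exact ((hχ.differentiable (by simp)).differentiableAt.hasDerivAt.smul_const _).deriv

/-- A factor depending only on time commutes with the divergence, so solenoidal test functions stay
solenoidal. -/
theorem constraint_timeProd {k : SystemKind n N} (χ : ℝ → ℝ) {ψ : ℝ × Vec n → Vec N}
    (hψ : ContDiff ℝ ∞ ψ) (hk : k.Constraint ψ) (r : ℝ) : k.Constraint (timeProd χ ψ r) := by
  cases k with
  | fullGradient => trivial
  | symGradient => trivial
  | stokes =>
    intro z
    have h := hk (r, z.2)
    simp only [spaceGrad_timeProd χ hψ, PiLp.smul_apply, smul_eq_mul, ← Finset.mul_sum, h, mul_zero]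

end TestFunctions

/-! ### Representatives on the cylinder -/

section Cylinder

variable {n : ℕ} {Ω : Set (Vec n)} {T : ℝ}

theorem volume_restrict_cylinder (T : ℝ) (Ω : Set (Vec n)) :
    (volume : Measure (ℝ × Vec n)).restrict (cylinder T Ω) =
      (volume.restrict (Ioo 0 T)).prod (volume.restrict Ω) := by
  rw [Measure.prod_restrict]
  rfl

theorem measurableSet_cylinder (hΩ : IsOpen Ω) : MeasurableSet (cylinder T Ω) :=
  measurableSet_Ioo.prod hΩ.measurableSet

/-- Cutting off to the cylinder gives functions that can be translated in time on the whole line. -/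
theorem exists_representative {E : Type*} [NormedAddCommGroup E] (hΩ : IsOpen Ω)
    {v : ℝ × Vec n → E} (hv : AEStronglyMeasurable v (volume.restrict (cylinder T Ω))) :
    ∃ v' : ℝ × Vec n → E, StronglyMeasurable v' ∧ v' =ᵐ[volume.restrict (cylinder T Ω)] v ∧
      ∀ z, z ∉ cylinder T Ω → v' z = 0 := by
  refine ⟨(cylinder T Ω).indicator (hv.mk v),
    hv.stronglyMeasurable_mk.indicator (measurableSet_cylinder hΩ), ?_,
    fun z hz => indicator_of_notMem hz _⟩
  filter_upwards [hv.ae_eq_mk, ae_restrict_mem (measurableSet_cylinder hΩ)] with z h1 h2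
  rw [indicator_of_mem h2, h1]

theorem eLpNorm_representative {E : Type*} [NormedAddCommGroup E] (hΩ : IsOpen Ω)
    {v v' : ℝ × Vec n → E} (h : v' =ᵐ[volume.restrict (cylinder T Ω)] v)
    (h0 : ∀ z, z ∉ cylinder T Ω → v' z = 0) (p : ℝ≥0∞) :
    eLpNorm v' p volume = eLpNorm v p (volume.restrict (cylinder T Ω)) := by
  rw [← eLpNorm_congr_ae h, ← eLpNorm_indicator_eq_eLpNorm_restrict (measurableSet_cylinder hΩ)]
  congr 1
  exact (indicator_eq_self.2 fun z hz => by_contra fun h => hz (h0 z h)).symm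

theorem prod_restrict_le :
    (volume : Measure ℝ).prod ((volume : Measure (Vec n)).restrict Ω) ≤ volume :=
  Measure.prod_mono le_rfl Measure.restrict_le_self

theorem lintegral_cylinder {g : ℝ × Vec n → ℝ≥0∞}
    (hg : AEMeasurable g (volume.restrict (cylinder T Ω))) :
    ∫⁻ z in cylinder T Ω, g z = ∫⁻ t in Ioo 0 T, ∫⁻ x in Ω, g (t, x) := by
  rw [volume_restrict_cylinder] at hg ⊢
  rw [lintegral_prod _ hg]

theorem setIntegral_cylinder_mul {χ : ℝ → ℝ} (hχ : Continuous χ) (hχc : HasCompactSupport χ)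
    {g : ℝ × Vec n → ℝ} (hg : Integrable g (volume.prod (volume.restrict Ω))) :
    ∫ z in cylinder T Ω, χ z.1 * g z = ∫ t in Ioo 0 T, χ t * ∫ x in Ω, g (t, x) := by
  obtain ⟨C, hC⟩ := hχc.exists_bound_of_continuous hχ
  have hg' : Integrable (fun z : ℝ × Vec n => χ z.1 * g z)
      ((volume.restrict (Ioo 0 T)).prod (volume.restrict Ω)) :=
    (hg.mono_measure (Measure.prod_mono Measure.restrict_le_self le_rfl)).bdd_mul
      (hχ.comp continuous_fst).aestronglyMeasurable (ae_of_all _ fun z => hC z.1)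
  rw [volume_restrict_cylinder, integral_prod _ hg']
  simp_rw [integral_const_mul]

end Cylinder

theorem eLpNorm_two_sq {X E : Type*} [MeasurableSpace X] [NormedAddCommGroup E] (ν : Measure X)
    (v : X → E) : eLpNorm v 2 ν ^ 2 = ∫⁻ x, ENNReal.ofReal (‖v x‖ ^ 2) ∂ν := by
  rw [eLpNorm_eq_lintegral_rpow_enorm_toReal (by norm_num) (by norm_num), ← ENNReal.rpow_natCast,
    ← ENNReal.rpow_mul]
  simp [ENNReal.ofReal_pow]

/-! ### From weak solutions to pairings in time. -/

section WeakSolution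

variable {n N : ℕ} {k : SystemKind n N} {φ : ℝ → ℝ} {μ T : ℝ} {Ω : Set (Vec n)}
  {F : Vec n → Mat n N → ℝ} {f f' u : ℝ × Vec n → Vec N} {u₀ : Vec n → Vec N}
  {G : ℝ × Vec n → Mat n N}

/-- Some compactly supported smooth function is at finite `L²` distance on the cylinder. -/
theorem InSolutionSpace.memLp (h : InSolutionSpace k φ μ T Ω u G) :
    MemLp u 2 (volume.restrict (cylinder T Ω)) := by
  obtain ⟨ψ, hψ, hψu, -, -⟩ := h.approx
  obtain ⟨j, hj⟩ := (hψu.eventually (gt_mem_nhds one_pos)).exists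
  have h1 : MemLp (ψ j) 2 (volume.restrict (cylinder T Ω)) :=
    ((hψ j).1.smooth.continuous.memLp_of_hasCompactSupport (hψ j).1.compact).restrict _
  have h2 : MemLp (ψ j - u) 2 (volume.restrict (cylinder T Ω)) :=
    ⟨h1.1.sub h.measurable, hj.trans ENNReal.one_lt_top⟩
  simpa using h1.sub h2

theorem memLp_representative {E : Type*} [NormedAddCommGroup E] (hΩ : IsOpen Ω)
    {v v' : ℝ × Vec n → E} (hv : MemLp v 2 (volume.restrict (cylinder T Ω)))
    (hm : StronglyMeasurable v') (h : v' =ᵐ[volume.restrict (cylinder T Ω)] v)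
    (h0 : ∀ z, z ∉ cylinder T Ω → v' z = 0) : MemLp v' 2 volume :=
  ⟨hm.aestronglyMeasurable, by rw [eLpNorm_representative hΩ h h0]; exact hv.2⟩

/-- The same argument for the modular: the energy of `q` is finite because `q` has finite energy
distance from a compactly supported continuous function. -/
theorem integrable_representative {m : ℝ → ℝ} (hm : Modular m) {q θ : ℝ × Vec n → Mat n N}
    (hq : StronglyMeasurable q) (hq0 : ∀ z, z ∉ cylinder T Ω → q z = 0) (hθ : Continuous θ)
    (hθc : HasCompactSupport θ)
    (hfin : ∫⁻ z in cylinder T Ω, ENNReal.ofReal (m ‖θ z - q z‖) < ⊤) :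
    Integrable (fun z => m ‖q z‖) volume := by
  have m1 := hm.stronglyMeasurable (hθ.stronglyMeasurable.sub hq)
  have h1 : IntegrableOn (fun z => m ‖θ z - q z‖) (cylinder T Ω) := by
    refine ⟨m1.aestronglyMeasurable, ?_⟩
    rw [hasFiniteIntegral_iff_ofReal (ae_of_all _ fun z => hm.nonneg _ (norm_nonneg _))]
    exact hfin
  have h2 : IntegrableOn (fun z => m ‖θ z‖) (cylinder T Ω) :=
    (hm.integrable_of_continuous (ν := volume) hθ hθc).integrableOn
  have h3 := hm.integrable_sub (ν := volume.restrict (cylinder T Ω))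
    hθ.aestronglyMeasurable (hθ.stronglyMeasurable.sub hq).aestronglyMeasurable h2 h1
  have h4 : IntegrableOn (fun z => m ‖q z‖) (cylinder T Ω) := by
    simpa [IntegrableOn] using h3
  refine (integrableOn_iff_integrable_of_support_subset fun z hz => ?_).1 h4
  by_contra h
  exact hz (by simp [hq0 z h, hm.zero])

/-- A weak solution in terms of measurable representatives. -/
theorem IsWeakSolution.exists_spaceTimeData (h : IsWeakSolution k φ μ T Ω F f u₀ u G)
    (hT : 0 < T) (hΩ : IsOpen Ω) (hm : Modular (energyDensity φ μ))
    (hF : ConvexStress Ω F (energyDensity φ μ)) (hu₀ : MemLp u₀ 2 (volume.restrict Ω))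
    (hf : MemW12 T Ω f f') {M : ℝ≥0} (hu₀M : eLpNorm u₀ 2 (volume.restrict Ω) ≤ M)
    (hfM : eLpNorm f 2 (volume.restrict (cylinder T Ω)) ≤ M)
    (hf'M : eLpNorm f' 2 (volume.restrict (cylinder T Ω)) ≤ M) :
    ∃ D : SpaceTimeData Ω F (energyDensity φ μ) T M,
      D.u =ᵐ[volume.restrict (cylinder T Ω)] u ∧ MemLp D.u 2 volume := by
  obtain ⟨ψ, hψ, hψu, -, hψe⟩ := h.mem.approx
  obtain ⟨L, hL⟩ := k.exists_clm
  obtain ⟨A, hAm, hA⟩ := hF.exists_measurable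
  set m := energyDensity φ μ with hmdef
  obtain ⟨u', u'm, u'e, u'0⟩ := exists_representative hΩ h.mem.measurable
  obtain ⟨f₁, f₁m, f₁e, f₁0⟩ := exists_representative hΩ hf.memLp.1
  obtain ⟨g₁, g₁m, g₁e, g₁0⟩ := exists_representative hΩ hf.memLp_deriv.1
  obtain ⟨q, qm, qe, q0⟩ := exists_representative hΩ
    (L.continuous.comp_aestronglyMeasurable h.mem.measurable_grad)
  have hu'2 := memLp_representative hΩ h.mem.memLp u'm u'e u'0
  have hf₁2 := memLp_representative hΩ hf.memLp f₁m f₁e f₁0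
  have hg₁2 := memLp_representative hΩ hf.memLp_deriv g₁m g₁e g₁0
  have off : ∀ z : ℝ × Vec n, z.1 ∉ Ioo 0 T → z ∉ cylinder T Ω := fun z hz h => hz h.1
  obtain ⟨Dψ, hDψ, Dψc, Dψs⟩ : ∃ Dψ : ℕ → ℝ × Vec n → Mat n N,
      (∀ j z, Dψ j z = L (spaceGrad (ψ j) z)) ∧ (∀ j, Continuous (Dψ j)) ∧
        ∀ j, HasCompactSupport (Dψ j) :=
    ⟨fun j z => L (spaceGrad (ψ j) z), fun _ _ => rfl,
      fun j => L.continuous.comp (continuous_spaceGrad (hψ j).1.smooth),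
      fun j => (hasCompactSupport_spaceGrad (hψ j).1.smooth (hψ j).1.compact).comp_left
        (map_zero L)⟩
  -- The convergence in energy is the one needed; it concerns `D` of the gradients, and `q`
  -- represents `D` applied to `G`.
  have hDe : Tendsto (fun j => ∫⁻ z in cylinder T Ω, ENNReal.ofReal (m ‖Dψ j z - q z‖))
      atTop (𝓝 0) := by
    refine hψe.congr fun j => lintegral_congr_ae ?_
    filter_upwards [qe] with z hz
    rw [hL, map_sub, hz, hDψ]
    rfl
  clear_value m
  have hq : Integrable (fun z => m ‖q z‖) volume := by
    obtain ⟨j, hj⟩ := (hDe.eventually (gt_mem_nhds one_pos)).exists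
    exact integrable_representative hm qm q0 (Dψc j) (Dψs j) (hj.trans ENNReal.one_lt_top)
  have hq' := hq.mono_measure (prod_restrict_le (Ω := Ω))
  have l2 : ∀ {v v' : ℝ × Vec n → Vec N}, StronglyMeasurable v' → MemLp v' 2 volume →
      v' =ᵐ[volume.restrict (cylinder T Ω)] v → (∀ z, z ∉ cylinder T Ω → v' z = 0) →
      ∀ (j : ℕ) (r : ℝ) (χ : ℝ → ℝ), Continuous χ → HasCompactSupport χ →
      ∫ z in cylinder T Ω, inner ℝ (v z) (χ z.1 • ψ j (r, z.2)) =
        ∫ t in Ioo 0 T, χ t * ∫ x in Ω, inner ℝ (v' (t, x)) (ψ j (r, x)) := by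
    intro v v' _ hv' hvv' hv'0 j r χ hχ hχc
    have hw : MemLp (fun x => ψ j (r, x)) 2 (volume.restrict Ω) :=
      (((hψ j).1.smooth.continuous.comp (by fun_prop)).memLp_of_hasCompactSupport
        (hasCompactSupport_section (hψ j).1.compact r)).restrict Ω
    rw [← setIntegral_cylinder_mul hχ hχc (integrable_inner_snd (T := T)
      (hv'.mono_measure prod_restrict_le) (fun z hz => hv'0 z (off z hz)) hw)]
    refine integral_congr_ae ?_
    filter_upwards [hvv'] with z hz
    rw [hz, inner_smul_right]
  have meas : ∀ {v : ℝ × Vec n → Vec N}, MemLp v 2 volume →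
      MemLp v 2 (volume.prod (volume.restrict Ω)) := fun hv => hv.mono_measure prod_restrict_le
  have normle : ∀ {v v' : ℝ × Vec n → Vec N}, v' =ᵐ[volume.restrict (cylinder T Ω)] v →
      (∀ z, z ∉ cylinder T Ω → v' z = 0) → eLpNorm v 2 (volume.restrict (cylinder T Ω)) ≤ M →
      eLpNorm v' 2 (volume.prod (volume.restrict Ω)) ≤ ENNReal.ofReal M := by
    intro v v' h1 h2 h3
    rw [ENNReal.ofReal_coe_nnreal]
    refine (eLpNorm_mono_measure _ prod_restrict_le).trans ?_
    rwa [eLpNorm_representative hΩ h1 h2]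
  have pairing : ∀ (j : ℕ) (r : ℝ),
      Integrable (fun z : ℝ × Vec n => inner ℝ (A z.2 (q z)) (Dψ j (r, z.2)))
        (volume.prod (volume.restrict Ω)) := by
    intro j r
    have hc : Continuous fun x => Dψ j (r, x) := (Dψc j).comp (Continuous.prodMk_right r)
    exact hF.integrable_pairing (T := T) hm hΩ hAm hA qm (fun z hz => q0 z (off z hz)) hq'
      (Ψ := fun x => Dψ j (r, x)) hc.aestronglyMeasurable
      (hm.integrable_of_continuous (ν := volume) hc
        (hasCompactSupport_section (Dψs j) r)).restrict
  refine ⟨{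
    u := u', f := f₁, g := g₁, q := q, A := A, u₀ := u₀, w := ψ, Dw := Dψ
    T_pos := hT, M_nonneg := M.2, open_set := hΩ, modular := hm, convex := hF
    A_meas := hAm, A_eq := hA
    u_meas := u'm, f_meas := f₁m, g_meas := g₁m, q_meas := qm
    u_off := fun z hz => u'0 z (off z hz)
    f_off := fun z hz => f₁0 z (off z hz)
    g_off := fun z hz => g₁0 z (off z hz)
    q_off := fun z hz => q0 z (off z hz)
    u_memLp := meas hu'2, f_memLp := meas hf₁2, g_memLp := meas hg₁2
    q_int := hq'
    u₀_memLp := hu₀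
    u₀_le := by rw [ENNReal.ofReal_coe_nnreal]; exact hu₀M
    f_le := normle f₁e f₁0 hfM
    g_le := normle g₁e g₁0 hf'M
    w_cont := fun j => (hψ j).1.smooth.continuous
    w_supp := fun j => (hψ j).1.compact
    Dw_cont := Dψc
    Dw_supp := Dψs
    w_tendsto := ?_
    Dw_tendsto := ?_
    weak := fun j r χ hχ hχc hχs => ?_
    weak_f := fun j r χ hχ hχc hχs => ?_ }, u'e, hu'2⟩
  · have h1 : Tendsto (fun j => eLpNorm (ψ j - u) 2 (volume.restrict (cylinder T Ω)) ^ 2) atTop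
        (𝓝 0) := by
      simpa using ENNReal.Tendsto.pow (n := 2) hψu
    refine h1.congr fun j => ?_
    rw [eLpNorm_two_sq, ← lintegral_cylinder
      (g := fun z => ENNReal.ofReal (‖ψ j z - u' z‖ ^ 2))
      (ENNReal.measurable_ofReal.comp (modular_sq.stronglyMeasurable
        ((hψ j).1.smooth.continuous.stronglyMeasurable.sub u'm)).measurable).aemeasurable]
    refine lintegral_congr_ae ?_
    filter_upwards [u'e] with z hz
    rw [hz]
    rfl
  · refine hDe.congr fun j => lintegral_cylinder (ENNReal.measurable_ofReal.comp
      (hm.stronglyMeasurable ((Dψc j).stronglyMeasurable.sub qm)).measurable).aemeasurable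
  -- Testing with `χ(t) ψ_j(r, x)` separates the variables, and Fubini turns the weak formulation
  -- into one for scalar functions of time.
  · have hξ := h.weak (timeProd χ (ψ j) r) (isTest_timeProd hχ hχc hχs (hψ j).1 r)
      (constraint_timeProd χ (hψ j).1.smooth (hψ j).2 r)
    have hw : MemLp (fun x => ψ j (r, x)) 2 (volume.restrict Ω) :=
      (((hψ j).1.smooth.continuous.comp (by fun_prop)).memLp_of_hasCompactSupport
        (hasCompactSupport_section (hψ j).1.compact r)).restrict Ω
    have hip := pairing j r
    have hif := integrable_inner_snd (T := T) (meas hf₁2) (fun z hz => f₁0 z (off z hz)) hw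
    have h2 : ∫ z in cylinder T Ω, inner ℝ (stress F z.2 (k.D (G z)))
        (k.D (spaceGrad (timeProd χ (ψ j) r) z)) =
        ∫ t in Ioo 0 T, χ t * ∫ x in Ω, inner ℝ (A x (q (t, x))) (Dψ j (r, x)) := by
      rw [← setIntegral_cylinder_mul hχ.continuous hχc hip]
      refine integral_congr_ae ?_
      filter_upwards [qe, ae_restrict_mem (measurableSet_cylinder hΩ)] with z h1 h2
      rw [hA _ h2.2, h1, hL, hL, spaceGrad_timeProd χ (hψ j).1.smooth, map_smul, inner_smul_right,
        hDψ]
    have h3 : ∫ x in Ω, inner ℝ (u₀ x) (timeProd χ (ψ j) r (0, x)) =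
        χ 0 * ∫ x in Ω, inner ℝ (u₀ x) (ψ j (r, x)) := by
      rw [← integral_const_mul]
      simp only [timeProd, inner_smul_right]
    simp only [timeDeriv_timeProd hχ] at hξ
    rw [h2, h3, l2 u'm hu'2 u'e u'0 j r _ (hχ.continuous_deriv (by simp)) hχc.deriv] at hξ
    have h4 : ∫ z in cylinder T Ω, inner ℝ (f z) (timeProd χ (ψ j) r z) =
        ∫ t in Ioo 0 T, χ t * ∫ x in Ω, inner ℝ (f₁ (t, x)) (ψ j (r, x)) :=
      l2 f₁m hf₁2 f₁e f₁0 j r χ hχ.continuous hχc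
    rw [h4] at hξ
    obtain ⟨C, hC⟩ := hχc.exists_bound_of_continuous hχ.continuous
    have i1 : Integrable (fun t => χ t * ∫ x in Ω, inner ℝ (A x (q (t, x))) (Dψ j (r, x)))
        (volume.restrict (Ioo 0 T)) :=
      (hip.integral_prod_left.restrict).bdd_mul hχ.continuous.aestronglyMeasurable (ae_of_all _ hC)
    have i2 : Integrable (fun t => χ t * ∫ x in Ω, inner ℝ (f₁ (t, x)) (ψ j (r, x)))
        (volume.restrict (Ioo 0 T)) :=
      (hif.integral_prod_left.restrict).bdd_mul hχ.continuous.aestronglyMeasurable (ae_of_all _ hC)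
    simp only [mul_add, mul_neg]
    rw [integral_add i1.fun_neg i2, integral_neg]
    linarith
  · have hξ := hf.weakDeriv (timeProd χ (ψ j) r) (isTest_timeProd hχ hχc hχs (hψ j).1 r)
    simp only [timeDeriv_timeProd hχ] at hξ
    rw [l2 f₁m hf₁2 f₁e f₁0 j r _ (hχ.continuous_deriv (by simp)) hχc.deriv] at hξ
    rw [hξ]
    congr 1
    exact l2 g₁m hg₁2 g₁e g₁0 j r χ hχ.continuous hχc

end WeakSolution

/-! ### Difference bounds for weak solutions -/

section Bounds

variable {n N : ℕ} {Ω : Set (Vec n)}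

/-- Transfers a bound for a curve in a normed space to the function on space-time whose sections
have the same norms. -/
theorem eLpNorm_slab_le_of_sections {H : Type*} [NormedAddCommGroup H]
    {v : ℝ × Vec n → Vec N} (hv : StronglyMeasurable v)
    {Y : ℝ → H} {a b B : ℝ} (hY : Integrable fun t => ‖Y t‖ ^ 2)
    (hvY : ∀ᵐ t : ℝ, t ∈ Ioo a b → eLpNorm (fun x => v (t, x)) 2 (volume.restrict Ω) = ‖Y t‖ₑ)
    (hB : ∫ t in Ioo a b, ‖Y t‖ ^ 2 ≤ B) :
    eLpNorm v 2 (slab Ω a b) ≤ ENNReal.ofReal √B := by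
  have h1 := lintegral_eLpNorm_sections Ω hv a b
  have hB0 : 0 ≤ B := (integral_nonneg fun _ => by positivity).trans hB
  have h2 : eLpNorm v 2 (slab Ω a b) ^ (2 : ℝ) ≤ ENNReal.ofReal B := by
    rw [← h1]
    refine le_trans (le_of_eq ?_) (ENNReal.ofReal_le_ofReal hB)
    rw [ofReal_integral_eq_lintegral_ofReal hY.integrableOn (ae_of_all _ fun _ => by positivity)]
    refine setLIntegral_congr_fun_ae measurableSet_Ioo ?_
    filter_upwards [hvY] with t ht hts
    rw [ht hts, ENNReal.ofReal_pow (norm_nonneg _), ofReal_norm, ENNReal.rpow_ofNat]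
  have h3 := ENNReal.rpow_le_rpow h2 (show (0 : ℝ) ≤ 1 / 2 by norm_num)
  rw [← ENNReal.rpow_mul] at h3
  rw [Real.sqrt_eq_rpow, ← ENNReal.ofReal_rpow_of_nonneg hB0 (by norm_num)]
  simpa using h3

/-- At almost every time the increments of the curve in `L²` are the classes of the increments of
`u`, so the abstract bounds carry over with the same constant. -/
theorem SpaceTimeData.differenceBounds {F : Vec n → Mat n N → ℝ} {m : ℝ → ℝ} {T M K : ℝ}
    (D : SpaceTimeData Ω F m T M) (hu : MemLp D.u 2 volume) (hK : 0 ≤ K)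
    (hD : ∀ (H : Type) [NormedAddCommGroup H] [InnerProductSpace ℝ H]
      (D : EvolutionData H T M) (h c : ℝ), 0 < h → 0 < c →
      (∫ t in Ioo c (T - h), ‖D.W h t‖ ^ 2 ≤ K * (h / c) ^ 2) ∧
      ∫ t in Ioo c (T - 2 * h), ‖D.W2 h t‖ ^ 2 ≤ K * (h / c) ^ 3) :
    DifferenceBounds Ω T K D.u := by
  obtain ⟨σ, c, S, G⟩ := D.exists_goodSet
  obtain ⟨E, hEU, -⟩ := G.exists_evolutionData
  have hmem : ∀ t ∈ S, MemLp (fun x => D.u (t, x)) 2 (volume.restrict Ω) := fun t ht =>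
    (G.good t ht).u_memLp
  refine ⟨hK, D.open_set, D.u_meas, hu, fun h c hh hc => ?_, fun h c hh hc => ?_⟩
  · refine eLpNorm_slab_le_of_sections (stronglyMeasurable_timeDiff D.u_meas h)
      (E.integrable_W_sq h) ?_ (hD _ E h c hh hc).1
    filter_upwards [G.ae, ae_comp_add G.ae h] with t h1 h2 ht
    have k1 := h1 ⟨by linarith [ht.1], by linarith [ht.2]⟩
    have k2 := h2 ⟨by linarith [ht.1], by linarith [ht.2]⟩
    rw [EvolutionData.W, hEU, lpSection_of_mem k1 (hmem _ k1), lpSection_of_mem k2 (hmem _ k2),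
      ← MemLp.toLp_sub, Lp.enorm_toLp]
    rfl
  · refine eLpNorm_slab_le_of_sections
      (stronglyMeasurable_timeDiff (stronglyMeasurable_timeDiff D.u_meas h) h)
      (E.integrable_W2_sq h) ?_ (hD _ E h c hh hc).2
    filter_upwards [G.ae, ae_comp_add G.ae h, ae_comp_add (ae_comp_add G.ae h) h] with t h1 h2 h3 ht
    have k1 := h1 ⟨by linarith [ht.1], by linarith [ht.2]⟩
    have k2 := h2 ⟨by linarith [ht.1], by linarith [ht.2]⟩
    have k3 := h3 ⟨by linarith [ht.1], by linarith [ht.2]⟩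
    rw [EvolutionData.W2, EvolutionData.W, EvolutionData.W, hEU, lpSection_of_mem k1 (hmem _ k1),
      lpSection_of_mem k2 (hmem _ k2), lpSection_of_mem k3 (hmem _ k3),
      ← MemLp.toLp_sub, ← MemLp.toLp_sub, ← MemLp.toLp_sub, Lp.enorm_toLp]
    rfl

end Bounds

end DegParabolic
end

/-! ### Assembly of the theorem. -/

open DegParabolic in
theorem mainTheorem1 {n N : ℕ} (k : SystemKind n N) (χ : Characteristics) (p d₁ d₂ : ℝ)
    (T : ℝ) (hT : 0 < T) (M : ℝ≥0) :
    ∃ K : ℝ, ∀ (φ : ℝ → ℝ) (Ω : Set (Vec n)) (F : Vec n → Mat n N → ℝ)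
      (u₀ : Vec n → Vec N) (f f' u : ℝ × Vec n → Vec N) (G : ℝ × Vec n → Mat n N),
      IsOpen Ω →
      ((φ = fun t => t ^ p) ∧ PGrowth p χ Ω F ∨
        OrliczFunction d₁ d₂ φ ∧ OrliczGrowth φ χ Ω F) →
      k.StressSymm Ω F →
      MemLp u₀ 2 (volume.restrict Ω) →
      MemDualOrlicz φ T Ω f →
      MemW12 T Ω f f' →
      eLpNorm u₀ 2 (volume.restrict Ω) ≤ M →
      eLpNorm f 2 (volume.restrict (cylinder T Ω)) ≤ M →
      eLpNorm f' 2 (volume.restrict (cylinder T Ω)) ≤ M →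
      IsWeakSolution k φ χ.μ T Ω F f u₀ u G →
      ∃ u_t : ℝ × Vec n → Vec N,
        AEStronglyMeasurable u_t (volume.restrict (cylinder T Ω)) ∧
        IsWeakTimeDeriv T Ω u u_t ∧
        ∀ a : ℝ, 0 < a →
          nikolskijNorm (1 / 2) 2 a (T - a) Ω u_t ≤ ENNReal.ofReal (K / a ^ 2) := by
  obtain ⟨K, hK, hD⟩ := exists_const_evolution T M hT
  refine ⟨√(K * (100 * T + 25 * T ^ 2)), fun φ Ω F u₀ f f' u G hΩ hgrowth _ hu₀ _ hf hu₀M hfM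
    hf'M hu => ?_⟩
  obtain ⟨hm, hF⟩ := convexStress_of_growth hgrowth
  obtain ⟨D, hDu, hDm⟩ := hu.exists_spaceTimeData hT hΩ hm hF hu₀ hf hu₀M hfM hf'M
  have B := D.differenceBounds hDm hK hD
  -- The initial step `1` is arbitrary: all positive steps give the same limit almost everywhere on
  -- slabs away from the ends of the time interval.
  refine ⟨dyadicDeriv D.u 1, (stronglyMeasurable_dyadicDeriv D.u_meas 1).aestronglyMeasurable,
    fun ζ hζ => ?_, fun a ha => B.nikolskijNorm_le hT ha⟩
  rw [← B.isWeakTimeDeriv one_pos ζ hζ]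
  refine integral_congr_ae ?_
  filter_upwards [hDu] with z hz
  rw [hz]
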